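/- Let $(\varepsilon_i)_{i\in\mathbb Z}$ be i.i.d. real random variables with $E\varepsilon_1=0$, $E\varepsilon_1^8<\infty$, whose law has a density $g$ with respect to Lebesgue measure such that $g(x)>0$ for all $x\in\mathbb R$, $\lim_{x\to+\infty}g(x)=0$, and $g$ is differentiable with $\sup_{x\in\mathbb R}|g'(x)|<\infty$. Let $|\alpha|<1$ and let $u_i=\varepsilon_i-\alpha\varepsilon_{i-1}$, $i\in\mathbb Z$. For $\theta\in\mathbb R$ define the residuals by $\varepsilon_0(\theta)=0$ and $\varepsilon_i(\theta)=u_i+\theta\,\varepsilon_{i-1}(\theta)$ for $i=1,2,\dots$. For $n\ge 1$ and $x\in\mathbb R$ put $$u_n(x,\theta)=\frac1n\sum_{k=1}^n\frac{\partial\varepsilon_k(\theta)}{\partial\theta}\,I(\varepsilon_k(\theta)\le x),\qquad \widetilde u_n(x,\alpha)=\frac1n\sum_{k=1}^n\frac{\partial\varepsilon_k(\theta)}{\partial\theta}\Big|_{\theta=\alpha}\,I(\varepsilon_k\le x).$$ Then for every $\Theta>0$, $$\sup_{x\in\mathbb R,\ |\tau|\le\Theta}\left|n^{1/2}\left[u_n(x,\alpha+n^{-1/2}\tau)-\widetilde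 u_n(x,\alpha)\right]+\tau\,g(x)\,\frac{E\varepsilon_1^2}{1-\alpha^2}\right|\longrightarrow 0$$ in probability as $n\to\infty$. -/

import Mathlib

open MeasureTheory ProbabilityTheory Filter Topology
open scoped ENNReal

noncomputable section

/-- The moving average `u_i = ε_i - α ε_{i-1}`, `i ∈ ℤ`, along one realisation `e` of the
innovations. -/
def maObs (α : ℝ) (e : ℤ → ℝ) (i : ℤ) : ℝ := e i - α * e (i - 1)

/-- The residuals: `ε_0(θ) = 0` and `ε_i(θ) = u_i + θ ε_{i-1}(θ)` for `i = 1, 2, …`. -/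
def maResidual (u : ℤ → ℝ) (θ : ℝ) : ℕ → ℝ
  | 0 => 0
  | i + 1 => u ((i + 1 : ℕ) : ℤ) + θ * maResidual u θ i

/-- `∂ε_k(θ)/∂θ`. -/
def residualDeriv (u : ℤ → ℝ) (θ : ℝ) (k : ℕ) : ℝ := deriv (fun s => maResidual u s k) θ

theorem differentiable_maResidual (u : ℤ → ℝ) (k : ℕ) :
    Differentiable ℝ (fun s => maResidual u s k) := by
  induction k with
  | zero => simp [maResidual]
  | succ k ih =>
    simp only [maResidual]
    fun_prop

/-- The residual weighted empirical process
`u_n(x, θ) = n⁻¹ ∑_{k=1}^n ∂ε_k(θ)/∂θ · I(ε_k(θ) ≤ x)`, in terms of the observations `u`. -/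
def residualProcess (u : ℤ → ℝ) (n : ℕ) (x θ : ℝ) : ℝ :=
  (1 / (n : ℝ)) * ∑ k ∈ Finset.Icc 1 n,
    residualDeriv u θ k * Set.indicator (Set.Iic x) (fun _ => (1 : ℝ)) (maResidual u θ k)

/-- The weighted empirical process of the innovations
`ũ_n(x, α) = n⁻¹ ∑_{k=1}^n ∂ε_k(α)/∂θ · I(ε_k ≤ x)`. -/
def innovationProcess (α : ℝ) (e : ℤ → ℝ) (n : ℕ) (x : ℝ) : ℝ :=
  (1 / (n : ℝ)) * ∑ k ∈ Finset.Icc 1 n,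
    residualDeriv (maObs α e) α k * Set.indicator (Set.Iic x) (fun _ => (1 : ℝ)) (e (k : ℤ))

end

/-! Put s = n^{-1/2} and θ = α + sτ, and write w_k for `score`, ξ_k for `residShift`, H_k for
`envelope` and G for the distribution function of the innovations. Since ε_{k+1}(θ) = ε_{k+1} +
ξ_k(θ), the scaled increment is the sum of s[w_k(θ) 1(ε_{k+1} ≤ x - ξ_k(θ)) - w_k(α) 1(ε_{k+1} ≤
x)], where w_k and ξ_k depend only on ε_0, …, ε_k. Centring the indicators at G splits it into a
martingale and a compensator.

The compensator is expanded at x. The term G(x) s ∑ (w_k(θ) - w_k(α)) is negligible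
(`SmallRemainders.score_sub`). Since ξ_k(θ) ≈ sτ w_k(α), what remains is -τ g(x) n⁻¹ ∑ w_k(α)². Up
to the fading effect of ε_0, w_k(α) is an autoregression with coefficient α driven by the
innovations, so this average tends to Eε₁²/(1 - α²) (`SmallRemainders.score_sq`).

For fixed (x, τ) the shift is O(s) plus a geometrically fading term, so the conditional variances of
the martingale add up to O(s), and `integral_sum_pow_four_le` gives a fourth moment O(1/n)
(`exists_integral_empIncr_pow_four_le`). Uniformity comes from a grid of mesh δ in τ and sδ in x.
About n^{3/4} points in x are used, so a union bound costs n^{3/4}/n → 0. Between grid points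
monotonicity of the indicator is used, which needs nonnegative weights: A H_k is added to the
weights, and the process with weights A H_k alone is subtracted again. The bracketing error is δ
times an average of H_k², so δ is fixed small before n grows.

The grid reaches out to at least δ n^{1/4}. With eight moments, no innovation or residual lies
beyond it, with probability tending to one; for x out there all indicators are constant and g is
small. Every bound is uniform in |θ| ≤ ρ < 1 because all quantities are dominated by the single
envelope H_k. -/

/-- The derivative `∂ε_{k+1}(θ)/∂θ`, a function of `ε_0, …, ε_k`. -/
noncomputable def score (α : ℝ) (e : ℤ → ℝ) (θ : ℝ) (k : ℕ) : ℝ :=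
  residualDeriv (maObs α e) θ (k + 1)

/-- The difference `ε_{k+1}(θ) - ε_{k+1}`, a function of `ε_0, …, ε_k`. -/
noncomputable def residShift (α : ℝ) (e : ℤ → ℝ) (θ : ℝ) (k : ℕ) : ℝ :=
  maResidual (maObs α e) θ (k + 1) - e ((k + 1 : ℕ) : ℤ)

/-- An envelope for the residuals and their derivatives, with geometrically fading memory. -/
noncomputable def envelope (r : ℝ) (e : ℤ → ℝ) : ℕ → ℝ
  | 0 => 1 + |e 0|
  | k + 1 => 1 + |e ((k + 1 : ℕ) : ℤ)| + |e (k : ℤ)| + r * envelope r e k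

/-! ### Recursions for residuals and their derivatives -/

theorem residualDeriv_zero (u : ℤ → ℝ) (θ : ℝ) : residualDeriv u θ 0 = 0 := by
  simp [residualDeriv, maResidual]

theorem residualDeriv_succ (u : ℤ → ℝ) (θ : ℝ) (k : ℕ) :
    residualDeriv u θ (k + 1) = maResidual u θ k + θ * residualDeriv u θ k := by
  have h := ((hasDerivAt_id θ).mul
    (differentiable_maResidual u k).differentiableAt.hasDerivAt).const_add
      (u ((k + 1 : ℕ) : ℤ))
  have := h.deriv
  simp only [residualDeriv, maResidual]
  simp only [id, one_mul] at this
  exact this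

theorem maResidual_succ (α : ℝ) (e : ℤ → ℝ) (θ : ℝ) (k : ℕ) :
    maResidual (maObs α e) θ (k + 1)
      = e ((k + 1 : ℕ) : ℤ) - α * e (k : ℤ) + θ * maResidual (maObs α e) θ k := by
  simp [maResidual, maObs]

theorem maResidual_self (α : ℝ) (e : ℤ → ℝ) (k : ℕ) :
    maResidual (maObs α e) α k = e (k : ℤ) - α ^ k * e 0 := by
  induction k with
  | zero => simp [maResidual]
  | succ k ih => rw [maResidual_succ, ih]; ring

theorem score_eq (α : ℝ) (e : ℤ → ℝ) (θ : ℝ) (k : ℕ) :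
    score α e θ k = maResidual (maObs α e) θ k + θ * residualDeriv (maObs α e) θ k :=
  residualDeriv_succ _ _ _

theorem residShift_eq (α : ℝ) (e : ℤ → ℝ) (θ : ℝ) (k : ℕ) :
    residShift α e θ k = -α * e (k : ℤ) + θ * maResidual (maObs α e) θ k := by
  rw [residShift, maResidual_succ]; ring

/-! ### Envelope bounds, Lipschitz bounds and Taylor expansion in θ -/

section bounds
variable {r ρ : ℝ} {e : ℤ → ℝ}

theorem one_le_envelope (hr : 0 ≤ r) (k : ℕ) : 1 ≤ envelope r e k := by
  induction k with
  | zero => simp [envelope]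
  | succ k ih =>
    have := mul_nonneg hr (zero_le_one.trans ih)
    have h1 := abs_nonneg (e ((k + 1 : ℕ) : ℤ))
    have h2 := abs_nonneg (e (k : ℤ))
    simp only [envelope]; linarith

theorem mul_envelope_le_succ (k : ℕ) : r * envelope r e k ≤ envelope r e (k + 1) := by
  have h1 := abs_nonneg (e ((k + 1 : ℕ) : ℤ))
  have h2 := abs_nonneg (e (k : ℤ))
  simp only [envelope]; linarith

theorem abs_le_envelope (hr : 0 ≤ r) (k : ℕ) : |e (k : ℤ)| ≤ envelope r e k := by
  cases k with
  | zero => simp [envelope]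
  | succ k =>
    have := mul_nonneg hr (zero_le_one.trans (one_le_envelope (e := e) hr k))
    have h2 := abs_nonneg (e (k : ℤ))
    simp only [envelope]; linarith

/-- Lets an initial-value error of size ρ^k |e 0| be written as (ρ/r)^k times the envelope, with a
summable factor. -/
theorem pow_mul_le_envelope (hr : 0 ≤ r) (k : ℕ) : r ^ k * |e 0| ≤ envelope r e k := by
  induction k with
  | zero => simp [envelope]
  | succ k ih =>
    calc r ^ (k + 1) * |e 0| = r * (r ^ k * |e 0|) := by ring
      _ ≤ r * envelope r e k := by gcongr
      _ ≤ _ := mul_envelope_le_succ k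

/-- A contracting recursion driven by the envelope stays below the envelope. -/
theorem recursion_le_envelope (hρ : 0 ≤ ρ) (hr : ρ < r) (hr1 : r ≤ 1) {y : ℕ → ℝ} {K : ℝ}
    (hK : 0 ≤ K) (h0 : y 0 = 0) (hy : ∀ k, |y (k + 1)| ≤ ρ * |y k| + K * envelope r e k) (k : ℕ) :
    |y k| ≤ (r - ρ)⁻¹ * K * envelope r e k ∧ |y (k + 1)| ≤ (r - ρ)⁻¹ * K * envelope r e k := by
  have hc : 0 < r - ρ := sub_pos.2 hr
  have hr0 : 0 ≤ r := hρ.trans hr.le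
  have hstep : ∀ k, |y k| ≤ (r - ρ)⁻¹ * K * envelope r e k →
      |y (k + 1)| ≤ (r - ρ)⁻¹ * K * (r * envelope r e k) := by
    intro k hk
    calc |y (k + 1)| ≤ ρ * ((r - ρ)⁻¹ * K * envelope r e k) + K * envelope r e k :=
          (hy k).trans (by gcongr)
      -- The constant (r - ρ)⁻¹ is the one for which ρ(r - ρ)⁻¹ + 1 = r(r - ρ)⁻¹, so the induction
      -- loses nothing.
      _ = (r - ρ)⁻¹ * K * (r * envelope r e k) := by field_simp; ring
  have hmain : ∀ k, |y k| ≤ (r - ρ)⁻¹ * K * envelope r e k := by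
    intro k
    induction k with
    | zero =>
      rw [h0, abs_zero]
      have := one_le_envelope (e := e) hr0 0
      positivity
    | succ k ih =>
      refine (hstep k ih).trans ?_
      gcongr
      exact mul_envelope_le_succ k
  refine ⟨hmain k, (hstep k (hmain k)).trans ?_⟩
  have := one_le_envelope (e := e) hr0 k
  gcongr
  nlinarith

variable {α θ θ' : ℝ}

theorem abs_maResidual_le (hρr : ρ ≤ r) (hρ : 0 ≤ ρ) (hα : |α| ≤ 1) (hθ : |θ| ≤ ρ) (k : ℕ) :
    |maResidual (maObs α e) θ k| ≤ envelope r e k := by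
  have hr : 0 ≤ r := hρ.trans hρr
  induction k with
  | zero => simpa [maResidual] using zero_le_one.trans (one_le_envelope (e := e) hr 0)
  | succ k ih =>
    rw [maResidual_succ]
    have h1 : |α * e (k : ℤ)| ≤ |e (k : ℤ)| := by
      rw [abs_mul]; exact mul_le_of_le_one_left (abs_nonneg _) hα
    have h2 : |θ * maResidual (maObs α e) θ k| ≤ r * envelope r e k := by
      rw [abs_mul]; exact mul_le_mul (hθ.trans hρr) ih (abs_nonneg _) hr
    have h3 := abs_add_le (e ((k + 1 : ℕ) : ℤ) - α * e (k : ℤ)) (θ * maResidual (maObs α e) θ k)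
    have h4 := abs_sub (e ((k + 1 : ℕ) : ℤ)) (α * e (k : ℤ))
    simp only [envelope]; linarith

/-- The derivative satisfies a recursion with contraction factor |θ| driven by the residual. The
second bound controls the derivative at time k + 1 by the envelope at time k, so the bound depends
on the past only. -/
theorem abs_residualDeriv_le (hρr : ρ < r) (hr1 : r ≤ 1) (hρ : 0 ≤ ρ) (hα : |α| ≤ 1)
    (hθ : |θ| ≤ ρ) (k : ℕ) :
    |residualDeriv (maObs α e) θ k| ≤ (r - ρ)⁻¹ * envelope r e k ∧
    |score α e θ k| ≤ (r - ρ)⁻¹ * envelope r e k := by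
  have := recursion_le_envelope (e := e) hρ hρr hr1 (y := residualDeriv (maObs α e) θ) zero_le_one
    (residualDeriv_zero _ _) (fun k => by
      rw [residualDeriv_succ, add_comm]
      refine (abs_add_le _ _).trans (add_le_add ?_ ?_)
      · rw [abs_mul]; gcongr
      · rw [one_mul]; exact abs_maResidual_le hρr.le hρ hα hθ k) k
  simpa [score] using this

theorem abs_maResidual_sub_le (hρr : ρ < r) (hr1 : r ≤ 1) (hρ : 0 ≤ ρ) (hα : |α| ≤ 1)
    (hθ : |θ| ≤ ρ) (hθ' : |θ'| ≤ ρ) (k : ℕ) :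
    |maResidual (maObs α e) θ k - maResidual (maObs α e) θ' k|
        ≤ (r - ρ)⁻¹ * |θ - θ'| * envelope r e k ∧
    |residShift α e θ k - residShift α e θ' k| ≤ (r - ρ)⁻¹ * |θ - θ'| * envelope r e k := by
  have := recursion_le_envelope (e := e) hρ hρr hr1
    (y := fun k => maResidual (maObs α e) θ k - maResidual (maObs α e) θ' k)
    (abs_nonneg (θ - θ')) (by simp [maResidual]) (fun k => by
      have : maResidual (maObs α e) θ (k + 1) - maResidual (maObs α e) θ' (k + 1)
        = θ * (maResidual (maObs α e) θ k - maResidual (maObs α e) θ' k)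
          + (θ - θ') * maResidual (maObs α e) θ' k := by
        rw [maResidual_succ, maResidual_succ]; ring
      rw [this]
      refine (abs_add_le _ _).trans (add_le_add ?_ ?_)
      · rw [abs_mul]; gcongr
      · rw [abs_mul]; gcongr; exact abs_maResidual_le hρr.le hρ hα hθ' k) k
  simpa [residShift] using this

/-- The difference is driven by the change of the residual and by (θ - θ') times the derivative.
Each is of size (r - ρ)⁻¹ |θ - θ'| times the envelope, whence the factor 2; solving the recursion
costs the second (r - ρ)⁻¹. -/
theorem abs_score_sub_le (hρr : ρ < r) (hr1 : r ≤ 1) (hρ : 0 ≤ ρ) (hα : |α| ≤ 1)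
    (hθ : |θ| ≤ ρ) (hθ' : |θ'| ≤ ρ) (k : ℕ) :
    |score α e θ k - score α e θ' k| ≤ 2 * (r - ρ)⁻¹ ^ 2 * |θ - θ'| * envelope r e k := by
  have hc : 0 < (r - ρ)⁻¹ := inv_pos.2 (sub_pos.2 hρr)
  have := (recursion_le_envelope (e := e) hρ hρr hr1
    (y := fun k => residualDeriv (maObs α e) θ k - residualDeriv (maObs α e) θ' k)
    (K := 2 * (r - ρ)⁻¹ * |θ - θ'|) (by positivity) (by simp [residualDeriv_zero]) (fun k => by
      have : residualDeriv (maObs α e) θ (k + 1) - residualDeriv (maObs α e) θ' (k + 1)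
        = θ * (residualDeriv (maObs α e) θ k - residualDeriv (maObs α e) θ' k)
          + ((maResidual (maObs α e) θ k - maResidual (maObs α e) θ' k)
          + (θ - θ') * residualDeriv (maObs α e) θ' k) := by
        rw [residualDeriv_succ, residualDeriv_succ]; ring
      rw [this]
      have h1 := (abs_maResidual_sub_le (e := e) hρr hr1 hρ hα hθ hθ' k).1
      have h2 := (abs_residualDeriv_le (e := e) hρr hr1 hρ hα hθ' k).1
      refine (abs_add_le _ _).trans (add_le_add ?_ ?_)
      · rw [abs_mul]; gcongr
      · refine (abs_add_le _ _).trans ((add_le_add h1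
          ((abs_mul _ _).le.trans (mul_le_mul_of_nonneg_left h2 (abs_nonneg _)))).trans ?_)
        apply le_of_eq; ring) k).2
  refine this.trans (le_of_eq ?_)
  ring

/-- First-order Taylor expansion of the residuals at `α`. -/
theorem abs_residShift_taylor (hρr : ρ < r) (hr1 : r ≤ 1) (hρ : 0 ≤ ρ) (hα : |α| ≤ 1)
    (hαρ : |α| ≤ ρ) (hθ : |θ| ≤ ρ) (k : ℕ) :
    |residShift α e θ k - residShift α e α k - (θ - α) * score α e α k|
      ≤ (r - ρ)⁻¹ ^ 2 * (θ - α) ^ 2 * envelope r e k := by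
  have hc : 0 < (r - ρ)⁻¹ := inv_pos.2 (sub_pos.2 hρr)
  have := (recursion_le_envelope (e := e) hρ hρr hr1
    (y := fun k => maResidual (maObs α e) θ k - maResidual (maObs α e) α k
      - (θ - α) * residualDeriv (maObs α e) α k)
    (K := (r - ρ)⁻¹ * (θ - α) ^ 2) (by positivity)
    (by simp [residualDeriv_zero, maResidual]) (fun k => by
      have : maResidual (maObs α e) θ (k + 1) - maResidual (maObs α e) α (k + 1)
          - (θ - α) * residualDeriv (maObs α e) α (k + 1)
        = θ * (maResidual (maObs α e) θ k - maResidual (maObs α e) α k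
            - (θ - α) * residualDeriv (maObs α e) α k)
          + (θ - α) ^ 2 * residualDeriv (maObs α e) α k := by
        rw [residualDeriv_succ, maResidual_succ, maResidual_succ]; ring
      rw [this]
      have h2 := (abs_residualDeriv_le (e := e) hρr hr1 hρ hα hαρ k).1
      refine (abs_add_le _ _).trans (add_le_add ?_ ?_)
      · rw [abs_mul]; gcongr
      · rw [abs_mul, abs_of_nonneg (sq_nonneg (θ - α))]
        calc (θ - α) ^ 2 * |residualDeriv (maObs α e) α k|
            ≤ (θ - α) ^ 2 * ((r - ρ)⁻¹ * envelope r e k) := by gcongr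
          _ = _ := by ring) k).2
  have heq : residShift α e θ k - residShift α e α k - (θ - α) * score α e α k
      = maResidual (maObs α e) θ (k + 1) - maResidual (maObs α e) α (k + 1)
          - (θ - α) * residualDeriv (maObs α e) α (k + 1) := by
    simp only [residShift, score]; ring
  rw [heq]
  refine this.trans (le_of_eq ?_)
  ring

theorem residShift_self (α : ℝ) (e : ℤ → ℝ) (k : ℕ) :
    residShift α e α k = -(α ^ (k + 1) * e 0) := by
  rw [residShift, maResidual_self]; ring

/-- The only error at θ = α comes from starting the residuals at 0 instead of ε_0, and it is
forgotten geometrically. -/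
theorem abs_residShift_self_le (hρr : ρ < r) (hρ : 0 ≤ ρ) (hα : |α| ≤ 1)
    (hαρ : |α| ≤ ρ) (k : ℕ) :
    |residShift α e α k| ≤ (ρ / r) ^ k * envelope r e k := by
  have hr : 0 < r := hρ.trans_lt hρr
  rw [residShift_self, abs_neg, abs_mul, abs_pow]
  calc |α| ^ (k + 1) * |e 0| ≤ ρ ^ k * |e 0| := by
        gcongr
        rw [pow_succ]
        exact (mul_le_of_le_one_right (by positivity) hα).trans (by gcongr)
    _ = (ρ / r) ^ k * (r ^ k * |e 0|) := by rw [div_pow]; field_simp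
    _ ≤ _ := by gcongr; exact pow_mul_le_envelope hr.le k

/-- Closed form of the sum of the derivatives. -/
theorem sum_score (α : ℝ) (e : ℤ → ℝ) (θ : ℝ) (hθ : θ ≠ 1) (n : ℕ) :
    ∑ k ∈ Finset.range n, score α e θ k
      = (∑ k ∈ Finset.range n, maObs α e ((k + 1 : ℕ) : ℤ) - maResidual (maObs α e) θ n)
          / (1 - θ) ^ 2 - θ * residualDeriv (maObs α e) θ n / (1 - θ) := by
  have h1 : (1 - θ) ≠ 0 := sub_ne_zero.2 hθ.symm
  induction n with
  | zero => simp [residualDeriv_zero, maResidual]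
  | succ n ih =>
    rw [Finset.sum_range_succ, ih, Finset.sum_range_succ, score, residualDeriv_succ]
    simp only [maResidual]
    field_simp
    ring
end bounds

/-! ### Regularity of the distribution function -/

section density
variable {μ : Measure ℝ} [IsProbabilityMeasure μ] {g : ℝ → ℝ} {C : ℝ}

theorem cdf_sub_cdf_eq_integral (hμ : μ = volume.withDensity (fun x => ENNReal.ofReal (g x)))
    (hg0 : ∀ x, 0 ≤ g x) (hg : Continuous g) {x y : ℝ} (hxy : x ≤ y) :
    cdf μ y - cdf μ x = ∫ t in x..y, g t := by
  have h1 : μ.real (Set.Ioc x y) = cdf μ y - cdf μ x := by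
    have hd : Set.Ioc x y = Set.Iic y \ Set.Iic x := by
      ext t; simp [and_comm]
    rw [cdf_eq_real, cdf_eq_real, hd,
      measureReal_sdiff (Set.Iic_subset_Iic.2 hxy) measurableSet_Iic]
  rw [← h1, measureReal_def, hμ, withDensity_apply _ measurableSet_Ioc,
    intervalIntegral.integral_of_le hxy,
    integral_eq_lintegral_of_nonneg_ae (ae_of_all _ hg0) hg.aestronglyMeasurable]

theorem abs_sub_le_of_abs_deriv_le (hg : Differentiable ℝ g) (hC : ∀ x, |deriv g x| ≤ C)
    (x y : ℝ) : |g y - g x| ≤ C * |y - x| := by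
  have := convex_univ.norm_image_sub_le_of_norm_deriv_le (f := g) (C := C)
    (fun x _ => hg x) (fun x _ => hC x) (Set.mem_univ x) (Set.mem_univ y)
  simpa using this

theorem abs_cdf_taylor_le (hμ : μ = volume.withDensity (fun x => ENNReal.ofReal (g x)))
    (hg0 : ∀ x, 0 ≤ g x) (hg : Differentiable ℝ g) (hC : ∀ x, |deriv g x| ≤ C) (x y : ℝ) :
    |cdf μ y - cdf μ x - (y - x) * g x| ≤ C * (y - x) ^ 2 := by
  have hC0 : 0 ≤ C := (abs_nonneg _).trans (hC 0)
  have hG : cdf μ y - cdf μ x = ∫ t in x..y, g t := by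
    rcases le_total x y with h | h
    · exact cdf_sub_cdf_eq_integral hμ hg0 hg.continuous h
    · rw [intervalIntegral.integral_symm, ← cdf_sub_cdf_eq_integral hμ hg0 hg.continuous h]; ring
  have hI : cdf μ y - cdf μ x - (y - x) * g x = ∫ t in x..y, (g t - g x) := by
    rw [intervalIntegral.integral_sub (hg.continuous.intervalIntegrable _ _) (by simp), hG]
    simp
  rw [hI]
  have := intervalIntegral.norm_integral_le_of_norm_le_const (a := x) (b := y)
    (f := fun t => g t - g x) (C := C * |y - x|) (fun t ht => by
      refine (abs_sub_le_of_abs_deriv_le hg hC x t).trans ?_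
      refine mul_le_mul_of_nonneg_left ?_ hC0
      rw [Set.mem_uIoc] at ht
      rcases ht with ht | ht
      · rw [abs_of_pos (by linarith [ht.1]), abs_of_pos (by linarith [ht.1, ht.2])]
        linarith [ht.2]
      · rw [abs_of_nonpos (by linarith [ht.2]), abs_of_neg (by linarith [ht.1, ht.2])]
        linarith [ht.1])
  refine this.trans (le_of_eq ?_)
  rw [mul_assoc, ← sq, sq_abs]

/-- Over a unit interval the distribution function grows by at most 1, and by at least g x - C. -/
theorem density_le (hμ : μ = volume.withDensity (fun x => ENNReal.ofReal (g x)))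
    (hg0 : ∀ x, 0 ≤ g x) (hg : Differentiable ℝ g) (hC : ∀ x, |deriv g x| ≤ C) (x : ℝ) :
    g x ≤ 1 + C := by
  have h := abs_le.1 (abs_cdf_taylor_le hμ hg0 hg hC x (x + 1))
  have h1 := cdf_le_one μ (x + 1)
  have h2 := cdf_nonneg μ x
  have := h.1
  norm_num at this
  linarith

theorem abs_cdf_sub_le (hμ : μ = volume.withDensity (fun x => ENNReal.ofReal (g x)))
    (hg0 : ∀ x, 0 ≤ g x) (hg : Differentiable ℝ g) (hC : ∀ x, |deriv g x| ≤ C) (x y : ℝ) :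
    |cdf μ y - cdf μ x| ≤ (1 + C) * |y - x| := by
  wlog h : x ≤ y generalizing x y
  · rw [abs_sub_comm, abs_sub_comm y]; exact this y x (le_of_not_ge h)
  rw [cdf_sub_cdf_eq_integral hμ hg0 hg.continuous h]
  refine intervalIntegral.norm_integral_le_of_norm_le_const (f := g) fun t _ => ?_
  rw [Real.norm_of_nonneg (hg0 t)]
  exact density_le hμ hg0 hg hC t

/-- The derivative bound gives h g(x) ≤ G(x + h) + C h². The first term vanishes at -∞, and dividing
by a small fixed h leaves an arbitrarily small bound. -/
theorem tendsto_density_atBot (hμ : μ = volume.withDensity (fun x => ENNReal.ofReal (g x)))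
    (hg0 : ∀ x, 0 ≤ g x) (hg : Differentiable ℝ g) (hC : ∀ x, |deriv g x| ≤ C) :
    Tendsto g atBot (𝓝 0) := by
  have hC0 : 0 ≤ C := (abs_nonneg _).trans (hC 0)
  rw [Metric.tendsto_nhds]
  intro η hη
  obtain ⟨h, hh, hCh⟩ : ∃ h : ℝ, 0 < h ∧ C * h < η / 2 := by
    refine ⟨η / (2 * (C + 1)) , by positivity, ?_⟩
    rw [← mul_div_assoc, div_lt_iff₀ (by positivity)]
    nlinarith
  have ht : Tendsto (fun x => cdf μ (x + h)) atBot (𝓝 0) :=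
    (tendsto_cdf_atBot μ).comp (tendsto_atBot_add_const_right _ _ tendsto_id)
  filter_upwards [ht.eventually_lt_const (show (0 : ℝ) < h * (η / 2) by positivity)] with x hx
  rw [Real.dist_eq, sub_zero, abs_of_nonneg (hg0 x)]
  have h1 := (abs_le.1 (abs_cdf_taylor_le hμ hg0 hg hC x (x + h))).1
  have h2 := cdf_nonneg μ x
  rw [add_sub_cancel_left] at h1
  have : h * g x < h * η := by nlinarith
  exact lt_of_mul_lt_mul_left this hh.le

end density

/-! ### Bracketing of weighted centred indicators and expansion of the compensator -/

section bracketing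

/-- The indicator of `b ≤ x` centred at `G x`. -/
noncomputable def centredInd (G : ℝ → ℝ) (x b : ℝ) : ℝ :=
  Set.indicator (Set.Iic x) (fun _ => (1 : ℝ)) b - G x

theorem indicator_Iic_add (x b ξ : ℝ) :
    Set.indicator (Set.Iic x) (fun _ => (1 : ℝ)) (b + ξ)
      = Set.indicator (Set.Iic (x - ξ)) (fun _ => (1 : ℝ)) b := by
  simp only [Set.indicator_apply, Set.mem_Iic, le_sub_iff_add_le]

variable {G : ℝ → ℝ} {M : ℝ}

theorem abs_centredInd_le (hG0 : ∀ x, 0 ≤ G x) (hG1 : ∀ x, G x ≤ 1) (x b : ℝ) :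
    |centredInd G x b| ≤ 1 := by
  have h0 := hG0 x
  have h1 := hG1 x
  rw [centredInd, Set.indicator_apply, abs_le]
  split_ifs <;> constructor <;> linarith

/-- The indicator is monotone in x; only the centring can decrease, and it is Lipschitz. -/
theorem centredInd_le (hL : ∀ x y, |G y - G x| ≤ M * |y - x|) {x y : ℝ} (hxy : x ≤ y) (b : ℝ) :
    centredInd G x b ≤ centredInd G y b + M * (y - x) := by
  have h1 := (le_abs_self _).trans (hL x y)
  rw [abs_of_nonneg (sub_nonneg.2 hxy)] at h1
  simp only [centredInd, Set.indicator_apply, Set.mem_Iic]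
  split_ifs with h2 h3
  · linarith
  · exact absurd (h2.trans hxy) h3
  · linarith
  · linarith

variable {W Wi W0 H ξ ξi x z h B b : ℝ}

/-- Lowering the grid shift by h(1 + B H) puts the grid threshold to the right of x - ξ, while z ≤ x
handles the subtracted term. Nonnegative weights preserve both inequalities. What is lost is
Lipschitz centring and the change of weight, each at most a constant times h H². -/
theorem bracket_upper (hG0 : ∀ x, 0 ≤ G x) (hG1 : ∀ x, G x ≤ 1)
    (hL : ∀ x y, |G y - G x| ≤ M * |y - x|) (hM : 0 ≤ M) (hB : 0 ≤ B) (hH : 1 ≤ H) (hh : 0 ≤ h)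
    (hWi : 0 ≤ Wi) (hWi' : Wi ≤ B * H) (hW0 : 0 ≤ W0) (hW0' : W0 ≤ B * H)
    (hW : |W - Wi| ≤ B * h * H) (hξ : |ξ - ξi| ≤ B * h * H) (hx1 : z ≤ x) (hx2 : x ≤ z + h) :
    W * centredInd G (x - ξ) b - W0 * centredInd G x b ≤
      (Wi * centredInd G (z - (ξi - h * (1 + B * H))) b - W0 * centredInd G z b)
        + (B * M * (2 + 2 * B) + B) * h * H ^ 2 := by
  obtain ⟨hξ1, hξ2⟩ := abs_le.1 hξ
  have h1 : W * centredInd G (x - ξ) b ≤ Wi * centredInd G (x - ξ) b + B * h * H := by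
    have := abs_mul (W - Wi) (centredInd G (x - ξ) b)
    have h2 : |(W - Wi) * centredInd G (x - ξ) b| ≤ B * h * H * 1 := by
      rw [this]; exact mul_le_mul hW (abs_centredInd_le hG0 hG1 _ _) (abs_nonneg _) (by positivity)
    have h3 := le_abs_self ((W - Wi) * centredInd G (x - ξ) b)
    linarith
  have h2 : Wi * centredInd G (x - ξ) b
      ≤ Wi * centredInd G (z - (ξi - h * (1 + B * H))) b + B * H * (M * (h * ((1 + 2 * B) * H))) := by
    have hc := centredInd_le hL (x := x - ξ) (y := z - (ξi - h * (1 + B * H))) (by nlinarith) b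
    -- The gap is at most h + 2 B h H, and H ≥ 1 absorbs the lone h.
    have hd : z - (ξi - h * (1 + B * H)) - (x - ξ) ≤ h * ((1 + 2 * B) * H) := by nlinarith
    calc Wi * centredInd G (x - ξ) b
        ≤ Wi * (centredInd G (z - (ξi - h * (1 + B * H))) b
            + M * (z - (ξi - h * (1 + B * H)) - (x - ξ))) := by gcongr
      _ ≤ Wi * (centredInd G (z - (ξi - h * (1 + B * H))) b + M * (h * ((1 + 2 * B) * H))) := by
          gcongr
      _ = Wi * centredInd G (z - (ξi - h * (1 + B * H))) b + Wi * (M * (h * ((1 + 2 * B) * H))) := by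
          ring
      _ ≤ _ := by gcongr
  have h3 : W0 * centredInd G z b ≤ W0 * centredInd G x b + B * H * (M * h) := by
    have hc := centredInd_le hL hx1 b
    calc W0 * centredInd G z b ≤ W0 * (centredInd G x b + M * (x - z)) := by gcongr
      _ ≤ W0 * (centredInd G x b + M * h) := by gcongr; linarith
      _ = W0 * centredInd G x b + W0 * (M * h) := by ring
      _ ≤ _ := by gcongr
  have h4 : B * H * (M * (h * ((1 + 2 * B) * H))) + B * H * (M * h) + B * h * H
      ≤ (B * M * (2 + 2 * B) + B) * h * H ^ 2 := by
    have e1 : B * H * (M * h) ≤ B * H * (M * h) * H := le_mul_of_one_le_right (by positivity) hH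
    have e2 : B * h * H ≤ B * h * H * H := le_mul_of_one_le_right (by positivity) hH
    nlinarith
  linarith

/-- Mirror image of `bracket_upper`: the grid point lies to the right of x and the shift is raised.
-/
theorem bracket_lower (hG0 : ∀ x, 0 ≤ G x) (hG1 : ∀ x, G x ≤ 1)
    (hL : ∀ x y, |G y - G x| ≤ M * |y - x|) (hM : 0 ≤ M) (hB : 0 ≤ B) (hH : 1 ≤ H) (hh : 0 ≤ h)
    (hWi : 0 ≤ Wi) (hWi' : Wi ≤ B * H) (hW0 : 0 ≤ W0) (hW0' : W0 ≤ B * H)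
    (hW : |W - Wi| ≤ B * h * H) (hξ : |ξ - ξi| ≤ B * h * H) (hx1 : x ≤ z) (hx2 : z ≤ x + h) :
    (Wi * centredInd G (z - (ξi + h * (1 + B * H))) b - W0 * centredInd G z b)
        - (B * M * (2 + 2 * B) + B) * h * H ^ 2 ≤
      W * centredInd G (x - ξ) b - W0 * centredInd G x b := by
  obtain ⟨hξ1, hξ2⟩ := abs_le.1 hξ
  have h1 : Wi * centredInd G (x - ξ) b ≤ W * centredInd G (x - ξ) b + B * h * H := by
    have := abs_mul (W - Wi) (centredInd G (x - ξ) b)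
    have h2 : |(W - Wi) * centredInd G (x - ξ) b| ≤ B * h * H * 1 := by
      rw [this]; exact mul_le_mul hW (abs_centredInd_le hG0 hG1 _ _) (abs_nonneg _) (by positivity)
    have h3 := neg_abs_le ((W - Wi) * centredInd G (x - ξ) b)
    linarith
  have h2 : Wi * centredInd G (z - (ξi + h * (1 + B * H))) b
      ≤ Wi * centredInd G (x - ξ) b + B * H * (M * (h * ((1 + 2 * B) * H))) := by
    have hc := centredInd_le hL (x := z - (ξi + h * (1 + B * H))) (y := x - ξ) (by nlinarith) b
    have hd : x - ξ - (z - (ξi + h * (1 + B * H))) ≤ h * ((1 + 2 * B) * H) := by nlinarith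
    calc Wi * centredInd G (z - (ξi + h * (1 + B * H))) b
        ≤ Wi * (centredInd G (x - ξ) b
            + M * (x - ξ - (z - (ξi + h * (1 + B * H))))) := by gcongr
      _ ≤ Wi * (centredInd G (x - ξ) b + M * (h * ((1 + 2 * B) * H))) := by
          gcongr
      _ = Wi * centredInd G (x - ξ) b + Wi * (M * (h * ((1 + 2 * B) * H))) := by
          ring
      _ ≤ _ := by gcongr
  have h3 : W0 * centredInd G x b ≤ W0 * centredInd G z b + B * H * (M * h) := by
    have hc := centredInd_le hL hx1 b
    calc W0 * centredInd G x b ≤ W0 * (centredInd G z b + M * (z - x)) := by gcongr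
      _ ≤ W0 * (centredInd G z b + M * h) := by gcongr; linarith
      _ = W0 * centredInd G z b + W0 * (M * h) := by ring
      _ ≤ _ := by gcongr
  have h4 : B * H * (M * (h * ((1 + 2 * B) * H))) + B * H * (M * h) + B * h * H
      ≤ (B * M * (2 + 2 * B) + B) * h * H ^ 2 := by
    have e1 : B * H * (M * h) ≤ B * H * (M * h) * H := le_mul_of_one_le_right (by positivity) hH
    have e2 : B * h * H ≤ B * h * H * H := le_mul_of_one_le_right (by positivity) hH
    nlinarith
  linarith

/-- One summand of the compensator, expanded to first order. -/
theorem compensator_term_le {g : ℝ → ℝ} {C L s q w w0 η : ℝ} (hg : ∀ x, |g x| ≤ M)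
    (hT : ∀ x y, |G y - G x - (y - x) * g x| ≤ C * (y - x) ^ 2) (hC : 0 ≤ C)
    (hL : 0 ≤ L) (hs : 0 ≤ s) (hs1 : s ≤ 1) (hq : 0 ≤ q) (hq1 : q ≤ 1) (hH : 1 ≤ H)
    (hL1 : 1 ≤ L) (hw : |w| ≤ L * H) (hw0 : |w0| ≤ L * H) (hww : |w - w0| ≤ L * s * H)
    (hξ : |ξ| ≤ (L * s + q) * H) (hξw : |ξ - η * w0| ≤ (q + L * s ^ 2) * H) (x : ℝ) :
    |w * G (x - ξ) - w0 * G x + g x * (η * w0 ^ 2) - (w - w0) * G x|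
      ≤ (2 * M * L ^ 2 + 2 * C * L ^ 3) * ((s ^ 2 + q) * H ^ 3) := by
  have hM : 0 ≤ M := (abs_nonneg _).trans (hg 0)
  have hH0 : 0 ≤ H := zero_le_one.trans hH
  have hT' := hT x (x - ξ)
  have hLL : L ≤ L ^ 2 := by nlinarith
  -- Once (w - w0) G x is removed there remain the Taylor remainder of G, the product of two small
  -- factors (w - w0) ξ, and the error of ξ ≈ η w0; each is of second order or fading.
  have e : w * G (x - ξ) - w0 * G x + g x * (η * w0 ^ 2) - (w - w0) * G x
      = w * (G (x - ξ) - G x - (x - ξ - x) * g x)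
        + -g x * ((w - w0) * ξ + w0 * (ξ - η * w0)) := by ring
  have b1 : |w * (G (x - ξ) - G x - (x - ξ - x) * g x)|
      ≤ 2 * C * L ^ 3 * ((s ^ 2 + q) * H ^ 3) := by
    have hx2 : ξ ^ 2 ≤ 2 * L ^ 2 * (s ^ 2 + q) * H ^ 2 := by
      calc ξ ^ 2 = |ξ| ^ 2 := (sq_abs _).symm
        _ ≤ ((L * s + q) * H) ^ 2 := by gcongr
        _ ≤ (2 * L ^ 2 * (s ^ 2 + q)) * H ^ 2 := by
          rw [mul_pow]; gcongr
          have : q ^ 2 ≤ L ^ 2 * q := by nlinarith [mul_nonneg hq (sub_nonneg.2 hq1), sq_nonneg L]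
          nlinarith [sq_nonneg (L * s - q)]
    rw [abs_mul]
    calc _ ≤ (L * H) * (C * (x - ξ - x) ^ 2) := by gcongr
      _ = L * H * (C * ξ ^ 2) := by ring
      _ ≤ L * H * (C * (2 * L ^ 2 * (s ^ 2 + q) * H ^ 2)) := by gcongr
      _ = _ := by ring
  have b2 : |(w - w0) * ξ + w0 * (ξ - η * w0)| ≤ 2 * L ^ 2 * ((s ^ 2 + q) * H ^ 3) := by
    have c1 : |(w - w0) * ξ| ≤ L ^ 2 * (s ^ 2 + q) * H ^ 2 := by
      rw [abs_mul]
      calc _ ≤ L * s * H * ((L * s + q) * H) := by gcongr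
        _ = (L * s * (L * s + q)) * H ^ 2 := by ring
        _ ≤ (L ^ 2 * (s ^ 2 + q)) * H ^ 2 := by
          refine mul_le_mul_of_nonneg_right ?_ (sq_nonneg H)
          have h1 : L * s ≤ L ^ 2 := (mul_le_of_le_one_right hL hs1).trans hLL
          have h2 : L * s * q ≤ L ^ 2 * q := mul_le_mul_of_nonneg_right h1 hq
          linarith
    have c2 : |w0 * (ξ - η * w0)| ≤ L ^ 2 * (s ^ 2 + q) * H ^ 2 := by
      rw [abs_mul]
      calc _ ≤ L * H * ((q + L * s ^ 2) * H) := by gcongr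
        _ = (L * (q + L * s ^ 2)) * H ^ 2 := by ring
        _ ≤ (L ^ 2 * (s ^ 2 + q)) * H ^ 2 := by
          refine mul_le_mul_of_nonneg_right ?_ (sq_nonneg H)
          have h1 : L * q ≤ L ^ 2 * q := mul_le_mul_of_nonneg_right hLL hq
          linarith
    calc _ ≤ _ := abs_add_le _ _
      _ ≤ 2 * L ^ 2 * ((s ^ 2 + q) * H ^ 2) := by linarith
      _ ≤ _ := by gcongr; norm_num
  rw [e]
  refine (abs_add_le _ _).trans ?_
  have b3 : |-g x * ((w - w0) * ξ + w0 * (ξ - η * w0))|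
      ≤ M * (2 * L ^ 2 * ((s ^ 2 + q) * H ^ 3)) := by
    rw [abs_mul, abs_neg]; gcongr; exact hg x
  linarith

end bracketing

/-! ### Integration over the next innovation and a fourth-moment inequality -/

section core
variable {Ω : Type*} [MeasurableSpace Ω] {P : Measure Ω}

theorem integrable_of_abs_le {f F : Ω → ℝ} (hf : Measurable f) (hF : Integrable F P)
    (h : ∀ ω, |f ω| ≤ F ω) : Integrable f P :=
  hF.mono' hf.aestronglyMeasurable (ae_of_all _ h)

theorem indepFun_succ_of_measurable_natural {β : Type*} [MeasurableSpace β] {e : ℕ → Ω → ℝ}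
    (he : ∀ k, Measurable (e k)) (hind : iIndepFun e P) {k : ℕ} {X : Ω → β}
    (hX : Measurable[(Filtration.natural e fun i => (he i).stronglyMeasurable) k] X) :
    IndepFun X (e (k + 1)) P := by
  have h := (hind.indep_comap_natural_of_lt (fun i => (he i).stronglyMeasurable)
    (Nat.lt_succ_self k)).symm
  rw [IndepFun_iff_Indep]
  exact indep_of_indep_of_le_left h hX.comap_le

variable [IsProbabilityMeasure P]

/-- By independence the joint law is a product, so Fubini integrates Y out with X frozen. This takes
the place of conditional expectations in what follows. -/
theorem integral_comp_prodMk_of_indepFun {β : Type*} [MeasurableSpace β] {X : Ω → β} {Y : Ω → ℝ}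
    (hX : Measurable X) (hY : Measurable Y) (hXY : IndepFun X Y P) {f : β × ℝ → ℝ}
    (hf : Measurable f) (hint : Integrable (fun ω => f (X ω, Y ω)) P) :
    ∫ ω, f (X ω, Y ω) ∂P = ∫ ω, (∫ t, f (X ω, t) ∂(P.map Y)) ∂P := by
  have hmap := (indepFun_iff_map_prod_eq_prod_map_map hX.aemeasurable hY.aemeasurable).1 hXY
  have hP1 : IsProbabilityMeasure (P.map X) := Measure.isProbabilityMeasure_map hX.aemeasurable
  have hP2 : IsProbabilityMeasure (P.map Y) := Measure.isProbabilityMeasure_map hY.aemeasurable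
  have hi : Integrable f ((P.map X).prod (P.map Y)) := by
    rw [← hmap, integrable_map_measure hf.aestronglyMeasurable (hX.prodMk hY).aemeasurable]
    exact hint
  calc ∫ ω, f (X ω, Y ω) ∂P = ∫ z, f z ∂(P.map fun ω => (X ω, Y ω)) :=
        (integral_map (hX.prodMk hY).aemeasurable hf.aestronglyMeasurable).symm
    _ = ∫ x, (∫ t, f (x, t) ∂(P.map Y)) ∂(P.map X) := by rw [hmap, integral_prod _ hi]
    _ = _ := integral_map hX.aemeasurable hi.integral_prod_left.aestronglyMeasurable

theorem integral_mul_comp_eq_zero {β : Type*} [MeasurableSpace β] {X : Ω → β} {Y Z : Ω → ℝ}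
    (hX : Measurable X) (hY : Measurable Y) (hZ : Measurable Z)
    (hind : IndepFun (fun ω => (Z ω, X ω)) Y P) {φ : β × ℝ → ℝ} (hφ : Measurable φ)
    (h0 : ∀ x, ∫ t, φ (x, t) ∂(P.map Y) = 0)
    (hint : Integrable (fun ω => Z ω * φ (X ω, Y ω)) P) :
    ∫ ω, Z ω * φ (X ω, Y ω) ∂P = 0 := by
  have := integral_comp_prodMk_of_indepFun (hZ.prodMk hX) hY hind
    (f := fun z : (ℝ × β) × ℝ => z.1.1 * φ (z.1.2, z.2)) (by fun_prop) hint
  rw [this]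
  simp [integral_const_mul, h0]

/-- Conditional-variance bound in integrated form: Z carries the past sum and v the bound on the
conditional second moment. -/
theorem integral_mul_comp_le {β : Type*} [MeasurableSpace β] {X : Ω → β} {Y Z : Ω → ℝ}
    (hX : Measurable X) (hY : Measurable Y) (hZ : Measurable Z) (hZ0 : ∀ ω, 0 ≤ Z ω)
    (hind : IndepFun (fun ω => (Z ω, X ω)) Y P) {ψ : β × ℝ → ℝ} (hψ : Measurable ψ)
    (hψ0 : ∀ x, 0 ≤ ψ x) {v : β → ℝ} (hv : ∀ x, ∫ t, ψ (x, t) ∂(P.map Y) ≤ v x)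
    (hint : Integrable (fun ω => Z ω * ψ (X ω, Y ω)) P)
    (hint' : Integrable (fun ω => Z ω * v (X ω)) P) :
    ∫ ω, Z ω * ψ (X ω, Y ω) ∂P ≤ ∫ ω, Z ω * v (X ω) ∂P := by
  have := integral_comp_prodMk_of_indepFun (hZ.prodMk hX) hY hind
    (f := fun z : (ℝ × β) × ℝ => z.1.1 * ψ (z.1.2, z.2)) (by fun_prop) hint
  rw [this]
  simp only [integral_const_mul]
  refine integral_mono_of_nonneg (ae_of_all _ fun ω => ?_) hint' (ae_of_all _ fun ω => ?_)
  · exact mul_nonneg (hZ0 ω) (integral_nonneg fun t => hψ0 _)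
  · exact mul_le_mul_of_nonneg_left (hv _) (hZ0 ω)

theorem add_pow_four_le (a b : ℝ) : (a + b) ^ 4 ≤ 8 * (a ^ 4 + b ^ 4) := by
  have h1 : (a + b) ^ 2 ≤ 2 * (a ^ 2 + b ^ 2) := by nlinarith [sq_nonneg (a - b)]
  have h2 : ((a + b) ^ 2) ^ 2 ≤ (2 * (a ^ 2 + b ^ 2)) ^ 2 := by gcongr
  nlinarith [sq_nonneg (a ^ 2 - b ^ 2)]

theorem abs_pow_mul_pow_le (a b : ℝ) :
    |a ^ 3 * b| ≤ a ^ 4 + b ^ 4 ∧ |a ^ 2 * b ^ 2| ≤ a ^ 4 + b ^ 4 := by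
  have h2 : |a ^ 2 * b ^ 2| ≤ a ^ 4 + b ^ 4 := by
    rw [abs_of_nonneg (by positivity)]
    nlinarith [sq_nonneg (a ^ 2 - b ^ 2), sq_nonneg (a * b)]
  refine ⟨?_, h2⟩
  rw [abs_le]
  constructor <;> nlinarith [sq_nonneg (a ^ 2 - b ^ 2), sq_nonneg (a * b),
    sq_nonneg (a ^ 2 + a * b), sq_nonneg (a ^ 2 - a * b), sq_nonneg (b ^ 2)]

/-- A fourth-moment bound for sums of martingale differences. -/
theorem integral_sum_pow_four_le {d V : ℕ → Ω → ℝ} {v : ℕ → ℝ} {a : ℝ}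
    (hd : ∀ k, Measurable (d k)) (hV : ∀ k, Measurable (V k))
    (hd4 : ∀ k, Integrable (fun ω => d k ω ^ 4) P) (hV2 : ∀ k, Integrable (fun ω => V k ω ^ 2) P)
    (hmean : ∀ k, ∫ ω, (∑ i ∈ Finset.range k, d i ω) ^ 3 * d k ω ∂P = 0)
    (hvar : ∀ k, ∫ ω, (∑ i ∈ Finset.range k, d i ω) ^ 2 * d k ω ^ 2 ∂P
      ≤ ∫ ω, (∑ i ∈ Finset.range k, d i ω) ^ 2 * V k ω ∂P)
    (ha : 0 < a) (hv : ∀ k, 0 < v k) (hVv : ∀ k, ∫ ω, V k ω ^ 2 ∂P ≤ v k ^ 2)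
    (hdv : ∀ k, ∫ ω, d k ω ^ 4 ∂P ≤ a * v k) (n : ℕ) :
    Integrable (fun ω => (∑ i ∈ Finset.range n, d i ω) ^ 4) P ∧
      ∫ ω, (∑ i ∈ Finset.range n, d i ω) ^ 4 ∂P ≤ (a + 6 * ∑ i ∈ Finset.range n, v i) ^ 2 := by
  induction n with
  | zero => simpa using sq_nonneg a
  | succ n ih =>
    obtain ⟨hS4, hm⟩ := ih
    set S : Ω → ℝ := fun ω => ∑ i ∈ Finset.range n, d i ω with hS
    have hSm : Measurable S := Finset.measurable_sum _ fun i _ => hd i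
    set f : ℝ := a + 6 * ∑ i ∈ Finset.range n, v i with hf
    have hfa : a ≤ f := by
      have : 0 ≤ ∑ i ∈ Finset.range n, v i := Finset.sum_nonneg fun i _ => (hv i).le
      linarith
    have hf0 : 0 < f := ha.trans_le hfa
    have hsum : Integrable (fun ω => S ω ^ 4 + d n ω ^ 4) P := hS4.add (hd4 n)
    have hi31 : Integrable (fun ω => S ω ^ 3 * d n ω) P :=
      integrable_of_abs_le ((hSm.pow_const 3).mul (hd n)) hsum fun ω => (abs_pow_mul_pow_le _ _).1
    have hi22 : Integrable (fun ω => S ω ^ 2 * d n ω ^ 2) P :=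
      integrable_of_abs_le ((hSm.pow_const 2).mul ((hd n).pow_const 2)) hsum
        fun ω => (abs_pow_mul_pow_le _ _).2
    have hi2V : Integrable (fun ω => S ω ^ 2 * V n ω) P :=
      integrable_of_abs_le ((hSm.pow_const 2).mul (hV n)) (hS4.add (hV2 n)) fun ω => by
        rw [abs_le]
        constructor <;> simp only [Pi.add_apply] <;>
          nlinarith [sq_nonneg (S ω ^ 2 + V n ω), sq_nonneg (S ω ^ 2 - V n ω)]
    have hi4 : Integrable (fun ω => (S ω + d n ω) ^ 4) P :=
      integrable_of_abs_le ((hSm.add (hd n)).pow_const 4) (hsum.const_mul 8) fun ω => by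
        rw [abs_of_nonneg (by positivity)]; exact add_pow_four_le _ _
    -- The odd term is removed by 4 S d³ ≤ 2 S² d² + 2 d⁴, which raises the coefficients 6 and 1 to
    -- 8 and 3.
    have hpt : ∀ ω, (S ω + d n ω) ^ 4
        ≤ S ω ^ 4 + 4 * (S ω ^ 3 * d n ω) + 8 * (S ω ^ 2 * d n ω ^ 2) + 3 * d n ω ^ 4 := fun ω => by
      nlinarith [sq_nonneg (d n ω * (S ω - d n ω))]
    have hint : ∫ ω, (S ω + d n ω) ^ 4 ∂P ≤ ∫ ω, S ω ^ 4 ∂P + 4 * ∫ ω, S ω ^ 3 * d n ω ∂P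
        + 8 * ∫ ω, S ω ^ 2 * d n ω ^ 2 ∂P + 3 * ∫ ω, d n ω ^ 4 ∂P := by
      have h1 : Integrable (fun ω => S ω ^ 4 + 4 * (S ω ^ 3 * d n ω)) P := hS4.add (hi31.const_mul 4)
      have h2 : Integrable (fun ω => S ω ^ 4 + 4 * (S ω ^ 3 * d n ω) + 8 * (S ω ^ 2 * d n ω ^ 2)) P :=
        h1.add (hi22.const_mul 8)
      refine (integral_mono hi4 (h2.add ((hd4 n).const_mul 3)) hpt).trans (le_of_eq ?_)
      simp only [Pi.add_apply]
      rw [integral_add h2 ((hd4 n).const_mul 3), integral_add h1 (hi22.const_mul 8),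
        integral_add hS4 (hi31.const_mul 4)]
      simp only [integral_const_mul]
      rfl
    have hSV : 2 * ∫ ω, S ω ^ 2 * V n ω ∂P ≤ 2 * (f * v n) := by
      -- Weighted arithmetic-geometric inequality. With E S⁴ ≤ f² and E V² ≤ v², the weight v/f
      -- makes both terms equal to f v.
      have hpt' : ∀ ω, 2 * (S ω ^ 2 * V n ω) ≤ v n / f * S ω ^ 4 + f / v n * V n ω ^ 2 := fun ω => by
        have h := two_mul_le_add_sq (v n / f * S ω ^ 2) (V n ω)
        have hvf : 0 < f / v n := div_pos hf0 (hv n)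
        have h' := mul_le_mul_of_nonneg_left h hvf.le
        have hvn := (hv n).ne'
        calc _ = f / v n * (2 * (v n / f * S ω ^ 2) * V n ω) := by field_simp
          _ ≤ _ := h'
          _ = _ := by field_simp
      have h1 := integral_mono (hi2V.const_mul 2)
        ((hS4.const_mul (v n / f)).add ((hV2 n).const_mul (f / v n))) hpt'
      simp only [Pi.add_apply] at h1
      rw [integral_add (hS4.const_mul _) ((hV2 n).const_mul _), integral_const_mul,
        integral_const_mul, integral_const_mul] at h1
      have hvn := hv n
      have h2 : v n / f * ∫ ω, S ω ^ 4 ∂P ≤ v n / f * f ^ 2 := by gcongr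
      have h3 : f / v n * ∫ ω, V n ω ^ 2 ∂P ≤ f / v n * v n ^ 2 := by gcongr; exact hVv n
      have h4 : v n / f * f ^ 2 + f / v n * v n ^ 2 = 2 * (f * v n) := by field_simp; ring
      linarith
    simp only [Finset.sum_range_succ]
    refine ⟨hi4, hint.trans ?_⟩
    have hm1 := hmean n
    have hm2 := hvar n
    have hm3 := hdv n
    have hvn := hv n
    rw [hm1]
    have : (a + 6 * (∑ i ∈ Finset.range n, v i + v n)) ^ 2
        = f ^ 2 + 12 * f * v n + 36 * v n ^ 2 := by rw [hf]; ring
    rw [this]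
    -- The total is at most f² + 8 f v + 3 a v ≤ f² + 11 f v because a ≤ f. The constant 6 supplies
    -- 12 f v.
    nlinarith [mul_le_mul_of_nonneg_right hfa hvn.le]

end core

/-! ### Martingale sums over the innovation filtration -/

section martingale
variable {Ω : Type*} [MeasurableSpace Ω] {P : Measure Ω} [IsProbabilityMeasure P]

/-- The fourth-moment bound for sums of functions of the past and of the next innovation, centred
in the latter. -/
theorem integral_sum_comp_pow_four_le {β : Type*} [MeasurableSpace β] {e : ℕ → Ω → ℝ}
    (he : ∀ k, Measurable (e k)) (hind : iIndepFun e P) {X : ℕ → Ω → β}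
    (hX : ∀ k, Measurable[(Filtration.natural e fun i => (he i).stronglyMeasurable) k] (X k))
    {φ : ℕ → β × ℝ → ℝ} (hφ : ∀ k, Measurable (φ k))
    (h0 : ∀ k x, ∫ t, φ k (x, t) ∂(P.map (e (k + 1))) = 0)
    {V : ℕ → β → ℝ} (hVm : ∀ k, Measurable (V k))
    (hV : ∀ k x, ∫ t, φ k (x, t) ^ 2 ∂(P.map (e (k + 1))) ≤ V k x)
    (hd4 : ∀ k, Integrable (fun ω => φ k (X k ω, e (k + 1) ω) ^ 4) P)
    (hV2 : ∀ k, Integrable (fun ω => V k (X k ω) ^ 2) P)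
    {v : ℕ → ℝ} {a : ℝ} (ha : 0 < a) (hv : ∀ k, 0 < v k)
    (hVv : ∀ k, ∫ ω, V k (X k ω) ^ 2 ∂P ≤ v k ^ 2)
    (hdv : ∀ k, ∫ ω, φ k (X k ω, e (k + 1) ω) ^ 4 ∂P ≤ a * v k) (n : ℕ) :
    Integrable (fun ω => (∑ k ∈ Finset.range n, φ k (X k ω, e (k + 1) ω)) ^ 4) P ∧
      ∫ ω, (∑ k ∈ Finset.range n, φ k (X k ω, e (k + 1) ω)) ^ 4 ∂P
        ≤ (a + 6 * ∑ k ∈ Finset.range n, v k) ^ 2 := by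
  set F := Filtration.natural e fun i => (he i).stronglyMeasurable with hF
  have heF : ∀ k, Measurable[F k] (e k) := fun k =>
    (Filtration.stronglyAdapted_natural (fun i => (he i).stronglyMeasurable) k).measurable
  have hXm : ∀ k, Measurable (X k) := fun k => (hX k).mono (F.le k) le_rfl
  have hdF : ∀ k, Measurable[F (k + 1)] fun ω => φ k (X k ω, e (k + 1) ω) := fun k =>
    (hφ k).comp (((hX k).mono (F.mono k.le_succ) le_rfl).prodMk (heF (k + 1)))
  have hSF : ∀ k, Measurable[F k] fun ω => ∑ i ∈ Finset.range k, φ i (X i ω, e (i + 1) ω) := by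
    intro k
    refine Finset.measurable_sum _ fun i hi => ?_
    exact (hdF i).mono (F.mono (Finset.mem_range.1 hi)) le_rfl
  have hSm := fun k => (hSF k).mono (F.le k) le_rfl
  have hdm : ∀ k, Measurable fun ω => φ k (X k ω, e (k + 1) ω) :=
    fun k => (hdF k).mono (F.le _) le_rfl
  have hI : ∀ {Z : Ω → ℝ} k, Measurable[F k] Z → IndepFun (fun ω => (Z ω, X k ω)) (e (k + 1)) P :=
    fun k hZ => indepFun_succ_of_measurable_natural he hind (hZ.prodMk (hX k))
  have hS4 : ∀ k, Integrable
      (fun ω => (∑ i ∈ Finset.range k, φ i (X i ω, e (i + 1) ω)) ^ 4) P := by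
    intro k
    induction k with
    | zero => simp
    | succ k ih =>
      refine integrable_of_abs_le ((hSm _).pow_const 4) ((ih.add (hd4 k)).const_mul 8) fun ω => ?_
      rw [abs_of_nonneg (by positivity), Finset.sum_range_succ]
      exact add_pow_four_le _ _
  refine integral_sum_pow_four_le (d := fun k ω => φ k (X k ω, e (k + 1) ω))
    (V := fun k ω => V k (X k ω)) hdm (fun k => (hVm k).comp (hXm k)) hd4 hV2 (fun k => ?_)
    (fun k => ?_) ha hv hVv hdv n
  · refine integral_mul_comp_eq_zero (hXm k) (he _) ((hSm k).pow_const 3)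
      (hI k ((hSF k).pow_const 3)) (hφ k) (h0 k) ?_
    exact integrable_of_abs_le (((hSm k).pow_const 3).mul (hdm k)) ((hS4 k).add (hd4 k))
      fun ω => (abs_pow_mul_pow_le _ _).1
  · refine integral_mul_comp_le (ψ := fun z => φ k z ^ 2) (hXm k) (he _) ((hSm k).pow_const 2)
      (fun ω => sq_nonneg _) (hI k ((hSF k).pow_const 2)) ((hφ k).pow_const 2)
      (fun x => sq_nonneg _) (hV k) ?_ ?_
    · exact integrable_of_abs_le (((hSm k).pow_const 2).mul ((hdm k).pow_const 2))
        ((hS4 k).add (hd4 k)) fun ω => (abs_pow_mul_pow_le _ _).2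
    · refine integrable_of_abs_le (((hSm k).pow_const 2).mul ((hVm k).comp (hXm k)))
        ((hS4 k).add (hV2 k)) fun ω => ?_
      rw [abs_le]
      set s := ∑ i ∈ Finset.range k, φ i (X i ω, e (i + 1) ω)
      constructor <;> simp only [Pi.add_apply] <;>
        nlinarith [sq_nonneg (s ^ 2 + V k (X k ω)), sq_nonneg (s ^ 2 - V k (X k ω))]

/-- The conditional variance of a difference of weighted centred indicators. -/
theorem integral_sq_centredInd_sub_le {μ : Measure ℝ} [IsProbabilityMeasure μ] {M : ℝ}
    (hL : ∀ x y, |cdf μ y - cdf μ x| ≤ M * |y - x|) (W W0 η y : ℝ) :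
    ∫ t, (W * centredInd (cdf μ) (y - η) t - W0 * centredInd (cdf μ) y t) ∂μ = 0 ∧
    ∫ t, (W * centredInd (cdf μ) (y - η) t - W0 * centredInd (cdf μ) y t) ^ 2 ∂μ
      ≤ 4 * W ^ 2 * (M * |η|) + 2 * (W - W0) ^ 2 := by
  have hi : ∀ x, Integrable (fun t => Set.indicator (Set.Iic x) (fun _ => (1 : ℝ)) t) μ :=
    fun x => (integrable_const _).indicator measurableSet_Iic
  have hii : ∀ x, ∫ t, Set.indicator (Set.Iic x) (fun _ => (1 : ℝ)) t ∂μ = cdf μ x := fun x => by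
    rw [integral_indicator measurableSet_Iic, cdf_eq_real]; simp
  have hci : ∀ x, Integrable (fun t => centredInd (cdf μ) x t) μ :=
    fun x => (hi x).sub (integrable_const _)
  have hc : ∀ x, ∫ t, centredInd (cdf μ) x t ∂μ = 0 := fun x => by
    simp only [centredInd]
    rw [integral_sub (hi x) (integrable_const _), hii]; simp
  have h01 := fun x t => abs_centredInd_le (cdf_nonneg μ) (cdf_le_one μ) x t
  constructor
  · rw [integral_sub ((hci _).const_mul _) ((hci _).const_mul _), integral_const_mul,
      integral_const_mul, hc, hc]; simp
  -- The indicator increment and the increment of the distribution function both lie in [0, 1], and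
  -- (a - b)² ≤ a + b for such numbers. Integration gives twice the increment of the distribution
  -- function.
  · have hmono : ∀ x z : ℝ, x ≤ z → ∀ t, (centredInd (cdf μ) x t - centredInd (cdf μ) z t) ^ 2
        ≤ (Set.indicator (Set.Iic z) (fun _ => (1 : ℝ)) t
          - Set.indicator (Set.Iic x) (fun _ => (1 : ℝ)) t) + (cdf μ z - cdf μ x) := by
      intro x z hxz t
      have h1 : Set.indicator (Set.Iic x) (fun _ => (1 : ℝ)) t
          ≤ Set.indicator (Set.Iic z) (fun _ => (1 : ℝ)) t :=
        Set.indicator_le_indicator_of_subset (Set.Iic_subset_Iic.2 hxz) (fun _ => zero_le_one) t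
      have h2 : Set.indicator (Set.Iic z) (fun _ => (1 : ℝ)) t ≤ 1 :=
        Set.indicator_le_self' (fun _ _ => zero_le_one) t
      have h3 : 0 ≤ Set.indicator (Set.Iic x) (fun _ => (1 : ℝ)) t :=
        Set.indicator_nonneg (fun _ _ => zero_le_one) t
      have h4 := monotone_cdf μ hxz
      have h5 := cdf_le_one μ z
      have h6 := cdf_nonneg μ x
      simp only [centredInd]
      generalize Set.indicator (Set.Iic x) (fun _ => (1 : ℝ)) t = p at *
      generalize Set.indicator (Set.Iic z) (fun _ => (1 : ℝ)) t = q at *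
      have a1 : 0 ≤ q - p := sub_nonneg.2 h1
      have a2 : 0 ≤ cdf μ z - cdf μ x := sub_nonneg.2 h4
      nlinarith [mul_nonneg a1 a2, mul_nonneg a1 (show 0 ≤ 1 - (q - p) by linarith),
        mul_nonneg a2 (show 0 ≤ 1 - (cdf μ z - cdf μ x) by linarith)]
    have hD : ∀ x z : ℝ, ∫ t, (centredInd (cdf μ) x t - centredInd (cdf μ) z t) ^ 2 ∂μ
        ≤ 2 * (M * |x - z|) := by
      intro x z
      wlog hxz : x ≤ z generalizing x z
      · have := this z x (le_of_not_ge hxz)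
        rw [abs_sub_comm] at this
        refine le_trans (le_of_eq ?_) this
        congr 1; ext t; ring
      have hint : Integrable (fun t => (Set.indicator (Set.Iic z) (fun _ => (1 : ℝ)) t
          - Set.indicator (Set.Iic x) (fun _ => (1 : ℝ)) t) + (cdf μ z - cdf μ x)) μ :=
        ((hi z).sub (hi x)).add (integrable_const _)
      refine (integral_mono_of_nonneg (ae_of_all _ fun t => sq_nonneg _) hint
        (ae_of_all _ (hmono x z hxz))).trans ?_
      have hzx : Integrable (fun t => Set.indicator (Set.Iic z) (fun _ => (1 : ℝ)) t
          - Set.indicator (Set.Iic x) (fun _ => (1 : ℝ)) t) μ := (hi z).sub (hi x)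
      rw [integral_add hzx (integrable_const _), integral_sub (hi z) (hi x), hii, hii]
      have := (le_abs_self _).trans (hL x z)
      rw [abs_sub_comm] at this
      simp only [integral_const, probReal_univ, one_smul]
      rw [abs_sub_comm x z] at *
      linarith
    -- Split as W times the change of threshold plus (W - W0) times an indicator bounded by 1.
    have hpt : ∀ t, (W * centredInd (cdf μ) (y - η) t - W0 * centredInd (cdf μ) y t) ^ 2
        ≤ 2 * W ^ 2 * (centredInd (cdf μ) (y - η) t - centredInd (cdf μ) y t) ^ 2
          + 2 * (W - W0) ^ 2 := fun t => by
      have h1 : (centredInd (cdf μ) y t) ^ 2 ≤ 1 := by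
        rw [sq_le_one_iff_abs_le_one]; exact h01 _ _
      generalize centredInd (cdf μ) (y - η) t = p at *
      generalize centredInd (cdf μ) y t = q at *
      have h2 : (W * p - W0 * q) ^ 2 ≤ 2 * (W * (p - q)) ^ 2 + 2 * ((W - W0) * q) ^ 2 := by
        nlinarith [sq_nonneg (W * (p - q) - (W - W0) * q)]
      have h3 : (W - W0) ^ 2 * q ^ 2 ≤ (W - W0) ^ 2 * 1 := by gcongr
      nlinarith
    have hsqi : Integrable (fun t => (centredInd (cdf μ) (y - η) t - centredInd (cdf μ) y t) ^ 2) μ := by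
      refine integrable_of_abs_le ?_ (integrable_const (4 : ℝ)) fun t => ?_
      · have hm : ∀ x, Measurable (fun t => centredInd (cdf μ) x t) := fun x =>
          (measurable_const.indicator measurableSet_Iic).sub_const _
        exact ((hm _).sub (hm _)).pow_const 2
      · have h1 := abs_le.1 (h01 (y - η) t)
        have h2 := abs_le.1 (h01 y t)
        rw [abs_of_nonneg (sq_nonneg _)]
        nlinarith
    refine (integral_mono_of_nonneg (ae_of_all _ fun t => sq_nonneg _)
      ((hsqi.const_mul _).add (integrable_const _)) (ae_of_all _ hpt)).trans ?_
    simp only [Pi.add_apply]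
    rw [integral_add (hsqi.const_mul _) (integrable_const _), integral_const_mul]
    simp only [integral_const, probReal_univ, one_smul]
    have h2 := hD (y - η) y
    rw [show y - η - y = -η by ring, abs_neg] at h2
    have h3 := mul_le_mul_of_nonneg_left h2 (show 0 ≤ 2 * W ^ 2 by positivity)
    linarith

end martingale

/-! ### Adapted measurability and moments of the envelope -/

/-- Independent innovations with common law `μ`, centred, with a finite eighth moment. -/
structure IsInnovation {Ω : Type*} [MeasurableSpace Ω] (P : Measure Ω) (ε : ℤ → Ω → ℝ)
    (μ : Measure ℝ) : Prop where
  measurable : ∀ i, Measurable (ε i)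
  indep : iIndepFun (fun (k : ℕ) => ε (k : ℤ)) P
  map_eq : ∀ i, P.map (ε i) = μ
  mean : ∫ x, x ∂μ = 0
  moment : Integrable (fun x => x ^ 8) μ

namespace IsInnovation
variable {Ω : Type*} [MeasurableSpace Ω] {P : Measure Ω} {ε : ℤ → Ω → ℝ} {μ : Measure ℝ}

/-- The filtration generated by `ε_0, ε_1, …`. -/
noncomputable def past (hε : IsInnovation P ε μ) : Filtration ℕ (inferInstance : MeasurableSpace Ω) :=
  Filtration.natural (fun (k : ℕ) => ε (k : ℤ)) fun k => (hε.measurable k).stronglyMeasurable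

theorem measurable_past (hε : IsInnovation P ε μ) {j k : ℕ} (hjk : j ≤ k) :
    Measurable[hε.past k] (ε (j : ℤ)) :=
  ((Filtration.stronglyAdapted_natural
    (fun k : ℕ => (hε.measurable k).stronglyMeasurable)) j).measurable.mono
      (hε.past.mono hjk) le_rfl

theorem measurable_past_zero (hε : IsInnovation P ε μ) (k : ℕ) :
    Measurable[hε.past k] (ε 0) := by
  simpa using hε.measurable_past (Nat.zero_le k)

theorem measurable_maResidual (hε : IsInnovation P ε μ) (α θ : ℝ) (k : ℕ) :
    Measurable[hε.past k] fun ω => maResidual (maObs α fun i => ε i ω) θ k := by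
  induction k with
  | zero => simp only [maResidual]; exact measurable_const
  | succ k ih =>
    simp only [maResidual_succ]
    exact ((hε.measurable_past le_rfl).sub ((hε.measurable_past k.le_succ).const_mul _)).add
      ((ih.mono (hε.past.mono k.le_succ) le_rfl).const_mul _)

theorem measurable_residualDeriv (hε : IsInnovation P ε μ) (α θ : ℝ) (k : ℕ) :
    Measurable[hε.past k] fun ω => residualDeriv (maObs α fun i => ε i ω) θ k := by
  induction k with
  | zero => simp only [residualDeriv_zero]; exact measurable_const
  | succ k ih =>
    simp only [residualDeriv_succ]
    exact ((hε.measurable_maResidual α θ k).mono (hε.past.mono k.le_succ) le_rfl).add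
      ((ih.mono (hε.past.mono k.le_succ) le_rfl).const_mul _)

theorem measurable_score (hε : IsInnovation P ε μ) (α θ : ℝ) (k : ℕ) :
    Measurable[hε.past k] fun ω => score α (fun i => ε i ω) θ k := by
  simp only [score_eq]
  exact (hε.measurable_maResidual α θ k).add ((hε.measurable_residualDeriv α θ k).const_mul _)

theorem measurable_residShift (hε : IsInnovation P ε μ) (α θ : ℝ) (k : ℕ) :
    Measurable[hε.past k] fun ω => residShift α (fun i => ε i ω) θ k := by
  simp only [residShift_eq]
  exact ((hε.measurable_past le_rfl).const_mul _).add
    ((hε.measurable_maResidual α θ k).const_mul _)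

theorem measurable_envelope (hε : IsInnovation P ε μ) (r : ℝ) (k : ℕ) :
    Measurable[hε.past k] fun ω => envelope r (fun i => ε i ω) k := by
  induction k with
  | zero => simp only [envelope]; exact measurable_const.add (continuous_abs.measurable.comp (hε.measurable_past_zero 0))
  | succ k ih =>
    simp only [envelope]
    exact ((measurable_const.add (continuous_abs.measurable.comp (hε.measurable_past le_rfl))).add
      (continuous_abs.measurable.comp (hε.measurable_past k.le_succ))).add
      ((ih.mono (hε.past.mono k.le_succ) le_rfl).const_mul _)

theorem measurable_envelope' (hε : IsInnovation P ε μ) (r : ℝ) (k : ℕ) :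
    Measurable fun ω => envelope r (fun i => ε i ω) k :=
  (hε.measurable_envelope r k).mono (hε.past.le k) le_rfl

theorem integrable_pow_eight (hε : IsInnovation P ε μ) (i : ℤ) :
    Integrable (fun ω => ε i ω ^ 8) P ∧ ∫ ω, ε i ω ^ 8 ∂P = ∫ x, x ^ 8 ∂μ := by
  have h1 : AEStronglyMeasurable (fun x : ℝ => x ^ 8) (P.map (ε i)) := by fun_prop
  constructor
  · have := (integrable_map_measure h1 (hε.measurable i).aemeasurable).1
      (by rw [hε.map_eq]; exact hε.moment)
    exact this
  · rw [← hε.map_eq i, integral_map (hε.measurable i).aemeasurable h1]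

/-- Using convexity with weights 1 - r and r keeps the coefficient of b⁸ at r < 1, so that a moment
recursion closes. -/
theorem convex_pow_eight {r a b : ℝ} (hr0 : 0 ≤ r) (hr : r < 1) (ha : 0 ≤ a) (hb : 0 ≤ b) :
    (a + r * b) ^ 8 ≤ (1 - r) * (a / (1 - r)) ^ 8 + r * b ^ 8 := by
  have h1 : 0 < 1 - r := sub_pos.2 hr
  have h := (convexOn_pow 8).2 (x := a / (1 - r)) (y := b) (Set.mem_Ici.2 (by positivity))
    (Set.mem_Ici.2 hb) h1.le hr0 (by ring)
  simp only [smul_eq_mul] at h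
  rwa [mul_div_cancel₀ _ h1.ne'] at h

theorem add_three_pow_eight_le {a b c : ℝ} (ha : 0 ≤ a) (hb : 0 ≤ b) (hc : 0 ≤ c) :
    (a + b + c) ^ 8 ≤ 3 ^ 8 * (a ^ 8 + b ^ 8 + c ^ 8) := by
  have h : ∀ m : ℝ, 0 ≤ m → a ≤ m → b ≤ m → c ≤ m → (a + b + c) ^ 8 ≤ 3 ^ 8 * m ^ 8 := by
    intro m _ h1 h2 h3
    rw [← mul_pow]; gcongr; linarith
  have ha8 := pow_nonneg ha 8
  have hb8 := pow_nonneg hb 8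
  have hc8 := pow_nonneg hc 8
  rcases le_total a b with hab | hab <;> rcases le_total b c with hbc | hbc <;>
    rcases le_total a c with hac | hac
  all_goals first
    | exact (h a ha le_rfl (by linarith) (by linarith)).trans (by gcongr; linarith)
    | exact (h b hb (by linarith) le_rfl (by linarith)).trans (by gcongr; linarith)
    | exact (h c hc (by linarith) (by linarith) le_rfl).trans (by gcongr; linarith)

variable [IsProbabilityMeasure P]

/-- The eighth moments satisfy m_{k+1} ≤ (1 - r) Q + r m_k with a fixed Q that also bounds m_0, so Q
bounds them all. -/
theorem exists_envelope_moment (hε : IsInnovation P ε μ) {r : ℝ} (hr0 : 0 ≤ r) (hr : r < 1) :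
    ∃ K : ℝ, 1 ≤ K ∧ ∀ k, Integrable (fun ω => envelope r (fun i => ε i ω) k ^ 8) P ∧
      ∫ ω, envelope r (fun i => ε i ω) k ^ 8 ∂P ≤ K := by
  set m := ∫ x, x ^ 8 ∂μ with hm
  have hm0 : 0 ≤ m := integral_nonneg fun x => by positivity
  have h1r : 0 < 1 - r := sub_pos.2 hr
  set A : ℝ := ((1 - r) ^ 8)⁻¹ * 3 ^ 8 with hA
  have hA1 : 1 ≤ A := by
    have : (1 : ℝ) ≤ ((1 - r) ^ 8)⁻¹ := (one_le_inv₀ (by positivity)).2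
      (pow_le_one₀ h1r.le (by linarith))
    rw [hA]; nlinarith
  have hQ : ∀ i j : ℤ, Integrable (fun ω => 1 + ε i ω ^ 8 + ε j ω ^ 8) P ∧
      ∫ ω, (1 + ε i ω ^ 8 + ε j ω ^ 8) ∂P = 1 + 2 * m := by
    intro i j
    obtain ⟨hi, hi'⟩ := hε.integrable_pow_eight i
    obtain ⟨hj, hj'⟩ := hε.integrable_pow_eight j
    have h1i : Integrable (fun ω => 1 + ε i ω ^ 8) P := (integrable_const _).add hi
    refine ⟨h1i.add hj, ?_⟩
    rw [integral_add h1i hj, integral_add (integrable_const _) hi, hi', hj']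
    simp; ring
  refine ⟨A * (1 + 2 * m), by nlinarith, fun k => ?_⟩
  induction k with
  | zero =>
    have hb : ∀ ω, |envelope r (fun i => ε i ω) 0 ^ 8| ≤ A * (1 + ε 0 ω ^ 8 + ε 0 ω ^ 8) := by
      intro ω
      have h0 : 0 ≤ ε 0 ω ^ 8 := by positivity
      have h := add_three_pow_eight_le (a := 1) (b := |ε 0 ω|) (c := 0) zero_le_one (abs_nonneg _)
        le_rfl
      have e8 : |ε 0 ω| ^ 8 = ε 0 ω ^ 8 := Even.pow_abs (by decide) _
      have hA3 : 3 ^ 8 ≤ A := by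
        rw [hA]
        exact le_mul_of_one_le_left (by positivity) ((one_le_inv₀ (by positivity)).2
          (pow_le_one₀ h1r.le (by linarith)))
      rw [abs_of_nonneg (by positivity)]
      simp only [envelope]
      rw [add_zero, e8] at h
      refine h.trans (mul_le_mul hA3 ?_ (by positivity) (by positivity))
      norm_num; linarith
    have hi := integrable_of_abs_le ((hε.measurable_envelope' r 0).pow_const 8)
      ((hQ 0 0).1.const_mul A) hb
    refine ⟨hi, ?_⟩
    refine (integral_mono hi ((hQ 0 0).1.const_mul A) fun ω => (le_abs_self _).trans (hb ω)).trans ?_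
    rw [integral_const_mul, (hQ 0 0).2]
  | succ k ih =>
    obtain ⟨hik, hk⟩ := ih
    have hb : ∀ ω, |envelope r (fun i => ε i ω) (k + 1) ^ 8| ≤
        (1 - r) * A * (1 + ε ((k + 1 : ℕ) : ℤ) ω ^ 8 + ε (k : ℤ) ω ^ 8)
          + r * envelope r (fun i => ε i ω) k ^ 8 := by
      intro ω
      rw [abs_of_nonneg (by positivity)]
      simp only [envelope]
      refine (convex_pow_eight hr0 hr (by positivity)
        (zero_le_one.trans (one_le_envelope hr0 k))).trans ?_
      gcongr ?_ + _
      have h := add_three_pow_eight_le (a := 1) (b := |ε ((k + 1 : ℕ) : ℤ) ω|) (c := |ε (k : ℤ) ω|)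
        zero_le_one (abs_nonneg _) (abs_nonneg _)
      rw [Even.pow_abs (by decide), Even.pow_abs (by decide), one_pow] at h
      rw [div_pow, mul_assoc, hA, mul_assoc, div_eq_inv_mul]
      gcongr
    have hint : Integrable (fun ω => (1 - r) * A * (1 + ε ((k + 1 : ℕ) : ℤ) ω ^ 8 + ε (k : ℤ) ω ^ 8)
          + r * envelope r (fun i => ε i ω) k ^ 8) P :=
      ((hQ _ _).1.const_mul _).add (hik.const_mul _)
    have hi := integrable_of_abs_le ((hε.measurable_envelope' r (k + 1)).pow_const 8) hint hb
    refine ⟨hi, ?_⟩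
    refine (integral_mono hi hint fun ω => (le_abs_self _).trans (hb ω)).trans ?_
    rw [integral_add ((hQ _ _).1.const_mul _) (hik.const_mul _), integral_const_mul,
      integral_const_mul, (hQ _ _).2]
    have := mul_le_mul_of_nonneg_left hk hr0
    linarith

end IsInnovation

/-! ### Fourth moments of increments and of quadratic averages -/

/-- The normalised difference of two weighted empirical processes, the first evaluated at `y`
shifted by `η`. -/
noncomputable def empIncr (G : ℝ → ℝ) (W η W0 b : ℕ → ℝ) (n : ℕ) (y : ℝ) : ℝ :=
  ∑ k ∈ Finset.range n,
    (√(n : ℝ))⁻¹ * (W k * centredInd G (y - η k) (b k) - W0 k * centredInd G y (b k))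

theorem measurable_centredInd {G : ℝ → ℝ} (hG : Measurable G) :
    Measurable fun z : ℝ × ℝ => centredInd G z.1 z.2 := by
  unfold centredInd
  refine Measurable.sub ?_ (hG.comp measurable_fst)
  have : (fun z : ℝ × ℝ => Set.indicator (Set.Iic z.1) (fun _ => (1 : ℝ)) z.2)
      = Set.indicator {z : ℝ × ℝ | z.2 ≤ z.1} fun _ => 1 := by
    ext z; simp [Set.indicator_apply]
  rw [this]
  exact measurable_const.indicator (measurableSet_le measurable_snd measurable_fst)

theorem sum_inv_sqrt_add_pow_le {q : ℝ} (hq : 0 ≤ q) (hq1 : q < 1) {n : ℕ} (hn : 1 ≤ n) :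
    ∑ k ∈ Finset.range n, ((√(n : ℝ))⁻¹ + q ^ k) ≤ (1 + (1 - q)⁻¹) * √(n : ℝ) := by
  have hs : 1 ≤ √(n : ℝ) := Real.one_le_sqrt.2 (by exact_mod_cast hn)
  have h1 : ∑ k ∈ Finset.range n, q ^ k ≤ (1 - q)⁻¹ := by
    rw [← tsum_geometric_of_lt_one hq hq1]
    exact (summable_geometric_of_lt_one hq hq1).sum_le_tsum _ fun k _ => by positivity
  have h2 : (1 - q)⁻¹ ≤ (1 - q)⁻¹ * √(n : ℝ) :=
    le_mul_of_one_le_right (inv_nonneg.2 (by linarith)) hs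
  rw [Finset.sum_add_distrib, Finset.sum_const, Finset.card_range, nsmul_eq_mul,
    ← div_eq_mul_inv, Real.div_sqrt]
  linarith

namespace IsInnovation
variable {Ω : Type*} [MeasurableSpace Ω] {P : Measure Ω} {ε : ℤ → Ω → ℝ} {μ : Measure ℝ}

theorem integrable_envelope_pow {K r : ℝ} (hε : IsInnovation P ε μ) (hr0 : 0 ≤ r)
    (hK : ∀ k, Integrable (fun ω => envelope r (fun i => ε i ω) k ^ 8) P ∧
      ∫ ω, envelope r (fun i => ε i ω) k ^ 8 ∂P ≤ K) {m : ℕ} (hm : m ≤ 8) (k : ℕ) :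
    Integrable (fun ω => envelope r (fun i => ε i ω) k ^ m) P ∧
      ∫ ω, envelope r (fun i => ε i ω) k ^ m ∂P ≤ K := by
  have h : ∀ ω, envelope r (fun i => ε i ω) k ^ m ≤ envelope r (fun i => ε i ω) k ^ 8 :=
    fun ω => pow_le_pow_right₀ (one_le_envelope hr0 k) hm
  have hi : Integrable (fun ω => envelope r (fun i => ε i ω) k ^ m) P := by
    refine integrable_of_abs_le ((hε.measurable_envelope' r k).pow_const m) (hK k).1 fun ω => ?_
    have := zero_le_one.trans (one_le_envelope (e := fun i => ε i ω) hr0 k)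
    rw [abs_of_nonneg (by positivity)]
    exact h ω
  exact ⟨hi, (integral_mono hi (hK k).1 h).trans (hK k).2⟩

variable [IsProbabilityMeasure P]

theorem isProbabilityMeasure (hε : IsInnovation P ε μ) : IsProbabilityMeasure μ := by
  rw [← hε.map_eq 0]
  exact Measure.isProbabilityMeasure_map (hε.measurable 0).aemeasurable

set_option maxHeartbeats 1000000 in
-- Each summand is O(n^{-1/2}) and its conditional variance is O(n⁻¹(n^{-1/2} + q^k)) up to powers
-- of the envelope. The variances add up to O(n^{-1/2}), and the fourth-moment inequality squares
-- this. A second moment would give only n^{-1/2}, too weak for a union bound over n^{3/4} points.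
theorem exists_integral_empIncr_pow_four_le (hε : IsInnovation P ε μ) {r q B M : ℝ} (hr0 : 0 ≤ r)
    (hr : r < 1) (hq : 0 ≤ q) (hq1 : q < 1) (hB : 0 < B) (hM : 0 ≤ M)
    (hL : ∀ x y, |cdf μ y - cdf μ x| ≤ M * |y - x|) :
    ∃ C : ℝ, ∀ (n : ℕ) (W η W0 : ℕ → Ω → ℝ) (y : ℝ), 1 ≤ n →
      (∀ k, Measurable[hε.past k] (W k)) → (∀ k, Measurable[hε.past k] (η k)) →
      (∀ k, Measurable[hε.past k] (W0 k)) →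
      (∀ k ω, |W k ω| ≤ B * envelope r (fun i => ε i ω) k) →
      (∀ k ω, |W0 k ω| ≤ B * envelope r (fun i => ε i ω) k) →
      (∀ k ω, |W k ω - W0 k ω| ≤ B * (√(n : ℝ))⁻¹ * envelope r (fun i => ε i ω) k) →
      (∀ k ω, |η k ω| ≤ B * ((√(n : ℝ))⁻¹ + q ^ k) * envelope r (fun i => ε i ω) k) →
      Integrable (fun ω => empIncr (cdf μ) (fun k => W k ω) (fun k => η k ω) (fun k => W0 k ω)
        (fun k => ε ((k + 1 : ℕ) : ℤ) ω) n y ^ 4) P ∧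
      ∫ ω, empIncr (cdf μ) (fun k => W k ω) (fun k => η k ω) (fun k => W0 k ω)
        (fun k => ε ((k + 1 : ℕ) : ℤ) ω) n y ^ 4 ∂P ≤ C / n := by
  obtain ⟨K, hK1, hK⟩ := hε.exists_envelope_moment hr0 hr
  have hμ : IsProbabilityMeasure μ := hε.isProbabilityMeasure
  set B' : ℝ := 4 * B ^ 3 * M + 2 * B ^ 2 with hB'
  have hB'0 : 0 < B' := by positivity
  refine ⟨(4 * B ^ 2 + 6 * (B' * K * (1 + (1 - q)⁻¹))) ^ 2, ?_⟩
  intro n W η W0 y hn hWm hηm hW0m hW hW0 hWW hη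
  have hK0 : 0 < K := by linarith
  have hs : 1 ≤ √(n : ℝ) := Real.one_le_sqrt.2 (by exact_mod_cast hn)
  set s : ℝ := (√(n : ℝ))⁻¹ with hsdef
  have hs0 : 0 < s := by positivity
  have hs1 : s ≤ 1 := inv_le_one_of_one_le₀ hs
  have hsn : s ^ 2 = (n : ℝ)⁻¹ := by rw [hsdef, inv_pow, Real.sq_sqrt (Nat.cast_nonneg n)]
  set H : ℕ → Ω → ℝ := fun k ω => envelope r (fun i => ε i ω) k with hH
  have hH1 : ∀ k ω, 1 ≤ H k ω := fun k ω => one_le_envelope hr0 k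
  have hH0 : ∀ k ω, 0 ≤ H k ω := fun k ω => zero_le_one.trans (hH1 k ω)
  have hHm : ∀ k, Measurable (H k) := fun k => hε.measurable_envelope' r k
  have hHi := fun {m : ℕ} (hm : m ≤ 8) k => hε.integrable_envelope_pow hr0 hK hm k
  have ha0 : ∀ k, 0 < s + q ^ k := fun k => by positivity
  let φ : ℕ → (ℝ × ℝ × ℝ) × ℝ → ℝ := fun _ z =>
    s * (z.1.1 * centredInd (cdf μ) (y - z.1.2.1) z.2 - z.1.2.2 * centredInd (cdf μ) y z.2)
  let V : ℕ → ℝ × ℝ × ℝ → ℝ := fun _ x =>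
    s ^ 2 * (4 * x.1 ^ 2 * (M * |x.2.1|) + 2 * (x.1 - x.2.2) ^ 2)
  let X : ℕ → Ω → ℝ × ℝ × ℝ := fun k ω => (W k ω, η k ω, W0 k ω)
  have hXF : ∀ k, Measurable[hε.past k] (X k) := fun k => (hWm k).prodMk ((hηm k).prodMk (hW0m k))
  have hXm : ∀ k, Measurable (X k) := fun k => (hXF k).mono (hε.past.le k) le_rfl
  have hGm : Measurable (cdf μ) := (monotone_cdf μ).measurable
  have hcm := measurable_centredInd hGm
  have hφm : ∀ k, Measurable (φ k) := fun k => by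
    have h1 : Measurable fun z : (ℝ × ℝ × ℝ) × ℝ => centredInd (cdf μ) (y - z.1.2.1) z.2 :=
      hcm.comp (f := fun z : (ℝ × ℝ × ℝ) × ℝ => (y - z.1.2.1, z.2)) (by fun_prop)
    have h2 : Measurable fun z : (ℝ × ℝ × ℝ) × ℝ => centredInd (cdf μ) y z.2 :=
      hcm.comp (f := fun z : (ℝ × ℝ × ℝ) × ℝ => (y, z.2)) (by fun_prop)
    exact (((by fun_prop : Measurable fun z : (ℝ × ℝ × ℝ) × ℝ => z.1.1).mul h1).sub
      ((by fun_prop : Measurable fun z : (ℝ × ℝ × ℝ) × ℝ => z.1.2.2).mul h2)).const_mul s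
  have hVm : ∀ k, Measurable (V k) := fun k => by
    have : Measurable fun x : ℝ × ℝ × ℝ => |x.2.1| :=
      continuous_abs.measurable.comp (measurable_fst.comp measurable_snd)
    fun_prop
  have hmap : ∀ k : ℕ, P.map (ε ((k + 1 : ℕ) : ℤ)) = μ := fun k => hε.map_eq _
  have hφ0 : ∀ k x, ∫ t, φ k (x, t) ∂(P.map (ε ((k + 1 : ℕ) : ℤ))) = 0 := fun k x => by
    rw [hmap]
    simp only [φ]
    rw [integral_const_mul, (integral_sq_centredInd_sub_le hL _ _ _ _).1, mul_zero]
  have hφV : ∀ k x, ∫ t, φ k (x, t) ^ 2 ∂(P.map (ε ((k + 1 : ℕ) : ℤ))) ≤ V k x := fun k x => by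
    rw [hmap]
    simp only [φ, V, mul_pow s]
    rw [integral_const_mul]
    exact mul_le_mul_of_nonneg_left (integral_sq_centredInd_sub_le hL _ _ _ _).2 (sq_nonneg s)
  have hV0 : ∀ k x, 0 ≤ V k x := fun k x => by positivity
  have hVb : ∀ k ω, V k (X k ω) ≤ s ^ 2 * B' * (s + q ^ k) * H k ω ^ 3 := by
    intro k ω
    have h1 : W k ω ^ 2 ≤ (B * H k ω) ^ 2 := by
      rw [← sq_abs]; gcongr; exact hW k ω
    have h2 : (W k ω - W0 k ω) ^ 2 ≤ (B * s * H k ω) ^ 2 := by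
      rw [← sq_abs]; gcongr; exact hWW k ω
    have h3 := hη k ω
    have hq0 : 0 ≤ q ^ k := by positivity
    have h4 : s ^ 2 * H k ω ^ 2 ≤ (s + q ^ k) * H k ω ^ 3 := by
      gcongr
      · nlinarith
      · exact hH1 k ω
      · norm_num
    have hH0' := hH0 k ω
    simp only [V, X]
    calc s ^ 2 * (4 * W k ω ^ 2 * (M * |η k ω|) + 2 * (W k ω - W0 k ω) ^ 2)
        ≤ s ^ 2 * (4 * (B * H k ω) ^ 2 * (M * (B * (s + q ^ k) * H k ω))
            + 2 * (B * s * H k ω) ^ 2) := by gcongr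
      _ = s ^ 2 * (4 * B ^ 3 * M * ((s + q ^ k) * H k ω ^ 3)
            + 2 * B ^ 2 * (s ^ 2 * H k ω ^ 2)) := by ring
      _ ≤ s ^ 2 * (4 * B ^ 3 * M * ((s + q ^ k) * H k ω ^ 3)
            + 2 * B ^ 2 * ((s + q ^ k) * H k ω ^ 3)) := by gcongr
      _ = _ := by rw [hB']; ring
  have hV2b : ∀ k ω, V k (X k ω) ^ 2 ≤ (s ^ 2 * B' * (s + q ^ k)) ^ 2 * H k ω ^ 6 := by
    intro k ω
    have h := pow_le_pow_left₀ (hV0 k _) (hVb k ω) 2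
    refine h.trans (le_of_eq ?_)
    ring
  have hV2 : ∀ k, Integrable (fun ω => V k (X k ω) ^ 2) P := fun k =>
    integrable_of_abs_le (((hVm k).comp (hXm k)).pow_const 2)
      ((hHi (show 6 ≤ 8 by norm_num) k).1.const_mul _) fun ω => by
        rw [abs_of_nonneg (sq_nonneg _)]; exact hV2b k ω
  let v : ℕ → ℝ := fun k => s ^ 2 * B' * K * (s + q ^ k)
  have hv : ∀ k, 0 < v k := fun k => by have := ha0 k; positivity
  have hVv : ∀ k, ∫ ω, V k (X k ω) ^ 2 ∂P ≤ v k ^ 2 := fun k => by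
    refine (integral_mono (hV2 k) ((hHi (show 6 ≤ 8 by norm_num) k).1.const_mul _)
      (hV2b k)).trans ?_
    rw [integral_const_mul]
    calc (s ^ 2 * B' * (s + q ^ k)) ^ 2 * ∫ ω, H k ω ^ 6 ∂P
        ≤ (s ^ 2 * B' * (s + q ^ k)) ^ 2 * K ^ 2 := by
          gcongr
          exact (hHi (show 6 ≤ 8 by norm_num) k).2.trans (by nlinarith)
      _ = _ := by simp only [v]; ring
  have hdm : ∀ k, Measurable fun ω => φ k (X k ω, ε ((k + 1 : ℕ) : ℤ) ω) := fun k =>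
    (hφm k).comp ((hXm k).prodMk (hε.measurable _))
  have hdb : ∀ k ω, φ k (X k ω, ε ((k + 1 : ℕ) : ℤ) ω) ^ 2 ≤ 4 * B ^ 2 * s ^ 2 * H k ω ^ 2 := by
    intro k ω
    have h1 := abs_centredInd_le (cdf_nonneg μ) (cdf_le_one μ) (y - η k ω) (ε ((k + 1 : ℕ) : ℤ) ω)
    have h2 := abs_centredInd_le (cdf_nonneg μ) (cdf_le_one μ) y (ε ((k + 1 : ℕ) : ℤ) ω)
    have h3 : |W k ω * centredInd (cdf μ) (y - η k ω) (ε ((k + 1 : ℕ) : ℤ) ω)| ≤ B * H k ω * 1 := by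
      rw [abs_mul]
      exact mul_le_mul (hW k ω) h1 (abs_nonneg _) (mul_nonneg hB.le (hH0 k ω))
    have h4 : |W0 k ω * centredInd (cdf μ) y (ε ((k + 1 : ℕ) : ℤ) ω)| ≤ B * H k ω * 1 := by
      rw [abs_mul]
      exact mul_le_mul (hW0 k ω) h2 (abs_nonneg _) (mul_nonneg hB.le (hH0 k ω))
    simp only [φ, X]
    rw [mul_pow]
    have h5 := (abs_sub _ _).trans (add_le_add h3 h4)
    have h6 := pow_le_pow_left₀ (abs_nonneg _) h5 2
    rw [sq_abs] at h6
    refine (mul_le_mul_of_nonneg_left h6 (sq_nonneg s)).trans (le_of_eq ?_)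
    ring
  -- Only two of the four factors are bounded crudely; the other two are kept for the conditional
  -- variance, which contributes the small factor s + q^k and gives the fourth moment the form a
  -- v_k.
  have hd4b : ∀ k ω, φ k (X k ω, ε ((k + 1 : ℕ) : ℤ) ω) ^ 4
      ≤ (4 * B ^ 2 * s ^ 2) * H k ω ^ 2 * φ k (X k ω, ε ((k + 1 : ℕ) : ℤ) ω) ^ 2 := fun k ω => by
    have := mul_le_mul_of_nonneg_right (hdb k ω)
      (sq_nonneg (φ k (X k ω, ε ((k + 1 : ℕ) : ℤ) ω)))
    refine le_trans (le_of_eq ?_) this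
    ring
  have hZd : ∀ k, Integrable (fun ω => (4 * B ^ 2 * s ^ 2) * H k ω ^ 2
      * φ k (X k ω, ε ((k + 1 : ℕ) : ℤ) ω) ^ 2) P := fun k => by
    refine integrable_of_abs_le ((((hHm k).pow_const 2).const_mul _).mul ((hdm k).pow_const 2))
      ((hHi (show 4 ≤ 8 by norm_num) k).1.const_mul ((4 * B ^ 2 * s ^ 2) ^ 2)) fun ω => ?_
    rw [abs_of_nonneg (by positivity)]
    calc _ ≤ (4 * B ^ 2 * s ^ 2) * H k ω ^ 2 * (4 * B ^ 2 * s ^ 2 * H k ω ^ 2) := by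
          gcongr; exact hdb k ω
      _ = _ := by ring
  have hd4 : ∀ k, Integrable (fun ω => φ k (X k ω, ε ((k + 1 : ℕ) : ℤ) ω) ^ 4) P := fun k =>
    integrable_of_abs_le ((hdm k).pow_const 4) (hZd k) fun ω => by
      rw [abs_of_nonneg (by positivity)]; exact hd4b k ω
  have hZV : ∀ k ω, (4 * B ^ 2 * s ^ 2) * H k ω ^ 2 * V k (X k ω)
      ≤ (4 * B ^ 2 * s ^ 2) * (s ^ 2 * B' * (s + q ^ k)) * H k ω ^ 5 := fun k ω => by
    have h : 0 ≤ (4 * B ^ 2 * s ^ 2) * H k ω ^ 2 := by positivity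
    exact (mul_le_mul_of_nonneg_left (hVb k ω) h).trans (le_of_eq (by ring))
  have hZVi : ∀ k, Integrable (fun ω => (4 * B ^ 2 * s ^ 2) * H k ω ^ 2 * V k (X k ω)) P :=
    fun k => by
      refine integrable_of_abs_le ?_ ((hHi (show 5 ≤ 8 by norm_num) k).1.const_mul _) fun ω =>
        (abs_of_nonneg ?_).trans_le (hZV k ω)
      · exact (((hHm k).pow_const 2).const_mul _).mul ((hVm k).comp (hXm k))
      · exact mul_nonneg (mul_nonneg (by positivity) (sq_nonneg _)) (hV0 k _)
  have hdv : ∀ k, ∫ ω, φ k (X k ω, ε ((k + 1 : ℕ) : ℤ) ω) ^ 4 ∂P ≤ (4 * B ^ 2 * s ^ 2) * v k := by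
    intro k
    have hHF : Measurable[hε.past k] fun ω => (4 * B ^ 2 * s ^ 2) * H k ω ^ 2 :=
      ((hε.measurable_envelope r k).pow_const 2).const_mul _
    have hind := indepFun_succ_of_measurable_natural (fun j : ℕ => hε.measurable j) hε.indep
      (k := k) (hHF.prodMk (hXF k))
    calc _ ≤ ∫ ω, (4 * B ^ 2 * s ^ 2) * H k ω ^ 2 * φ k (X k ω, ε ((k + 1 : ℕ) : ℤ) ω) ^ 2 ∂P :=
          integral_mono (hd4 k) (hZd k) (hd4b k)
      _ ≤ ∫ ω, (4 * B ^ 2 * s ^ 2) * H k ω ^ 2 * V k (X k ω) ∂P :=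
          integral_mul_comp_le (ψ := fun z => φ k z ^ 2) (hXm k) (hε.measurable _)
            (((hHm k).pow_const 2).const_mul _) (fun ω => by positivity) hind
            ((hφm k).pow_const 2) (fun x => sq_nonneg _) (hφV k) (hZd k) (hZVi k)
      _ ≤ ∫ ω, (4 * B ^ 2 * s ^ 2) * (s ^ 2 * B' * (s + q ^ k)) * H k ω ^ 5 ∂P :=
          integral_mono (hZVi k) ((hHi (show 5 ≤ 8 by norm_num) k).1.const_mul _) (hZV k)
      _ = (4 * B ^ 2 * s ^ 2) * (s ^ 2 * B' * (s + q ^ k)) * ∫ ω, H k ω ^ 5 ∂P :=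
          integral_const_mul _ _
      _ ≤ (4 * B ^ 2 * s ^ 2) * (s ^ 2 * B' * (s + q ^ k)) * K := by
          have := ha0 k
          gcongr
          exact (hHi (show 5 ≤ 8 by norm_num) k).2
      _ = _ := by simp only [v]; ring
  have hmain := integral_sum_comp_pow_four_le (fun j : ℕ => hε.measurable j) hε.indep hXF hφm hφ0
    hVm hφV hd4 hV2 (a := 4 * B ^ 2 * s ^ 2) (by positivity) hv hVv hdv n
  refine ⟨hmain.1, hmain.2.trans ?_⟩
  have hsum : ∑ k ∈ Finset.range n, v k ≤ B' * K * (1 + (1 - q)⁻¹) * s := by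
    simp only [v]
    rw [← Finset.mul_sum]
    calc _ ≤ s ^ 2 * B' * K * ((1 + (1 - q)⁻¹) * √(n : ℝ)) := by
          gcongr; exact sum_inv_sqrt_add_pow_le hq hq1 hn
      _ = B' * K * (1 + (1 - q)⁻¹) * s * (s * √(n : ℝ)) := by ring
      _ = _ := by rw [hsdef, inv_mul_cancel₀ (by positivity), mul_one]
  have hsum0 : 0 ≤ ∑ k ∈ Finset.range n, v k := Finset.sum_nonneg fun k _ => (hv k).le
  calc _ ≤ (4 * B ^ 2 * s + 6 * (B' * K * (1 + (1 - q)⁻¹) * s)) ^ 2 := by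
        gcongr
        nlinarith
    _ = (4 * B ^ 2 + 6 * (B' * K * (1 + (1 - q)⁻¹))) ^ 2 * s ^ 2 := by ring
    _ = _ := by rw [hsn, div_eq_mul_inv]

set_option maxHeartbeats 1000000 in
/-- A fourth-moment law of large numbers for quadratic functions of the innovations. -/
theorem exists_integral_quadratic_pow_four_le (hε : IsInnovation P ε μ) {r B p : ℝ} (hr0 : 0 ≤ r)
    (hr : r < 1) (hB : 0 < B) {Y : ℕ → Ω → ℝ} (hYm : ∀ k, Measurable[hε.past k] (Y k))
    (hY : ∀ k ω, |Y k ω| ≤ B * envelope r (fun i => ε i ω) k) :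
    ∃ C : ℝ, ∀ n : ℕ, 1 ≤ n →
      Integrable (fun ω => (∑ k ∈ Finset.range n, (n : ℝ)⁻¹ *
        (p * (ε ((k + 1 : ℕ) : ℤ) ω ^ 2 - ∫ x, x ^ 2 ∂μ) + Y k ω * ε ((k + 1 : ℕ) : ℤ) ω)) ^ 4) P ∧
      ∫ ω, (∑ k ∈ Finset.range n, (n : ℝ)⁻¹ *
        (p * (ε ((k + 1 : ℕ) : ℤ) ω ^ 2 - ∫ x, x ^ 2 ∂μ) + Y k ω * ε ((k + 1 : ℕ) : ℤ) ω)) ^ 4 ∂P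
          ≤ C / n := by
  obtain ⟨K, hK1, hK⟩ := hε.exists_envelope_moment hr0 hr
  have hK0 : 0 < K := by linarith
  have hμ : IsProbabilityMeasure μ := hε.isProbabilityMeasure
  have hxm : ∀ m : ℕ, m ≤ 8 → Integrable (fun x : ℝ => x ^ m) μ := fun m hm => by
    refine integrable_of_abs_le (by fun_prop) ((integrable_const (1 : ℝ)).add hε.moment)
      fun x => ?_
    rw [abs_pow, Pi.add_apply, ← Even.pow_abs (show Even 8 by decide) x]
    rcases le_total |x| 1 with h | h
    · have := pow_le_one₀ (n := m) (abs_nonneg x) h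
      have := pow_nonneg (abs_nonneg x) 8
      linarith
    · have := pow_le_pow_right₀ h hm
      linarith
  set σ2 : ℝ := ∫ x, x ^ 2 ∂μ with hσ2
  have hσ0 : 0 ≤ σ2 := integral_nonneg fun x => sq_nonneg x
  have hx1 : Integrable (fun x : ℝ => x) μ := by simpa using hxm 1 (by norm_num)
  have hx2 := hxm 2 (by norm_num)
  have hx4 := hxm 4 (by norm_num)
  have hc2 : Integrable (fun x : ℝ => (x ^ 2 - σ2) ^ 2) μ := by
    have : Integrable (fun x : ℝ => x ^ 4 - 2 * σ2 * x ^ 2 + σ2 ^ 2) μ :=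
      (hx4.sub (hx2.const_mul _)).add (integrable_const _)
    refine this.congr (ae_of_all _ fun x => ?_)
    simp only; ring
  set m4 : ℝ := ∫ x, (x ^ 2 - σ2) ^ 2 ∂μ with hm4
  have hm40 : 0 ≤ m4 := integral_nonneg fun x => sq_nonneg _
  set H : ℕ → Ω → ℝ := fun k ω => envelope r (fun i => ε i ω) k with hH
  have hH1 : ∀ k ω, 1 ≤ H k ω := fun k ω => one_le_envelope hr0 k
  have hH0 : ∀ k ω, 0 ≤ H k ω := fun k ω => zero_le_one.trans (hH1 k ω)
  have hHi := fun {m : ℕ} (hm : m ≤ 8) k => hε.integrable_envelope_pow hr0 hK hm k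
  set B1 : ℝ := 2 * p ^ 2 * m4 + 2 * B ^ 2 * σ2 with hB1
  have hB10 : 0 ≤ B1 := by positivity
  set B2 : ℝ := |p| * (1 + σ2) + B with hB2
  have hB20 : 0 < B2 := by positivity
  -- One constant for both requirements: B1 K serves the conditional variance, 16 B2⁴ K the fourth
  -- moment.
  set D : ℝ := B1 * K + 16 * B2 ^ 4 * K with hD
  have hD0 : 0 < D := by positivity
  refine ⟨(1 + 6 * D) ^ 2, fun n hn => ?_⟩
  have hn0 : (0 : ℝ) < n := by exact_mod_cast hn
  have hn1 : (1 : ℝ) ≤ n := by exact_mod_cast hn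
  set s : ℝ := (n : ℝ)⁻¹ with hs
  have hs0 : 0 < s := by positivity
  have hs1 : s ≤ 1 := inv_le_one_of_one_le₀ hn1
  have hYm' : ∀ k, Measurable (Y k) := fun k => (hYm k).mono (hε.past.le k) le_rfl
  let φ : ℕ → ℝ × ℝ → ℝ := fun _ z => s * (p * (z.2 ^ 2 - σ2) + z.1 * z.2)
  let V : ℕ → ℝ → ℝ := fun _ y => s ^ 2 * (2 * p ^ 2 * m4 + 2 * y ^ 2 * σ2)
  have hφm : ∀ k, Measurable (φ k) := fun k => by fun_prop
  have hVm : ∀ k, Measurable (V k) := fun k => by fun_prop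
  have hmap : ∀ k : ℕ, P.map (ε ((k + 1 : ℕ) : ℤ)) = μ := fun k => hε.map_eq _
  have hφ0 : ∀ k x, ∫ t, φ k (x, t) ∂(P.map (ε ((k + 1 : ℕ) : ℤ))) = 0 := fun k x => by
    rw [hmap]
    simp only [φ]
    have hi : Integrable (fun t : ℝ => t ^ 2 - σ2) μ := hx2.sub (integrable_const _)
    rw [integral_const_mul, integral_add (hi.const_mul p)
      (hx1.const_mul x), integral_const_mul, integral_const_mul,
      integral_sub hx2 (integrable_const _), hε.mean]
    simp [hσ2]
  have hφV : ∀ k x, ∫ t, φ k (x, t) ^ 2 ∂(P.map (ε ((k + 1 : ℕ) : ℤ))) ≤ V k x := fun k x => by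
    rw [hmap]
    simp only [φ, V, mul_pow s]
    rw [integral_const_mul]
    refine mul_le_mul_of_nonneg_left ?_ (sq_nonneg s)
    have hi : Integrable (fun t : ℝ => 2 * p ^ 2 * (t ^ 2 - σ2) ^ 2 + 2 * x ^ 2 * t ^ 2) μ :=
      (hc2.const_mul _).add (hx2.const_mul _)
    refine (integral_mono_of_nonneg (ae_of_all _ fun t => sq_nonneg _) hi
      (ae_of_all _ fun t => ?_)).trans (le_of_eq ?_)
    · simp only
      nlinarith [sq_nonneg (p * (t ^ 2 - σ2) - x * t)]
    · rw [integral_add (hc2.const_mul _) (hx2.const_mul _), integral_const_mul, integral_const_mul]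
  have hV0 : ∀ k x, 0 ≤ V k x := fun k x => by positivity
  have hVb : ∀ k ω, V k (Y k ω) ^ 2 ≤ (s ^ 2 * B1) ^ 2 * H k ω ^ 4 := by
    intro k ω
    have h1 : Y k ω ^ 2 ≤ (B * H k ω) ^ 2 := by
      rw [← sq_abs]; gcongr; exact hY k ω
    have h2 : (1 : ℝ) ≤ H k ω ^ 2 := one_le_pow₀ (hH1 k ω)
    have h3 : V k (Y k ω) ≤ s ^ 2 * B1 * H k ω ^ 2 := by
      simp only [V]
      calc _ ≤ s ^ 2 * (2 * p ^ 2 * m4 * H k ω ^ 2 + 2 * (B * H k ω) ^ 2 * σ2) := by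
            have h4 : 2 * p ^ 2 * m4 ≤ 2 * p ^ 2 * m4 * H k ω ^ 2 :=
              le_mul_of_one_le_right (by positivity) h2
            gcongr
        _ = _ := by rw [hB1]; ring
    refine (pow_le_pow_left₀ (hV0 k _) h3 2).trans (le_of_eq ?_)
    ring
  have hV2 : ∀ k, Integrable (fun ω => V k (Y k ω) ^ 2) P := fun k =>
    integrable_of_abs_le (((hVm k).comp (hYm' k)).pow_const 2)
      ((hHi (show 4 ≤ 8 by norm_num) k).1.const_mul _) fun ω => by
        rw [abs_of_nonneg (sq_nonneg _)]; exact hVb k ω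
  have hVv : ∀ k, ∫ ω, V k (Y k ω) ^ 2 ∂P ≤ (s ^ 2 * D) ^ 2 := fun k => by
    refine (integral_mono (hV2 k) ((hHi (show 4 ≤ 8 by norm_num) k).1.const_mul _) (hVb k)).trans ?_
    rw [integral_const_mul]
    calc (s ^ 2 * B1) ^ 2 * ∫ ω, H k ω ^ 4 ∂P ≤ (s ^ 2 * B1) ^ 2 * K ^ 2 := by
          gcongr
          exact (hHi (show 4 ≤ 8 by norm_num) k).2.trans (by nlinarith)
      _ = (s ^ 2 * (B1 * K)) ^ 2 := by ring
      _ ≤ _ := by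
        gcongr
        rw [hD]
        have : 0 ≤ 16 * B2 ^ 4 * K := by positivity
        linarith
  have hdm : ∀ k, Measurable fun ω => φ k (Y k ω, ε ((k + 1 : ℕ) : ℤ) ω) := fun k =>
    (hφm k).comp ((hYm' k).prodMk (hε.measurable _))
  -- The fourth power of a quadratic function of the innovations uses the full eighth moment.
  have hdb : ∀ k ω, φ k (Y k ω, ε ((k + 1 : ℕ) : ℤ) ω) ^ 4
      ≤ s ^ 4 * B2 ^ 4 * (8 * (H (k + 1) ω ^ 8 + H k ω ^ 8)) := by
    intro k ω
    have ht : |ε ((k + 1 : ℕ) : ℤ) ω| ≤ H (k + 1) ω :=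
      abs_le_envelope (e := fun i => ε i ω) hr0 (k + 1)
    set t := ε ((k + 1 : ℕ) : ℤ) ω
    have h1 := hH1 k ω
    have h2 := hH1 (k + 1) ω
    have hb : |p * (t ^ 2 - σ2) + Y k ω * t| ≤ B2 * (H (k + 1) ω ^ 2 + H k ω ^ 2) := by
      have e1 : |p * (t ^ 2 - σ2)| ≤ |p| * (1 + σ2) * (H (k + 1) ω ^ 2 + H k ω ^ 2) := by
        rw [abs_mul, mul_assoc]
        gcongr
        have ht2 : t ^ 2 ≤ H (k + 1) ω ^ 2 := by rw [← sq_abs]; gcongr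
        have h3 : 1 ≤ H k ω ^ 2 := one_le_pow₀ h1
        have h4 := mul_nonneg hσ0 (sq_nonneg (H (k + 1) ω))
        have h5 := mul_le_mul_of_nonneg_left h3 hσ0
        have h6 := sq_nonneg t
        rw [abs_le]
        constructor <;> linarith
      have e2 : |Y k ω * t| ≤ B * (H (k + 1) ω ^ 2 + H k ω ^ 2) := by
        rw [abs_mul]
        calc _ ≤ B * H k ω * H (k + 1) ω := mul_le_mul (hY k ω) ht (abs_nonneg _) (by positivity)
          _ = B * (H k ω * H (k + 1) ω) := by ring
          _ ≤ _ := by gcongr; nlinarith [sq_nonneg (H k ω - H (k + 1) ω)]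
      refine (abs_add_le _ _).trans ((add_le_add e1 e2).trans (le_of_eq ?_))
      rw [hB2]; ring
    have h4 := pow_le_pow_left₀ (abs_nonneg _) hb 4
    rw [Even.pow_abs (by decide)] at h4
    simp only [φ, mul_pow s]
    have h5 := add_pow_four_le (H (k + 1) ω ^ 2) (H k ω ^ 2)
    rw [← pow_mul, ← pow_mul] at h5
    calc _ ≤ s ^ 4 * (B2 * (H (k + 1) ω ^ 2 + H k ω ^ 2)) ^ 4 := by gcongr
      _ = s ^ 4 * B2 ^ 4 * (H (k + 1) ω ^ 2 + H k ω ^ 2) ^ 4 := by ring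
      _ ≤ _ := by gcongr
  have hHH : ∀ k, Integrable (fun ω => s ^ 4 * B2 ^ 4 * (8 * (H (k + 1) ω ^ 8 + H k ω ^ 8))) P :=
    fun k => (((hK (k + 1)).1.add (hK k).1).const_mul 8).const_mul _
  have hd4 : ∀ k, Integrable (fun ω => φ k (Y k ω, ε ((k + 1 : ℕ) : ℤ) ω) ^ 4) P := fun k =>
    integrable_of_abs_le ((hdm k).pow_const 4) (hHH k) fun ω => by
      rw [abs_of_nonneg (by positivity)]; exact hdb k ω
  have hdv : ∀ k, ∫ ω, φ k (Y k ω, ε ((k + 1 : ℕ) : ℤ) ω) ^ 4 ∂P ≤ s ^ 2 * (s ^ 2 * D) := by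
    intro k
    refine (integral_mono (hd4 k) (hHH k) (hdb k)).trans ?_
    have h1 : ∫ ω, (H (k + 1) ω ^ 8 + H k ω ^ 8) ∂P ≤ K + K :=
      (integral_add (hK (k + 1)).1 (hK k).1).trans_le (add_le_add (hK (k + 1)).2 (hK k).2)
    calc _ = s ^ 4 * B2 ^ 4 * (8 * ∫ ω, (H (k + 1) ω ^ 8 + H k ω ^ 8) ∂P) := by
          rw [integral_const_mul, integral_const_mul]
      _ ≤ s ^ 4 * B2 ^ 4 * (8 * (K + K)) := by gcongr
      _ = s ^ 4 * (16 * B2 ^ 4 * K) := by ring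
      _ ≤ s ^ 4 * D := by
        gcongr
        rw [hD]
        have : 0 ≤ B1 * K := by positivity
        linarith
      _ = _ := by ring
  have hmain := integral_sum_comp_pow_four_le (fun j : ℕ => hε.measurable j) hε.indep hYm hφm hφ0
    hVm hφV hd4 hV2 (v := fun _ => s ^ 2 * D) (a := s ^ 2) (by positivity)
    (fun _ => by positivity) hVv hdv n
  refine ⟨hmain.1, hmain.2.trans ?_⟩
  rw [Finset.sum_const, Finset.card_range, nsmul_eq_mul]
  have hns : (n : ℝ) * (s ^ 2 * D) = s * D := by rw [hs]; field_simp
  rw [hns]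
  calc (s ^ 2 + 6 * (s * D)) ^ 2 ≤ (s + 6 * (s * D)) ^ 2 := by gcongr; nlinarith
    _ = (1 + 6 * D) ^ 2 * s ^ 2 := by ring
    _ ≤ (1 + 6 * D) ^ 2 * s := by gcongr; nlinarith
    _ = _ := by rw [hs, div_eq_mul_inv]

end IsInnovation

/-! ### Sums of scores and discretisation in (x, τ) -/

section sums
variable {r ρ α θ : ℝ} {e : ℤ → ℝ}

theorem abs_inv_sq_sub_inv_sq_le (hρ1 : ρ < 1) (hα : |α| ≤ ρ) (hθ : |θ| ≤ ρ) :
    |1 / (1 - θ) ^ 2 - 1 / (1 - α) ^ 2| ≤ 4 * (1 - ρ)⁻¹ ^ 4 * |θ - α| := by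
  obtain ⟨ha1, ha2⟩ := abs_le.1 hα
  obtain ⟨ht1, ht2⟩ := abs_le.1 hθ
  have h0 : 0 < 1 - ρ := sub_pos.2 hρ1
  have hA : 1 - ρ ≤ 1 - α := by linarith
  have hT : 1 - ρ ≤ 1 - θ := by linarith
  have hA0 : 0 < 1 - α := by linarith
  have hT0 : 0 < 1 - θ := by linarith
  have e1 : 1 / (1 - θ) ^ 2 - 1 / (1 - α) ^ 2
      = (θ - α) * (2 - θ - α) * ((1 - θ)⁻¹ ^ 2 * (1 - α)⁻¹ ^ 2) := by field_simp; ring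
  rw [e1, abs_mul, abs_mul, abs_of_nonneg (show 0 ≤ (1 - θ)⁻¹ ^ 2 * (1 - α)⁻¹ ^ 2 by positivity)]
  have h2 : |2 - θ - α| ≤ 4 := by rw [abs_le]; constructor <;> linarith
  calc _ ≤ |θ - α| * 4 * ((1 - ρ)⁻¹ ^ 2 * (1 - ρ)⁻¹ ^ 2) := by gcongr
    _ = _ := by ring

theorem abs_sum_maObs_le (hr : 0 ≤ r) (hα : |α| ≤ 1) (n : ℕ) :
    |∑ k ∈ Finset.range n, maObs α e ((k + 1 : ℕ) : ℤ)|
      ≤ 2 * |∑ k ∈ Finset.range n, e ((k + 1 : ℕ) : ℤ)| + (envelope r e 0 + envelope r e n) := by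
  have h : ∑ k ∈ Finset.range n, maObs α e ((k + 1 : ℕ) : ℤ)
      = (1 - α) * ∑ k ∈ Finset.range n, e ((k + 1 : ℕ) : ℤ) + α * (e (n : ℤ) - e 0) := by
    induction n with
    | zero => simp
    | succ n ih => rw [Finset.sum_range_succ, ih, Finset.sum_range_succ]; simp [maObs]; ring
  have h0 : |e 0| ≤ envelope r e 0 := by simpa using abs_le_envelope (e := e) hr 0
  have hn : |e (n : ℤ)| ≤ envelope r e n := abs_le_envelope (e := e) hr n
  have h1 : |1 - α| ≤ 2 := by
    obtain ⟨h1, h2⟩ := abs_le.1 hα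
    rw [abs_le]; constructor <;> linarith
  rw [h]
  refine (abs_add_le _ _).trans (add_le_add ?_ ?_)
  · rw [abs_mul]; gcongr
  · rw [abs_mul]
    calc |α| * |e (n : ℤ) - e 0| ≤ 1 * |e (n : ℤ) - e 0| := by gcongr
      _ ≤ |e (n : ℤ)| + |e 0| := by rw [one_mul]; exact abs_sub _ _
      _ ≤ _ := by linarith

/-- In the closed form `sum_score` the parameter enters the long random sum only through the factor
(1 - θ)⁻², which is Lipschitz; everything else is a boundary term. Uniformity in θ therefore needs
no chaining. -/
theorem abs_sum_score_sub_le (hρr : ρ < r) (hr1 : r ≤ 1) (hρ : 0 ≤ ρ) (hα : |α| ≤ ρ)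
    (hθ : |θ| ≤ ρ) (n : ℕ) :
    |∑ k ∈ Finset.range n, (score α e θ k - score α e α k)|
      ≤ 4 * (1 - ρ)⁻¹ ^ 4 * |θ - α| * (2 * |∑ k ∈ Finset.range n, e ((k + 1 : ℕ) : ℤ)|
          + (envelope r e 0 + envelope r e n))
        + 2 * ((1 - ρ)⁻¹ ^ 2 + (r - ρ)⁻¹ * (1 - ρ)⁻¹) * envelope r e n := by
  have hρ1 : ρ < 1 := hρr.trans_le hr1
  have hα1 : |α| ≤ 1 := hα.trans hρ1.le
  have h0 : 0 < 1 - ρ := sub_pos.2 hρ1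
  have hc : 0 < r - ρ := sub_pos.2 hρr
  have hne : ∀ {t : ℝ}, |t| ≤ ρ → t ≠ 1 := fun {t} ht h => by rw [h, abs_one] at ht; linarith
  rw [Finset.sum_sub_distrib, sum_score α e θ (hne hθ), sum_score α e α (hne hα)]
  set U := ∑ k ∈ Finset.range n, maObs α e ((k + 1 : ℕ) : ℤ)
  have hU : |U| ≤ _ := abs_sum_maObs_le (e := e) (r := r) (hρ.trans hρr.le) hα1 n
  have hb : ∀ {t : ℝ}, |t| ≤ ρ → |maResidual (maObs α e) t n / (1 - t) ^ 2
      + t * residualDeriv (maObs α e) t n / (1 - t)|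
      ≤ ((1 - ρ)⁻¹ ^ 2 + (r - ρ)⁻¹ * (1 - ρ)⁻¹) * envelope r e n := by
    intro t ht
    obtain ⟨ht1, ht2⟩ := abs_le.1 ht
    have hT : 1 - ρ ≤ 1 - t := by linarith
    have hT0 : 0 < 1 - t := by linarith
    have h1 := abs_maResidual_le (e := e) hρr.le hρ hα1 ht n
    have h2 := (abs_residualDeriv_le (e := e) hρr hr1 hρ hα1 ht n).1
    have hH : 0 ≤ envelope r e n := zero_le_one.trans (one_le_envelope (hρ.trans hρr.le) n)
    refine (abs_add_le _ _).trans ?_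
    rw [add_mul]
    refine add_le_add ?_ ?_
    · rw [abs_div, abs_of_pos (show 0 < (1 - t) ^ 2 by positivity), div_eq_inv_mul, ← inv_pow]
      gcongr
    · rw [abs_div, abs_of_pos hT0, div_eq_inv_mul, abs_mul]
      calc (1 - t)⁻¹ * (|t| * |residualDeriv (maObs α e) t n|)
          ≤ (1 - ρ)⁻¹ * (1 * ((r - ρ)⁻¹ * envelope r e n)) := by
            gcongr; exact ht.trans hρ1.le
        _ = _ := by ring
  have e1 : (U - maResidual (maObs α e) θ n) / (1 - θ) ^ 2
        - θ * residualDeriv (maObs α e) θ n / (1 - θ)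
      - ((U - maResidual (maObs α e) α n) / (1 - α) ^ 2
        - α * residualDeriv (maObs α e) α n / (1 - α))
      = (1 / (1 - θ) ^ 2 - 1 / (1 - α) ^ 2) * U
        - (maResidual (maObs α e) θ n / (1 - θ) ^ 2 + θ * residualDeriv (maObs α e) θ n / (1 - θ))
        + (maResidual (maObs α e) α n / (1 - α) ^ 2
          + α * residualDeriv (maObs α e) α n / (1 - α)) := by ring
  rw [e1]
  have a1 : |(1 / (1 - θ) ^ 2 - 1 / (1 - α) ^ 2) * U| ≤ 4 * (1 - ρ)⁻¹ ^ 4 * |θ - α|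
      * (2 * |∑ k ∈ Finset.range n, e ((k + 1 : ℕ) : ℤ)|
          + (envelope r e 0 + envelope r e n)) := by
    rw [abs_mul]
    exact mul_le_mul (abs_inv_sq_sub_inv_sq_le hρ1 hα hθ) hU (abs_nonneg _) (by positivity)
  have a2 := hb hθ
  have a3 := hb hα
  refine (abs_add_le _ _).trans ((add_le_add (abs_sub _ _) le_rfl).trans ?_)
  linarith

theorem score_self_succ (α : ℝ) (e : ℤ → ℝ) (k : ℕ) :
    score α e α (k + 1) = e ((k + 1 : ℕ) : ℤ) - α ^ (k + 1) * e 0 + α * score α e α k := by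
  rw [score_eq, maResidual_self, score]

/-- The mean square of the derivatives at `α`, up to explicit remainders. -/
theorem abs_sum_score_sq_sub_le (hρr : ρ < r) (hr1 : r ≤ 1) (hρ : 0 ≤ ρ) (hα : |α| ≤ ρ)
    (σ2 : ℝ) (n : ℕ) :
    |∑ k ∈ Finset.range n, ((1 - α ^ 2) * score α e α k ^ 2 - σ2)|
      ≤ |∑ k ∈ Finset.range n, ((e ((k + 1 : ℕ) : ℤ) ^ 2 - σ2)
            + 2 * α * score α e α k * e ((k + 1 : ℕ) : ℤ))|
        + (r - ρ)⁻¹ ^ 2 * envelope r e n ^ 2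
        + (2 + 2 * (r - ρ)⁻¹) * ∑ k ∈ Finset.range n,
            (ρ / r) ^ k * (envelope r e k ^ 2 + envelope r e (k + 1) ^ 2) := by
  have hα1 : |α| ≤ 1 := hα.trans (hρr.trans_le hr1).le
  have hr0 : 0 < r := hρ.trans_lt hρr
  have hc : 0 < (r - ρ)⁻¹ := inv_pos.2 (sub_pos.2 hρr)
  have hq0 : 0 ≤ ρ / r := by positivity
  have hq1 : ρ / r ≤ 1 := (div_le_one hr0).2 hρr.le
  set c := (r - ρ)⁻¹ with hcdef
  let R : ℕ → ℝ := fun k => (α ^ (k + 1) * e 0) ^ 2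
    - 2 * (α ^ (k + 1) * e 0) * (e ((k + 1 : ℕ) : ℤ) + α * score α e α k)
  -- Square the autoregression `score_self_succ` and telescope; the score at 0 vanishes, and R
  -- collects the terms with ε_0.
  have hid : ∑ k ∈ Finset.range n, ((1 - α ^ 2) * score α e α k ^ 2 - σ2)
      = ∑ k ∈ Finset.range n, ((e ((k + 1 : ℕ) : ℤ) ^ 2 - σ2)
            + 2 * α * score α e α k * e ((k + 1 : ℕ) : ℤ))
        - score α e α n ^ 2 + ∑ k ∈ Finset.range n, R k := by
    induction n with
    | zero => simp [score_eq, residualDeriv_zero, maResidual]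
    | succ n ih =>
      rw [Finset.sum_range_succ, ih, Finset.sum_range_succ, Finset.sum_range_succ, score_self_succ]
      simp only [R]; ring
  have hR : ∀ k, |R k| ≤ (2 + 2 * c) * ((ρ / r) ^ k
      * (envelope r e k ^ 2 + envelope r e (k + 1) ^ 2)) := by
    intro k
    have hp : |α ^ (k + 1) * e 0| ≤ (ρ / r) ^ k * envelope r e k := by
      have := abs_residShift_self_le (e := e) hρr hρ hα1 hα k
      rwa [residShift_self, abs_neg] at this
    have h1 := one_le_envelope (e := e) hr0.le k
    have h2 := one_le_envelope (e := e) hr0.le (k + 1)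
    have h3 := abs_le_envelope (e := e) hr0.le (k + 1)
    have h4 := (abs_residualDeriv_le (e := e) hρr hr1 hρ hα1 hα k).2
    have hqk : (ρ / r) ^ k ≤ 1 := pow_le_one₀ hq0 hq1
    have hqk0 : 0 ≤ (ρ / r) ^ k := by positivity
    have h5 : |e ((k + 1 : ℕ) : ℤ) + α * score α e α k| ≤ envelope r e (k + 1) + c * envelope r e k := by
      refine (abs_add_le _ _).trans (add_le_add h3 ?_)
      rw [abs_mul]
      exact (mul_le_of_le_one_left (abs_nonneg _) hα1).trans h4
    generalize envelope r e k = a at *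
    generalize envelope r e (k + 1) = b at *
    generalize (ρ / r) ^ k = Q at *
    have a1 : |(α ^ (k + 1) * e 0) ^ 2| ≤ Q * a ^ 2 := by
      rw [abs_pow]
      calc _ ≤ (Q * a) ^ 2 := by gcongr
        _ = Q * (Q * a ^ 2) := by ring
        _ ≤ 1 * (Q * a ^ 2) := by gcongr
        _ = _ := one_mul _
    have a2 : |2 * (α ^ (k + 1) * e 0) * (e ((k + 1 : ℕ) : ℤ) + α * score α e α k)|
        ≤ Q * (a ^ 2 + b ^ 2 + 2 * c * a ^ 2) := by
      rw [abs_mul, abs_mul, abs_two]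
      calc _ ≤ 2 * (Q * a) * (b + c * a) := by gcongr
        _ = Q * (2 * a * b + 2 * c * a ^ 2) := by ring
        _ ≤ _ := by gcongr; nlinarith [sq_nonneg (a - b)]
    calc |R k| ≤ _ := abs_sub _ _
      _ ≤ Q * a ^ 2 + Q * (a ^ 2 + b ^ 2 + 2 * c * a ^ 2) := add_le_add a1 a2
      _ = Q * (2 * a ^ 2 + b ^ 2 + 2 * c * a ^ 2) := by ring
      _ ≤ Q * ((2 + 2 * c) * (a ^ 2 + b ^ 2)) := by gcongr; nlinarith [sq_nonneg b]
      _ = _ := by ring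
  have hY : score α e α n ^ 2 ≤ c ^ 2 * envelope r e n ^ 2 := by
    rw [← mul_pow, ← sq_abs]
    gcongr
    exact (abs_residualDeriv_le (e := e) hρr hr1 hρ hα1 hα n).2
  have hRs : |∑ k ∈ Finset.range n, R k| ≤ (2 + 2 * c) * ∑ k ∈ Finset.range n,
            (ρ / r) ^ k * (envelope r e k ^ 2 + envelope r e (k + 1) ^ 2) := by
    rw [Finset.mul_sum]
    exact (Finset.abs_sum_le_sum_abs _ _).trans (Finset.sum_le_sum fun k _ => hR k)
  rw [hid]
  refine (abs_add_le _ _).trans (add_le_add ((abs_sub _ _).trans (add_le_add le_rfl ?_)) hRs)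
  rwa [abs_of_nonneg (sq_nonneg _)]

/-- The difference of weighted empirical processes is controlled by its values on a grid. -/
theorem abs_sum_centredInd_sub_le {G : ℝ → ℝ} {M B T Θ δ lam : ℝ} {n I : ℕ} {J : ℕ}
    (hG0 : ∀ x, 0 ≤ G x) (hG1 : ∀ x, G x ≤ 1)
    (hL : ∀ x y, |G y - G x| ≤ M * |y - x|) (hM : 0 ≤ M) (hB : 0 ≤ B) {H b : ℕ → ℝ}
    (hH : ∀ k, 1 ≤ H k) {W ξ : ℝ → ℕ → ℝ} (hn : 1 ≤ n) (hδ : 0 < δ) (hΘ : 0 ≤ Θ) (hT : Θ + δ ≤ T)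
    (hI : Θ / δ + 1 ≤ I)
    (hW0 : ∀ τ k, |τ| ≤ T → 0 ≤ W τ k) (hWB : ∀ τ k, |τ| ≤ T → W τ k ≤ B * H k)
    (hWL : ∀ τ τ' k, |τ| ≤ T → |τ'| ≤ T → |W τ k - W τ' k| ≤ B * ((√(n : ℝ))⁻¹ * |τ - τ'|) * H k)
    (hξL : ∀ τ τ' k, |τ| ≤ T → |τ'| ≤ T → |ξ τ k - ξ τ' k| ≤ B * ((√(n : ℝ))⁻¹ * |τ - τ'|) * H k)
    (hgrid : ∀ i ∈ Finset.Icc (-I : ℤ) I, ∀ j ∈ Finset.Icc (-J : ℤ) J,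
      |empIncr G (W (δ * i)) (fun k => ξ (δ * i) k - (√(n : ℝ))⁻¹ * δ * (1 + B * H k)) (W 0) b n
        ((√(n : ℝ))⁻¹ * δ * j)| ≤ lam ∧
      |empIncr G (W (δ * i)) (fun k => ξ (δ * i) k + (√(n : ℝ))⁻¹ * δ * (1 + B * H k)) (W 0) b n
        ((√(n : ℝ))⁻¹ * δ * j)| ≤ lam)
    {τ x : ℝ} (hτ : |τ| ≤ Θ) (hx : |x| ≤ (√(n : ℝ))⁻¹ * δ * (J - 1)) :
    |∑ k ∈ Finset.range n, (√(n : ℝ))⁻¹ *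
      (W τ k * centredInd G (x - ξ τ k) (b k) - W 0 k * centredInd G x (b k))|
      ≤ lam + (B * M * (2 + 2 * B) + B) * (δ * ((n : ℝ)⁻¹ * ∑ k ∈ Finset.range n, H k ^ 2)) := by
  have hn0 : (0 : ℝ) < n := by exact_mod_cast hn
  have hs0 : 0 < (√(n : ℝ))⁻¹ := inv_pos.2 (Real.sqrt_pos.2 hn0)
  have hsn : (√(n : ℝ))⁻¹ * (√(n : ℝ))⁻¹ = (n : ℝ)⁻¹ := by
    rw [← mul_inv, Real.mul_self_sqrt hn0.le]
  set s := (√(n : ℝ))⁻¹ with hs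
  set h := s * δ with hh
  have hh0 : 0 < h := by positivity
  set K := B * M * (2 + 2 * B) + B with hK
  have hT0 : |(0 : ℝ)| ≤ T := by rw [abs_zero]; linarith
  -- The cell of (τ, x). Its left end δ i may lie up to δ beyond [-Θ, Θ], which is why T ≥ Θ + δ.
  set i : ℤ := ⌊τ / δ⌋ with hi
  set j : ℤ := ⌊x / h⌋ with hj
  have hi1 : δ * i ≤ τ := by
    have := Int.floor_le (τ / δ)
    rw [le_div_iff₀ hδ] at this; linarith
  have hi2 : τ < δ * i + δ := by
    have := Int.lt_floor_add_one (τ / δ)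
    rw [div_lt_iff₀ hδ] at this; linarith
  have hj1 : h * j ≤ x := by
    have := Int.floor_le (x / h)
    rw [le_div_iff₀ hh0] at this; linarith
  have hj2 : x < h * j + h := by
    have := Int.lt_floor_add_one (x / h)
    rw [div_lt_iff₀ hh0] at this; linarith
  obtain ⟨hτ1, hτ2⟩ := abs_le.1 hτ
  obtain ⟨hx1, hx2⟩ := abs_le.1 hx
  have hIδ : Θ + δ ≤ δ * I := by
    have := mul_le_mul_of_nonneg_left hI hδ.le
    rwa [mul_add, mul_div_cancel₀ _ hδ.ne', mul_one] at this
  have hτi : |τ - δ * i| ≤ δ := by rw [abs_le]; constructor <;> linarith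
  have hiT : |δ * (i : ℝ)| ≤ T := by rw [abs_le]; constructor <;> linarith
  have hτT : |τ| ≤ T := by linarith
  have hiI : i ∈ Finset.Icc (-I : ℤ) I := by
    rw [Finset.mem_Icc]
    constructor
    · have : (-I : ℝ) ≤ i := le_of_mul_le_mul_left (by linarith) hδ
      exact_mod_cast this
    · have : (i : ℝ) ≤ I := le_of_mul_le_mul_left (by linarith) hδ
      exact_mod_cast this
  have hjJ : j ∈ Finset.Icc (-J : ℤ) J := by
    rw [Finset.mem_Icc]
    constructor
    · have : (-J : ℝ) ≤ j := le_of_mul_le_mul_left (by linarith) hh0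
      exact_mod_cast this
    · have : (j : ℝ) ≤ J := le_of_mul_le_mul_left (by linarith) hh0
      exact_mod_cast this
  -- The lower bracket uses the right end of the x-cell; the J - 1 in the range of x leaves room for
  -- it.
  have hjJ' : j + 1 ∈ Finset.Icc (-J : ℤ) J := by
    rw [Finset.mem_Icc] at hjJ ⊢
    constructor
    · linarith [hjJ.1]
    · have : ((j + 1 : ℤ) : ℝ) ≤ J := by
        push_cast
        exact le_of_mul_le_mul_left (by linarith) hh0
      exact_mod_cast this
  have hWi : ∀ k, |W τ k - W (δ * i) k| ≤ B * h * H k := fun k => by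
    have := zero_le_one.trans (hH k)
    refine (hWL τ (δ * i) k hτT hiT).trans ?_
    rw [hh]; gcongr
  have hξi : ∀ k, |ξ τ k - ξ (δ * i) k| ≤ B * h * H k := fun k => by
    have := zero_le_one.trans (hH k)
    refine (hξL τ (δ * i) k hτT hiT).trans ?_
    rw [hh]; gcongr
  -- There are n terms of size s h = δ/n, so the bracketing error is of order δ and does not vanish
  -- with n.
  have herr : ∑ k ∈ Finset.range n, s * (K * h * H k ^ 2)
      = K * (δ * ((n : ℝ)⁻¹ * ∑ k ∈ Finset.range n, H k ^ 2)) := by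
    rw [← hsn, hh, Finset.mul_sum, Finset.mul_sum, Finset.mul_sum]
    exact Finset.sum_congr rfl fun k _ => by ring
  have hup := (abs_le.1 (hgrid i hiI j hjJ).1).2
  have hlo := (abs_le.1 (hgrid i hiI (j + 1) hjJ').2).1
  rw [abs_le]
  constructor
  · refine le_trans ?_ (Finset.sum_le_sum fun k _ => mul_le_mul_of_nonneg_left
      (bracket_lower (b := b k) (z := h * ((j + 1 : ℤ) : ℝ)) hG0 hG1 hL hM hB (hH k) hh0.le
        (hW0 _ k hiT) (hWB _ k hiT) (hW0 _ k hT0) (hWB _ k hT0) (hWi k) (hξi k)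
        (by push_cast; linarith) (by push_cast; linarith)) hs0.le)
    simp only [mul_sub s, Finset.sum_sub_distrib]
    rw [herr]
    simp only [empIncr, ← hs, mul_sub s, Finset.sum_sub_distrib] at hlo
    linarith
  · refine (Finset.sum_le_sum fun k _ => mul_le_mul_of_nonneg_left
      (bracket_upper (b := b k) (z := h * (j : ℝ)) hG0 hG1 hL hM hB (hH k) hh0.le
        (hW0 _ k hiT) (hWB _ k hiT) (hW0 _ k hT0) (hWB _ k hT0) (hWi k) (hξi k)
        (by linarith) (by linarith)) hs0.le).trans ?_
    simp only [mul_add s, mul_sub s, Finset.sum_add_distrib, Finset.sum_sub_distrib]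
    rw [herr]
    simp only [empIncr, ← hs, mul_sub s, Finset.sum_sub_distrib] at hup
    linarith

end sums

/-! ### Local increments, remainders and the compensator -/

/-- The increment of the residual weighted empirical process, scaled by `√n`, in the local
parameter `τ`. -/
noncomputable def localIncr (α : ℝ) (e : ℤ → ℝ) (n : ℕ) (x τ : ℝ) : ℝ :=
  ∑ k ∈ Finset.range n, (√(n : ℝ))⁻¹ *
    (score α e (α + (√(n : ℝ))⁻¹ * τ) k *
        Set.indicator (Set.Iic (x - residShift α e (α + (√(n : ℝ))⁻¹ * τ) k)) (fun _ => (1 : ℝ))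
          (e ((k + 1 : ℕ) : ℤ))
      - score α e α k * Set.indicator (Set.Iic x) (fun _ => (1 : ℝ)) (e ((k + 1 : ℕ) : ℤ)))

theorem sqrt_mul_process_sub (α : ℝ) (e : ℤ → ℝ) {n : ℕ} (hn : 1 ≤ n) (x τ : ℝ) :
    √(n : ℝ) * (residualProcess (maObs α e) n x (α + τ / √(n : ℝ)) - innovationProcess α e n x)
      = localIncr α e n x τ := by
  have hn0 : (0 : ℝ) < n := by exact_mod_cast hn
  have hs : √(n : ℝ) ≠ 0 := (Real.sqrt_pos.2 hn0).ne'
  have h1 : √(n : ℝ) * (1 / (n : ℝ)) = (√(n : ℝ))⁻¹ := by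
    rw [mul_one_div, Real.sqrt_div_self]
  have hI : ∀ f : ℕ → ℝ, ∑ k ∈ Finset.Icc 1 n, f k = ∑ k ∈ Finset.range n, f (k + 1) := fun f => by
    rw [Finset.range_eq_Ico, Finset.sum_Ico_add' f 0 n 1]
    rfl
  rw [residualProcess, innovationProcess, ← mul_sub, ← mul_assoc, h1, hI, hI,
    ← Finset.sum_sub_distrib, Finset.mul_sum, localIncr]
  refine Finset.sum_congr rfl fun k _ => ?_
  have h2 : maResidual (maObs α e) (α + (√(n : ℝ))⁻¹ * τ) (k + 1)
      = e ((k + 1 : ℕ) : ℤ) + residShift α e (α + (√(n : ℝ))⁻¹ * τ) k := by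
    rw [residShift]; ring
  rw [div_eq_inv_mul, h2, indicator_Iic_add]
  rfl

/-- The remainders that control the local increments, all at most `lam`. -/
structure SmallRemainders (α ρ r σ2 δ lam : ℝ) (n : ℕ) (e : ℤ → ℝ) : Prop where
  mean_sq : δ * ((n : ℝ)⁻¹ * ∑ k ∈ Finset.range n, envelope r e k ^ 2) ≤ lam
  fading : (√(n : ℝ))⁻¹ * ∑ k ∈ Finset.range n,
    ((n : ℝ)⁻¹ + (ρ / r) ^ k) * (envelope r e k ^ 3 + envelope r e (k + 1) ^ 3) ≤ lam
  boundary : (√(n : ℝ))⁻¹ * (envelope r e 0 ^ 2 + envelope r e n ^ 2) ≤ lam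
  quadratic : |∑ k ∈ Finset.range n, (n : ℝ)⁻¹ * (1 * (e ((k + 1 : ℕ) : ℤ) ^ 2 - σ2)
    + 2 * α * score α e α k * e ((k + 1 : ℕ) : ℤ))| ≤ lam
  linear : |∑ k ∈ Finset.range n, (n : ℝ)⁻¹ * (0 * (e ((k + 1 : ℕ) : ℤ) ^ 2 - σ2)
    + 1 * e ((k + 1 : ℕ) : ℤ))| ≤ lam

section
variable {α ρ r σ2 δ lam T : ℝ} {n : ℕ} {e : ℤ → ℝ}

theorem inv_natCast_le_inv_sqrt (hn : 1 ≤ n) : (n : ℝ)⁻¹ ≤ (√(n : ℝ))⁻¹ := by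
  have h1 : (1 : ℝ) ≤ n := by exact_mod_cast hn
  have hs : 1 ≤ √(n : ℝ) := Real.one_le_sqrt.2 h1
  have := Real.mul_self_sqrt (zero_le_one.trans h1)
  gcongr
  nlinarith

theorem inv_sqrt_sq (n : ℕ) : (√(n : ℝ))⁻¹ * (√(n : ℝ))⁻¹ = (n : ℝ)⁻¹ := by
  rw [← mul_inv, Real.mul_self_sqrt (Nat.cast_nonneg n)]

/-- One factor n^{-1/2} is the normalisation and another comes from θ - α, so the innovation sum
appears divided by n and a law of large numbers suffices. -/
theorem SmallRemainders.score_sub (h : SmallRemainders α ρ r σ2 δ lam n e) (hρr : ρ < r)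
    (hr1 : r ≤ 1) (hρ : 0 ≤ ρ) (hα : |α| ≤ ρ) (hn : 1 ≤ n) (hT : 0 ≤ T) {τ : ℝ} (hτ : |τ| ≤ T)
    (hθ : |α + (√(n : ℝ))⁻¹ * τ| ≤ ρ) :
    |(√(n : ℝ))⁻¹ * ∑ k ∈ Finset.range n,
        (score α e (α + (√(n : ℝ))⁻¹ * τ) k - score α e α k)|
      ≤ (12 * (1 - ρ)⁻¹ ^ 4 * T + 2 * ((1 - ρ)⁻¹ ^ 2 + (r - ρ)⁻¹ * (1 - ρ)⁻¹)) * lam := by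
  have hρ1 : ρ < 1 := hρr.trans_le hr1
  have h0 : 0 < (1 - ρ)⁻¹ := inv_pos.2 (sub_pos.2 hρ1)
  have hc : 0 < (r - ρ)⁻¹ := inv_pos.2 (sub_pos.2 hρr)
  have hn0 : (0 : ℝ) < n := by exact_mod_cast hn
  have hs0 : 0 < (√(n : ℝ))⁻¹ := inv_pos.2 (Real.sqrt_pos.2 hn0)
  have hsn := inv_sqrt_sq n
  have hns := inv_natCast_le_inv_sqrt hn
  have h1 := abs_sum_score_sub_le (e := e) hρr hr1 hρ hα hθ n
  have hlin := h.linear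
  have hbd := h.boundary
  have hH0 := one_le_envelope (e := e) (hρ.trans hρr.le) 0
  have hHn := one_le_envelope (e := e) (hρ.trans hρr.le) n
  rw [← Finset.mul_sum, abs_mul, abs_of_pos (inv_pos.2 hn0)] at hlin
  simp only [zero_mul, zero_add, one_mul] at hlin
  rw [abs_mul, abs_of_pos hs0]
  rw [add_sub_cancel_left, abs_mul, abs_of_pos hs0] at h1
  set U := |∑ k ∈ Finset.range n, e ((k + 1 : ℕ) : ℤ)|
  set s := (√(n : ℝ))⁻¹
  generalize envelope r e 0 = a at *
  generalize envelope r e n = b at *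
  have hab : a + b ≤ a ^ 2 + b ^ 2 := by nlinarith
  have hab0 : 0 ≤ a + b := by linarith
  have hab1 : (n : ℝ)⁻¹ * (a + b) ≤ lam :=
    (mul_le_mul hns hab hab0 hs0.le).trans hbd
  have hb1 : s * b ≤ lam :=
    le_trans (mul_le_mul_of_nonneg_left (by nlinarith) hs0.le) hbd
  have hU0 : 0 ≤ U := abs_nonneg _
  have hlam : 0 ≤ 2 * ((n : ℝ)⁻¹ * U) + (n : ℝ)⁻¹ * (a + b) := by positivity
  calc _ ≤ s * (4 * (1 - ρ)⁻¹ ^ 4 * (s * |τ|) * (2 * U + (a + b))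
        + 2 * ((1 - ρ)⁻¹ ^ 2 + (r - ρ)⁻¹ * (1 - ρ)⁻¹) * b) := by gcongr
    _ = 4 * (1 - ρ)⁻¹ ^ 4 * |τ| * (2 * ((n : ℝ)⁻¹ * U) + (n : ℝ)⁻¹ * (a + b))
        + 2 * ((1 - ρ)⁻¹ ^ 2 + (r - ρ)⁻¹ * (1 - ρ)⁻¹) * (s * b) := by rw [← hsn]; ring
    _ ≤ 4 * (1 - ρ)⁻¹ ^ 4 * T * (2 * lam + lam)
        + 2 * ((1 - ρ)⁻¹ ^ 2 + (r - ρ)⁻¹ * (1 - ρ)⁻¹) * lam := by gcongr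
    _ = _ := by ring

theorem SmallRemainders.score_sq (h : SmallRemainders α ρ r σ2 δ lam n e) (hρr : ρ < r)
    (hr1 : r ≤ 1) (hρ : 0 ≤ ρ) (hα : |α| ≤ ρ) (hn : 1 ≤ n) :
    |(n : ℝ)⁻¹ * ∑ k ∈ Finset.range n, score α e α k ^ 2 - σ2 / (1 - α ^ 2)|
      ≤ (1 - α ^ 2)⁻¹ * (3 + (r - ρ)⁻¹ ^ 2 + 2 * (r - ρ)⁻¹) * lam := by
  have hρ1 : ρ < 1 := hρr.trans_le hr1
  have hr0 : 0 < r := hρ.trans_lt hρr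
  have hα2 : 0 < 1 - α ^ 2 := by
    have : |α| < 1 := hα.trans_lt hρ1
    have := (sq_lt_one_iff_abs_lt_one α).2 this
    linarith
  have hc : 0 < (r - ρ)⁻¹ := inv_pos.2 (sub_pos.2 hρr)
  have hn0 : (0 : ℝ) < n := by exact_mod_cast hn
  have hs0 : 0 < (√(n : ℝ))⁻¹ := inv_pos.2 (Real.sqrt_pos.2 hn0)
  have hns := inv_natCast_le_inv_sqrt hn
  have h1 := abs_sum_score_sq_sub_le (e := e) hρr hr1 hρ hα σ2 n
  have hq := h.quadratic
  rw [← Finset.mul_sum, abs_mul, abs_of_pos (inv_pos.2 hn0)] at hq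
  simp only [one_mul] at hq
  have hf : (n : ℝ)⁻¹ * ∑ k ∈ Finset.range n,
      (ρ / r) ^ k * (envelope r e k ^ 2 + envelope r e (k + 1) ^ 2) ≤ lam := by
    refine le_trans ?_ h.fading
    refine mul_le_mul hns (Finset.sum_le_sum fun k _ => ?_)
      (Finset.sum_nonneg fun k _ => by positivity) hs0.le
    have a1 := one_le_envelope (e := e) hr0.le k
    have a2 := one_le_envelope (e := e) hr0.le (k + 1)
    gcongr
    · linarith [inv_pos.2 hn0]
    · norm_num
    · norm_num
  have hb : (n : ℝ)⁻¹ * envelope r e n ^ 2 ≤ lam := by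
    refine le_trans ?_ h.boundary
    gcongr
    have := sq_nonneg (envelope r e 0)
    linarith
  have e1 : (n : ℝ)⁻¹ * ∑ k ∈ Finset.range n, score α e α k ^ 2 - σ2 / (1 - α ^ 2)
      = (1 - α ^ 2)⁻¹ * ((n : ℝ)⁻¹ *
          ∑ k ∈ Finset.range n, ((1 - α ^ 2) * score α e α k ^ 2 - σ2)) := by
    rw [Finset.sum_sub_distrib, ← Finset.mul_sum, Finset.sum_const, Finset.card_range,
      nsmul_eq_mul]
    field_simp
  rw [e1, abs_mul, abs_mul, abs_of_pos (inv_pos.2 hα2), abs_of_pos (inv_pos.2 hn0), mul_assoc]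
  refine mul_le_mul_of_nonneg_left ?_ (inv_pos.2 hα2).le
  have h2 := mul_le_mul_of_nonneg_left h1 (inv_pos.2 hn0).le
  have h3 := mul_le_mul_of_nonneg_left hb (sq_nonneg (r - ρ)⁻¹)
  have h4 := mul_le_mul_of_nonneg_left hf (show 0 ≤ 2 + 2 * (r - ρ)⁻¹ by positivity)
  rw [mul_add, mul_add] at h2
  linarith

/-- The compensator of the local increments is small. -/
theorem SmallRemainders.compensator (h : SmallRemainders α ρ r σ2 δ lam n e) {G g : ℝ → ℝ}
    {M C : ℝ} (hG0 : ∀ x, 0 ≤ G x) (hG1 : ∀ x, G x ≤ 1) (hg : ∀ x, |g x| ≤ M)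
    (hTay : ∀ x y, |G y - G x - (y - x) * g x| ≤ C * (y - x) ^ 2) (hC : 0 ≤ C) (hρr : ρ < r)
    (hr1 : r ≤ 1) (hρ : 0 ≤ ρ) (hα : |α| ≤ ρ) (hn : 1 ≤ n) (hT : 1 ≤ T) {τ : ℝ} (hτ : |τ| ≤ T)
    (hθ : |α + (√(n : ℝ))⁻¹ * τ| ≤ ρ) (x : ℝ) {L : ℝ} (hL : L = 2 * (r - ρ)⁻¹ ^ 2 * T ^ 2) :
    |∑ k ∈ Finset.range n, (√(n : ℝ))⁻¹ * (score α e (α + (√(n : ℝ))⁻¹ * τ) k *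
        G (x - residShift α e (α + (√(n : ℝ))⁻¹ * τ) k) - score α e α k * G x)
      + τ * g x * (σ2 / (1 - α ^ 2))|
      ≤ (12 * (1 - ρ)⁻¹ ^ 4 * T + 2 * ((1 - ρ)⁻¹ ^ 2 + (r - ρ)⁻¹ * (1 - ρ)⁻¹)
        + T * M * ((1 - α ^ 2)⁻¹ * (3 + (r - ρ)⁻¹ ^ 2 + 2 * (r - ρ)⁻¹))
        + (2 * M * L ^ 2 + 2 * C * L ^ 3)) * lam := by
  have hM : 0 ≤ M := (abs_nonneg _).trans (hg 0)
  have hρ1 : ρ < 1 := hρr.trans_le hr1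
  have hr0 : 0 < r := hρ.trans_lt hρr
  have hα1 : |α| ≤ 1 := hα.trans hρ1.le
  have hn0 : (0 : ℝ) < n := by exact_mod_cast hn
  have hs0 : 0 < (√(n : ℝ))⁻¹ := inv_pos.2 (Real.sqrt_pos.2 hn0)
  have hs1 : (√(n : ℝ))⁻¹ ≤ 1 := inv_le_one_of_one_le₀ (Real.one_le_sqrt.2 (by exact_mod_cast hn))
  have hsn := inv_sqrt_sq n
  have hc1 : 1 ≤ (r - ρ)⁻¹ := (one_le_inv₀ (sub_pos.2 hρr)).2 (by linarith)
  have hS := h.score_sub hρr hr1 hρ hα hn (by linarith) hτ hθ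
  have hQ := h.score_sq hρr hr1 hρ hα hn
  have hfad := h.fading
  set s := (√(n : ℝ))⁻¹
  set c := (r - ρ)⁻¹
  set θ := α + s * τ with hθdef
  set κ := σ2 / (1 - α ^ 2)
  have hθα : θ - α = s * τ := by rw [hθdef]; ring
  have hT2 : 1 ≤ T ^ 2 := one_le_pow₀ hT
  have hTT : T ≤ T ^ 2 := by nlinarith
  have hc2 : 1 ≤ c ^ 2 := one_le_pow₀ hc1
  have hcc : c ≤ c ^ 2 := by nlinarith
  -- L is chosen to dominate c, c T, 2c² T and c² T², the constants of all the envelope bounds used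
  -- below.
  have hcL : c ≤ L := by rw [hL]; nlinarith
  have hcTL : c * T ≤ L := by
    rw [hL]
    calc c * T ≤ c ^ 2 * T ^ 2 := by gcongr
      _ ≤ _ := by nlinarith [mul_pos (zero_lt_one.trans_le hc2) (zero_lt_one.trans_le hT2)]
  have hc2TL : 2 * c ^ 2 * T ≤ L := by rw [hL]; gcongr
  have hc2T2L : c ^ 2 * T ^ 2 ≤ L := by
    rw [hL]
    nlinarith [mul_pos (zero_lt_one.trans_le hc2) (zero_lt_one.trans_le hT2)]
  have hL1 : 1 ≤ L := hc1.trans hcL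
  let H : ℕ → ℝ := fun k => envelope r e k
  let E : ℕ → ℝ := fun k => score α e θ k * G (x - residShift α e θ k) - score α e α k * G x
      + g x * (s * τ * score α e α k ^ 2) - (score α e θ k - score α e α k) * G x
  have hE : ∀ k, |E k| ≤ (2 * M * L ^ 2 + 2 * C * L ^ 3) * ((s ^ 2 + (ρ / r) ^ k) * H k ^ 3) := by
    intro k
    have hH1 : 1 ≤ H k := one_le_envelope hr0.le k
    have hH0 : 0 ≤ H k := zero_le_one.trans hH1
    have hq0 : 0 ≤ (ρ / r) ^ k := by positivity
    have hq1 : (ρ / r) ^ k ≤ 1 := pow_le_one₀ (by positivity) ((div_le_one hr0).2 hρr.le)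
    have hτs : |s * τ| ≤ s * T := by rw [abs_mul, abs_of_pos hs0]; gcongr
    have b1 : |score α e θ k| ≤ L * H k :=
      (abs_residualDeriv_le hρr hr1 hρ hα1 hθ k).2.trans (by gcongr)
    have b2 : |score α e α k| ≤ L * H k :=
      (abs_residualDeriv_le hρr hr1 hρ hα1 hα k).2.trans (by gcongr)
    have b3 : |score α e θ k - score α e α k| ≤ L * s * H k := by
      refine (abs_score_sub_le hρr hr1 hρ hα1 hθ hα k).trans ?_
      rw [hθα]
      calc _ ≤ 2 * c ^ 2 * (s * T) * H k := by gcongr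
        _ = (2 * c ^ 2 * T) * s * H k := by ring
        _ ≤ _ := by gcongr
    have b0 := abs_residShift_self_le (e := e) hρr hρ hα1 hα k
    have b4 : |residShift α e θ k| ≤ (L * s + (ρ / r) ^ k) * H k := by
      have h1 := (abs_maResidual_sub_le (e := e) hρr hr1 hρ hα1 hθ hα k).2
      rw [hθα] at h1
      have h2 : |residShift α e θ k - residShift α e α k| ≤ L * s * H k := by
        refine h1.trans ?_
        calc _ ≤ c * (s * T) * H k := by gcongr
          _ = (c * T) * s * H k := by ring
          _ ≤ _ := by gcongr
      have h3 := abs_add_le (residShift α e θ k - residShift α e α k) (residShift α e α k)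
      rw [sub_add_cancel] at h3
      linarith
    have b5 : |residShift α e θ k - s * τ * score α e α k|
        ≤ ((ρ / r) ^ k + L * s ^ 2) * H k := by
      have h1 := abs_residShift_taylor (e := e) hρr hr1 hρ hα1 hα hθ k
      rw [hθα] at h1
      have h2 : |residShift α e θ k - residShift α e α k - s * τ * score α e α k|
          ≤ L * s ^ 2 * H k := by
        refine h1.trans ?_
        rw [← sq_abs (s * τ)]
        calc _ ≤ c ^ 2 * (s * T) ^ 2 * H k := by gcongr
          _ = (c ^ 2 * T ^ 2) * s ^ 2 * H k := by ring
          _ ≤ _ := by gcongr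
      have h3 := abs_add_le (residShift α e θ k - residShift α e α k - s * τ * score α e α k)
        (residShift α e α k)
      rw [show residShift α e θ k - residShift α e α k - s * τ * score α e α k
        + residShift α e α k = residShift α e θ k - s * τ * score α e α k by ring] at h3
      linarith
    exact compensator_term_le hg hTay hC (zero_le_one.trans hL1) hs0.le hs1 hq0 hq1 hH1 hL1
      b1 b2 b3 b4 b5 x
  have hEs : |s * ∑ k ∈ Finset.range n, E k| ≤ (2 * M * L ^ 2 + 2 * C * L ^ 3) * lam := by
    rw [abs_mul, abs_of_pos hs0]
    have hL0 : 0 ≤ L := zero_le_one.trans hL1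
    calc s * |∑ k ∈ Finset.range n, E k|
        ≤ s * ∑ k ∈ Finset.range n, (2 * M * L ^ 2 + 2 * C * L ^ 3)
            * ((s ^ 2 + (ρ / r) ^ k) * H k ^ 3) := by
          gcongr
          exact (Finset.abs_sum_le_sum_abs _ _).trans (Finset.sum_le_sum fun k _ => hE k)
      _ = (2 * M * L ^ 2 + 2 * C * L ^ 3) * (s * ∑ k ∈ Finset.range n,
            (s ^ 2 + (ρ / r) ^ k) * H k ^ 3) := by rw [← Finset.mul_sum]; ring
      _ ≤ (2 * M * L ^ 2 + 2 * C * L ^ 3) * lam := by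
          gcongr
          refine le_trans ?_ hfad
          rw [← hsn]
          refine mul_le_mul_of_nonneg_left (Finset.sum_le_sum fun k _ => ?_) hs0.le
          have a2 := zero_le_one.trans (one_le_envelope (e := e) hr0.le (k + 1))
          rw [sq]
          gcongr
          exact le_add_of_nonneg_right (by positivity)
  -- Three sources of error: the sum of score differences, the deviation of the mean square score
  -- from its limit, and the second-order terms E.
  have key : ∑ k ∈ Finset.range n, s * (score α e θ k * G (x - residShift α e θ k)
        - score α e α k * G x) + τ * g x * κ
      = G x * (s * ∑ k ∈ Finset.range n, (score α e θ k - score α e α k))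
        - τ * g x * ((n : ℝ)⁻¹ * ∑ k ∈ Finset.range n, score α e α k ^ 2 - κ)
        + s * ∑ k ∈ Finset.range n, E k := by
    have : ∑ k ∈ Finset.range n, s * (score α e θ k * G (x - residShift α e θ k)
        - score α e α k * G x) = ∑ k ∈ Finset.range n,
          (G x * (s * (score α e θ k - score α e α k)) - τ * g x * ((s * s) * score α e α k ^ 2)
            + s * E k) := by
      refine Finset.sum_congr rfl fun k _ => ?_
      simp only [E]; ring
    rw [this, Finset.sum_add_distrib, Finset.sum_sub_distrib, ← Finset.mul_sum, ← Finset.mul_sum,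
      ← Finset.mul_sum, ← Finset.mul_sum, ← Finset.mul_sum, hsn]
    ring
  rw [key]
  have a1 : |G x * (s * ∑ k ∈ Finset.range n, (score α e θ k - score α e α k))|
      ≤ (12 * (1 - ρ)⁻¹ ^ 4 * T + 2 * ((1 - ρ)⁻¹ ^ 2 + c * (1 - ρ)⁻¹)) * lam := by
    rw [abs_mul, abs_of_nonneg (hG0 x)]
    exact (mul_le_of_le_one_left (abs_nonneg _) (hG1 x)).trans hS
  have a2 : |τ * g x * ((n : ℝ)⁻¹ * ∑ k ∈ Finset.range n, score α e α k ^ 2 - κ)| ≤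
      T * M * ((1 - α ^ 2)⁻¹ * (3 + c ^ 2 + 2 * c) * lam) := by
    rw [abs_mul, abs_mul]
    have := hg x
    gcongr
  refine (abs_add_le _ _).trans ((add_le_add ((abs_sub _ _).trans (add_le_add a1 a2)) hEs).trans ?_)
  apply le_of_eq; ring

end

/-! ### From grid control to a uniform bound -/

/-- The centred increment at the grid point `(δ i, n^{-1/2} δ j)`, for the weights
`b ∂ε_k(θ)/∂θ + A H_k` and the shifts moved by `σ` times the mesh. -/
noncomputable def gridIncr (α r A : ℝ) (G : ℝ → ℝ) (e : ℤ → ℝ) (n : ℕ) (δ b σ : ℝ) (i j : ℤ) : ℝ :=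
  empIncr G (fun k => b * score α e (α + (√(n : ℝ))⁻¹ * (δ * i)) k + A * envelope r e k)
    (fun k => residShift α e (α + (√(n : ℝ))⁻¹ * (δ * i)) k
      + σ * ((√(n : ℝ))⁻¹ * δ * (1 + 2 * A * envelope r e k)))
    (fun k => b * score α e (α + (√(n : ℝ))⁻¹ * 0) k + A * envelope r e k)
    (fun k => e ((k + 1 : ℕ) : ℤ)) n ((√(n : ℝ))⁻¹ * δ * j)

section
variable {α ρ r σ2 δ lam T Θ M C A L : ℝ} {n I J : ℕ} {e : ℤ → ℝ} {G g : ℝ → ℝ}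

/-- Since A H_k dominates the score, the weights b w_k + A H_k lie between 0 and 2A H_k, as
bracketing requires. This is why B = 2A. Only b = 0 and b = 1 are needed later. -/
theorem abs_sum_weighted_centredInd_le (h : SmallRemainders α ρ r σ2 δ lam n e)
    (hG0 : ∀ x, 0 ≤ G x) (hG1 : ∀ x, G x ≤ 1) (hLip : ∀ x y, |G y - G x| ≤ M * |y - x|)
    (hM : 0 ≤ M) (hρr : ρ < r) (hr1 : r ≤ 1) (hρ : 0 ≤ ρ) (hα : |α| ≤ ρ) (hn : 1 ≤ n)
    (hδ : 0 < δ) (hΘ : 0 ≤ Θ) (hT : Θ + δ ≤ T) (hI : Θ / δ + 1 ≤ I)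
    (hθ : ∀ τ, |τ| ≤ T → |α + (√(n : ℝ))⁻¹ * τ| ≤ ρ) (hA : A = 2 * (r - ρ)⁻¹ ^ 2)
    {b : ℝ} (hb0 : 0 ≤ b) (hb1 : b ≤ 1)
    (hgrid : ∀ σ ∈ ({-1, 1} : Finset ℝ), ∀ i ∈ Finset.Icc (-I : ℤ) I,
      ∀ j ∈ Finset.Icc (-J : ℤ) J, |gridIncr α r A G e n δ b σ i j| ≤ lam)
    {τ x : ℝ} (hτ : |τ| ≤ Θ) (hx : |x| ≤ (√(n : ℝ))⁻¹ * δ * (J - 1)) :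
    |∑ k ∈ Finset.range n, (√(n : ℝ))⁻¹ *
      ((b * score α e (α + (√(n : ℝ))⁻¹ * τ) k + A * envelope r e k)
          * centredInd G (x - residShift α e (α + (√(n : ℝ))⁻¹ * τ) k) (e ((k + 1 : ℕ) : ℤ))
        - (b * score α e α k + A * envelope r e k) * centredInd G x (e ((k + 1 : ℕ) : ℤ)))|
      ≤ (1 + (2 * A * M * (2 + 2 * (2 * A)) + 2 * A)) * lam := by
  have hα1 : |α| ≤ 1 := hα.trans (hρr.le.trans hr1)
  have hr0 : 0 < r := hρ.trans_lt hρr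
  have hc1 : 1 ≤ (r - ρ)⁻¹ := (one_le_inv₀ (sub_pos.2 hρr)).2 (by linarith)
  have hs0 : 0 ≤ (√(n : ℝ))⁻¹ := by positivity
  set s := (√(n : ℝ))⁻¹ with hs
  set c := (r - ρ)⁻¹
  have hcA : c ≤ A := by rw [hA]; nlinarith
  have hA0 : 0 ≤ A := by linarith
  have hH : ∀ k, 1 ≤ envelope r e k := one_le_envelope hr0.le
  have hsc : ∀ τ k, |τ| ≤ T → |b * score α e (α + s * τ) k| ≤ A * envelope r e k := by
    intro τ k hτ
    have := hH k
    rw [abs_mul, abs_of_nonneg hb0]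
    calc _ ≤ 1 * (c * envelope r e k) := by
          gcongr
          exact (abs_residualDeriv_le hρr hr1 hρ hα1 (hθ τ hτ) k).2
      _ ≤ _ := by rw [one_mul]; gcongr
  have hdiff : ∀ τ τ' : ℝ, |α + s * τ - (α + s * τ')| = s * |τ - τ'| := fun τ τ' => by
    rw [add_sub_add_left_eq_sub, ← mul_sub, abs_mul, abs_of_nonneg hs0]
  have main := abs_sum_centredInd_sub_le (G := G) (M := M) (B := 2 * A) (T := T) (Θ := Θ) (δ := δ)
    (lam := lam) (n := n) (I := I) (J := J) hG0 hG1 hLip hM (by positivity)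
    (H := fun k => envelope r e k) (b := fun k => e ((k + 1 : ℕ) : ℤ)) hH
    (W := fun τ k => b * score α e (α + s * τ) k + A * envelope r e k)
    (ξ := fun τ k => residShift α e (α + s * τ) k) hn hδ hΘ hT hI
    (fun τ k hτ => by have := (abs_le.1 (hsc τ k hτ)).1; linarith)
    (fun τ k hτ => by have := (abs_le.1 (hsc τ k hτ)).2; linarith)
    (fun τ τ' k hτ hτ' => by
      have h1 := abs_score_sub_le (e := e) hρr hr1 hρ hα1 (hθ τ hτ) (hθ τ' hτ') k
      rw [hdiff] at h1
      have hk := hH k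
      rw [add_sub_add_right_eq_sub, ← mul_sub, abs_mul, abs_of_nonneg hb0]
      calc b * |score α e (α + s * τ) k - score α e (α + s * τ') k|
          ≤ 1 * (2 * c ^ 2 * (s * |τ - τ'|) * envelope r e k) := by gcongr
        _ = A * (s * |τ - τ'|) * envelope r e k := by rw [hA]; ring
        _ ≤ _ := by rw [← hs]; gcongr; linarith)
    (fun τ τ' k hτ hτ' => by
      have h1 := (abs_maResidual_sub_le (e := e) hρr hr1 hρ hα1 (hθ τ hτ) (hθ τ' hτ') k).2
      rw [hdiff] at h1
      have hk := hH k
      refine h1.trans ?_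
      rw [← hs]
      gcongr; linarith)
    (fun i hi j hj => by
      have h1 := hgrid (-1) (by simp) i hi j hj
      have h2 := hgrid 1 (by simp) i hi j hj
      simp only [gridIncr, neg_one_mul, ← sub_eq_add_neg] at h1
      simp only [gridIncr, one_mul] at h2
      exact ⟨h1, h2⟩) hτ hx
  simp only [mul_zero, add_zero] at main
  have hK : 0 ≤ 2 * A * M * (2 + 2 * (2 * A)) + 2 * A := by positivity
  have := mul_le_mul_of_nonneg_left h.mean_sq hK
  refine main.trans ?_
  linarith

/-- On the event that the remainders and the grid increments are small, the local increments are
uniformly close to their linear drift. -/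
theorem abs_localIncr_add_le (h : SmallRemainders α ρ r σ2 δ lam n e)
    (hG0 : ∀ x, 0 ≤ G x) (hG1 : ∀ x, G x ≤ 1) (hLip : ∀ x y, |G y - G x| ≤ M * |y - x|)
    (hg0 : ∀ x, 0 ≤ g x) (hg : ∀ x, g x ≤ M)
    (hTay : ∀ x y, |G y - G x - (y - x) * g x| ≤ C * (y - x) ^ 2) (hC : 0 ≤ C)
    (hρr : ρ < r) (hr1 : r ≤ 1) (hρ : 0 ≤ ρ) (hα : |α| ≤ ρ) (hn : 1 ≤ n)
    (hδ : 0 < δ) (hΘ : 0 ≤ Θ) (hT : Θ + δ ≤ T) (hT1 : 1 ≤ T) (hI : Θ / δ + 1 ≤ I)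
    (hθ : ∀ τ, |τ| ≤ T → |α + (√(n : ℝ))⁻¹ * τ| ≤ ρ) (hA : A = 2 * (r - ρ)⁻¹ ^ 2)
    (hL : L = 2 * (r - ρ)⁻¹ ^ 2 * T ^ 2)
    (hgrid : ∀ b ∈ ({0, 1} : Finset ℝ), ∀ σ ∈ ({-1, 1} : Finset ℝ), ∀ i ∈ Finset.Icc (-I : ℤ) I,
      ∀ j ∈ Finset.Icc (-J : ℤ) J, |gridIncr α r A G e n δ b σ i j| ≤ lam)
    (hmax : ∀ k ≤ n, envelope r e k < (√(n : ℝ))⁻¹ * δ * (J - 1))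
    (hgx : ∀ x, (√(n : ℝ))⁻¹ * δ * (J - 1) ≤ |x| → g x ≤ lam)
    {τ : ℝ} (hτ : |τ| ≤ Θ) (x : ℝ) :
    |localIncr α e n x τ + τ * g x * (σ2 / (1 - α ^ 2))|
      ≤ (2 * (1 + (2 * A * M * (2 + 2 * (2 * A)) + 2 * A))
        + (12 * (1 - ρ)⁻¹ ^ 4 * T + 2 * ((1 - ρ)⁻¹ ^ 2 + (r - ρ)⁻¹ * (1 - ρ)⁻¹)
        + T * M * ((1 - α ^ 2)⁻¹ * (3 + (r - ρ)⁻¹ ^ 2 + 2 * (r - ρ)⁻¹))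
        + (2 * M * L ^ 2 + 2 * C * L ^ 3)) + T * |σ2 / (1 - α ^ 2)|) * lam := by
  have hM : 0 ≤ M := (hg0 0).trans (hg 0)
  have hρ1 : ρ < 1 := hρr.trans_le hr1
  have hα1 : |α| ≤ 1 := hα.trans hρ1.le
  have hα2 : 0 < (1 - α ^ 2)⁻¹ := by
    have := (sq_lt_one_iff_abs_lt_one α).2 (hα.trans_lt hρ1)
    exact inv_pos.2 (by linarith)
  have hr0 : 0 < r := hρ.trans_lt hρr
  have hc : 0 < (r - ρ)⁻¹ := inv_pos.2 (sub_pos.2 hρr)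
  have hκ0 : 0 < (1 - ρ)⁻¹ := inv_pos.2 (sub_pos.2 hρ1)
  have hA0 : 0 ≤ A := by rw [hA]; positivity
  have hL0 : 0 ≤ L := by rw [hL]; positivity
  have hlam : 0 ≤ lam := le_trans (by positivity) h.mean_sq
  have hτT : |τ| ≤ T := by linarith
  have hT0 : 0 ≤ T := by linarith
  have hS := h.score_sub hρr hr1 hρ hα hn hT0 hτT (hθ τ hτT)
  have hcomp := h.compensator hG0 hG1 (fun x => (abs_of_nonneg (hg0 x)).trans_le (hg x)) hTay hC
    hρr hr1 hρ hα hn hT1 hτT (hθ τ hτT) x hL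
  have hbr : ∀ {b : ℝ}, b ∈ ({0, 1} : Finset ℝ) → 0 ≤ b → b ≤ 1 → _ := fun {b} hb hb0 hb1 =>
    abs_sum_weighted_centredInd_le h hG0 hG1 hLip hM hρr hr1 hρ hα hn hδ hΘ hT hI hθ hA hb0 hb1
      (hgrid b hb) hτ (x := x)
  have hres : ∀ k < n, |e ((k + 1 : ℕ) : ℤ) + residShift α e (α + (√(n : ℝ))⁻¹ * τ) k|
      < (√(n : ℝ))⁻¹ * δ * (J - 1) := fun k hk => by
    rw [residShift, add_sub_cancel]
    exact (abs_maResidual_le hρr.le hρ hα1 (hθ τ hτT) (k + 1)).trans_lt (hmax _ hk)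
  have hinn : ∀ k < n, |e ((k + 1 : ℕ) : ℤ)| < (√(n : ℝ))⁻¹ * δ * (J - 1) := fun k hk =>
    (abs_le_envelope hr0.le (k + 1)).trans_lt (hmax _ hk)
  set s := (√(n : ℝ))⁻¹
  set θ := α + s * τ
  set κ := σ2 / (1 - α ^ 2)
  set Kb := 1 + (2 * A * M * (2 + 2 * (2 * A)) + 2 * A) with hKb
  set Ks := 12 * (1 - ρ)⁻¹ ^ 4 * T + 2 * ((1 - ρ)⁻¹ ^ 2 + (r - ρ)⁻¹ * (1 - ρ)⁻¹) with hKs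
  have hKb0 : 0 ≤ Kb := by positivity
  have hKs0 : 0 ≤ Ks := by positivity
  have hrest0 : 0 ≤ T * M * ((1 - α ^ 2)⁻¹ * (3 + (r - ρ)⁻¹ ^ 2 + 2 * (r - ρ)⁻¹))
      + (2 * M * L ^ 2 + 2 * C * L ^ 3) := by positivity
  set Kr := T * M * ((1 - α ^ 2)⁻¹ * (3 + (r - ρ)⁻¹ ^ 2 + 2 * (r - ρ)⁻¹)) with hKr
  set Kt := 2 * M * L ^ 2 + 2 * C * L ^ 3 with hKt
  have hKl := mul_nonneg hKb0 hlam
  have hSl := mul_nonneg hKs0 hlam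
  have hRl := mul_nonneg hrest0 hlam
  have hTl := mul_nonneg (mul_nonneg hT0 (abs_nonneg κ)) hlam
  have hdrift : s * δ * (J - 1) ≤ |x| → |τ * g x * κ| ≤ T * |κ| * lam := fun hx => by
    have := hgx x hx
    have hgx0 := hg0 x
    rw [abs_mul, abs_mul, abs_of_nonneg (hg0 x)]
    calc |τ| * g x * |κ| ≤ T * lam * |κ| := by gcongr
      _ = _ := by ring
  -- Inside the grid range the bracketing applies; outside, every residual and innovation lies on
  -- one known side of x.
  rcases le_or_gt |x| (s * δ * (J - 1)) with hx | hx
  · have h1 := hbr (b := 1) (by simp) zero_le_one le_rfl hx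
    have h0 := hbr (b := 0) (by simp) le_rfl zero_le_one hx
    -- Subtracting the case b = 0 from b = 1 cancels the auxiliary weights A H_k; the centring terms
    -- form the compensator.
    have key : localIncr α e n x τ + τ * g x * κ
        = ∑ k ∈ Finset.range n, s * ((1 * score α e θ k + A * envelope r e k)
          * centredInd G (x - residShift α e θ k) (e ((k + 1 : ℕ) : ℤ))
        - (1 * score α e α k + A * envelope r e k) * centredInd G x (e ((k + 1 : ℕ) : ℤ)))
        - ∑ k ∈ Finset.range n, s * ((0 * score α e θ k + A * envelope r e k)
          * centredInd G (x - residShift α e θ k) (e ((k + 1 : ℕ) : ℤ))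
        - (0 * score α e α k + A * envelope r e k) * centredInd G x (e ((k + 1 : ℕ) : ℤ)))
        + (∑ k ∈ Finset.range n, s * (score α e θ k * G (x - residShift α e θ k)
            - score α e α k * G x) + τ * g x * κ) := by
      rw [← add_assoc, ← Finset.sum_sub_distrib, ← Finset.sum_add_distrib, localIncr]
      congr 1
      refine Finset.sum_congr rfl fun k _ => ?_
      simp only [centredInd]
      ring
    rw [key]
    refine (abs_add_le _ _).trans ((add_le_add ((abs_sub _ _).trans (add_le_add h1 h0))
      hcomp).trans ?_)
    linarith
  · have hd := hdrift hx.le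
    rcases lt_abs.1 hx with hx' | hx'
    -- To the right all indicators equal 1, leaving the sum of score differences.
    · have hloc : localIncr α e n x τ
          = s * ∑ k ∈ Finset.range n, (score α e θ k - score α e α k) := by
        rw [localIncr, Finset.mul_sum]
        refine Finset.sum_congr rfl fun k hk => ?_
        have hk' := Finset.mem_range.1 hk
        have a1 := (abs_lt.1 (hres k hk')).2
        have a2 := (abs_lt.1 (hinn k hk')).2
        rw [Set.indicator_of_mem (show e ((k + 1 : ℕ) : ℤ) ∈ Set.Iic (x - residShift α e θ k) from
            Set.mem_Iic.2 (by linarith)),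
          Set.indicator_of_mem (show e ((k + 1 : ℕ) : ℤ) ∈ Set.Iic x from
            Set.mem_Iic.2 (by linarith)), mul_one, mul_one]
      rw [hloc]
      refine (abs_add_le _ _).trans ((add_le_add hS hd).trans ?_)
      linarith
    -- To the left all indicators vanish.
    · have hloc : localIncr α e n x τ = 0 := by
        rw [localIncr]
        refine Finset.sum_eq_zero fun k hk => ?_
        have hk' := Finset.mem_range.1 hk
        have a1 := (abs_lt.1 (hres k hk')).1
        have a2 := (abs_lt.1 (hinn k hk')).1
        rw [Set.indicator_of_notMem (show e ((k + 1 : ℕ) : ℤ) ∉ Set.Iic (x - residShift α e θ k)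
            from fun hm => by have := Set.mem_Iic.1 hm; linarith),
          Set.indicator_of_notMem (show e ((k + 1 : ℕ) : ℤ) ∉ Set.Iic x
            from fun hm => by have := Set.mem_Iic.1 hm; linarith)]
        ring
      rw [hloc, zero_add]
      refine hd.trans ?_
      linarith

end

/-! ### Markov bounds and probabilities of the exceptional events -/

section markov
variable {Ω : Type*} [MeasurableSpace Ω] {P : Measure Ω} [IsProbabilityMeasure P]

theorem measure_ge_le_ofReal_div {f : Ω → ℝ} {c t : ℝ} (hf0 : ∀ ω, 0 ≤ f ω)
    (hf : Integrable f P) (hc : ∫ ω, f ω ∂P ≤ c) (ht : 0 < t) :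
    P {ω | t ≤ f ω} ≤ ENNReal.ofReal (c / t) := by
  have h := mul_meas_ge_le_integral_of_nonneg (ae_of_all P hf0) hf t
  rw [← ofReal_measureReal (measure_ne_top P _)]
  refine ENNReal.ofReal_le_ofReal ?_
  rw [le_div_iff₀ ht]
  linarith

theorem measure_lt_abs_le_ofReal_div {f : Ω → ℝ} {c t : ℝ}
    (hf : Integrable (fun ω => f ω ^ 4) P) (hc : ∫ ω, f ω ^ 4 ∂P ≤ c) (ht : 0 < t) :
    P {ω | t < |f ω|} ≤ ENNReal.ofReal (c / t ^ 4) := by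
  refine (measure_mono fun ω hω => ?_).trans
    (measure_ge_le_ofReal_div (fun ω => by positivity) hf hc (pow_pos ht 4))
  have h : t < |f ω| := hω
  have := pow_le_pow_left₀ ht.le h.le 4
  rwa [Even.pow_abs (by decide)] at this

end markov

namespace IsInnovation
variable {Ω : Type*} [MeasurableSpace Ω] {P : Measure Ω} {ε : ℤ → Ω → ℝ} {μ : Measure ℝ}
  [IsProbabilityMeasure P]

/-- The number of grid points used on each side of the origin. -/
noncomputable def gridSize (n : ℕ) : ℕ := ⌈(n : ℝ) ^ (3 / 4 : ℝ)⌉₊ + 1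

theorem rpow_le_gridSize (n : ℕ) : (n : ℝ) ^ (3 / 4 : ℝ) ≤ (gridSize n : ℝ) - 1 := by
  rw [gridSize]; push_cast
  linarith [Nat.le_ceil ((n : ℝ) ^ (3 / 4 : ℝ))]

/-- With exponent 3/4 the number of points is o(n), beaten by the O(1/n) bound at each point, while
the range n^{-1/2} n^{3/4} = n^{1/4} still diverges. -/
theorem tendsto_gridSize_div : Tendsto (fun n : ℕ => (gridSize n : ℝ) / n) atTop (𝓝 0) := by
  have h1 : Tendsto (fun n : ℕ => (n : ℝ) ^ (-(1 / 4) : ℝ) + 2 / (n : ℝ)) atTop (𝓝 (0 + 0)) :=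
    ((tendsto_rpow_neg_atTop (by norm_num)).comp tendsto_natCast_atTop_atTop).add
      (tendsto_const_div_atTop_nhds_zero_nat 2)
  rw [add_zero] at h1
  refine squeeze_zero' (Eventually.of_forall fun n => by positivity) ?_ h1
  filter_upwards [eventually_ge_atTop 1] with n hn
  have hn0 : (0 : ℝ) < n := by exact_mod_cast hn
  have h2 : (gridSize n : ℝ) ≤ (n : ℝ) ^ (3 / 4 : ℝ) + 2 := by
    rw [gridSize]; push_cast
    linarith [(Nat.ceil_lt_add_one (show 0 ≤ (n : ℝ) ^ (3 / 4 : ℝ) by positivity)).le]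
  have h3 : (n : ℝ) ^ (3 / 4 : ℝ) / n = (n : ℝ) ^ (-(1 / 4) : ℝ) := by
    rw [← Real.rpow_sub_one hn0.ne']; norm_num
  calc (gridSize n : ℝ) / n ≤ ((n : ℝ) ^ (3 / 4 : ℝ) + 2) / n := by gcongr
    _ = _ := by rw [add_div, h3]

theorem rpow_le_inv_sqrt_mul_gridSize {n : ℕ} (hn : 1 ≤ n) {δ : ℝ} (hδ : 0 < δ) :
    δ * (n : ℝ) ^ (1 / 4 : ℝ) ≤ (√(n : ℝ))⁻¹ * δ * ((gridSize n : ℝ) - 1) := by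
  have hn0 : (0 : ℝ) < n := by exact_mod_cast hn
  have h : (n : ℝ) ^ (1 / 4 : ℝ) = (√(n : ℝ))⁻¹ * (n : ℝ) ^ (3 / 4 : ℝ) := by
    rw [Real.sqrt_eq_rpow, ← Real.rpow_neg hn0.le, ← Real.rpow_add hn0]; norm_num
  rw [h]
  calc _ = (√(n : ℝ))⁻¹ * δ * (n : ℝ) ^ (3 / 4 : ℝ) := by ring
    _ ≤ _ := by gcongr; exact rpow_le_gridSize n

variable {α ρ r A δ lam T M : ℝ}

/-- The probability that some grid increment is large tends to zero. -/
theorem tendsto_measure_gridIncr (hε : IsInnovation P ε μ) (hρr : ρ < r) (hr1 : r < 1)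
    (hρ : 0 ≤ ρ) (hα : |α| ≤ ρ) (hA : A = 2 * (r - ρ)⁻¹ ^ 2) (hM : 0 ≤ M)
    (hLip : ∀ x y, |cdf μ y - cdf μ x| ≤ M * |y - x|) (hδ : 0 < δ) (hδ1 : δ ≤ 1) (hlam : 0 < lam)
    {I : ℕ} (hT0 : 0 ≤ T) (hI : δ * I ≤ T)
    (hθ : ∀ᶠ n : ℕ in atTop, ∀ τ, |τ| ≤ T → |α + (√(n : ℝ))⁻¹ * τ| ≤ ρ) :
    Tendsto (fun n : ℕ => P {ω | ¬ ∀ b ∈ ({0, 1} : Finset ℝ), ∀ σ ∈ ({-1, 1} : Finset ℝ),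
      ∀ i ∈ Finset.Icc (-I : ℤ) I, ∀ j ∈ Finset.Icc (-(gridSize n) : ℤ) (gridSize n),
        |gridIncr α r A (cdf μ) (fun i => ε i ω) n δ b σ i j| ≤ lam}) atTop (𝓝 0) := by
  have hα1 : |α| ≤ 1 := hα.trans (hρr.le.trans hr1.le)
  have hr0 : 0 < r := hρ.trans_lt hρr
  have hc1 : 1 ≤ (r - ρ)⁻¹ := (one_le_inv₀ (sub_pos.2 hρr)).2 (by linarith)
  have hq0 : 0 ≤ ρ / r := by positivity
  have hq1 : ρ / r < 1 := (div_lt_one hr0).2 hρr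
  set c := (r - ρ)⁻¹
  have hcA : c ≤ A := by rw [hA]; nlinarith
  have hA0 : 0 ≤ A := by linarith
  -- Covers the weights (2A), their change (A T) and the shift, which needs A T + 1 + 2A on n^{-1/2}
  -- and 1 on the fading term.
  set B : ℝ := 2 * A + A * T + 3 with hB
  have hAT : 0 ≤ A * T := mul_nonneg hA0 hT0
  obtain ⟨C, hC⟩ := hε.exists_integral_empIncr_pow_four_le (B := B) hr0.le hr1 hq0 hq1
    (by positivity) hM hLip
  have hlim : Tendsto (fun n : ℕ => ENNReal.ofReal
      ((2 * (2 * ((2 * I + 1) * (2 * gridSize n + 1)))) * (C / n / lam ^ 4))) atTop (𝓝 0) := by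
    rw [← ENNReal.ofReal_zero]
    refine ENNReal.tendsto_ofReal ?_
    have h1 : Tendsto (fun n : ℕ => (4 * (2 * I + 1) * C / lam ^ 4) *
        (2 * ((gridSize n : ℝ) / n) + 1 / (n : ℝ))) atTop
        (𝓝 ((4 * (2 * I + 1) * C / lam ^ 4) * (2 * 0 + 0))) :=
      ((tendsto_gridSize_div.const_mul 2).add
        (tendsto_const_div_atTop_nhds_zero_nat 1)).const_mul _
    simp only [mul_zero, add_zero] at h1
    refine h1.congr fun n => ?_
    ring
  refine tendsto_of_tendsto_of_tendsto_of_le_of_le' tendsto_const_nhds hlim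
    (Eventually.of_forall fun _ => zero_le) ?_
  filter_upwards [hθ, eventually_ge_atTop 1] with n hθ hn
  set s := (√(n : ℝ))⁻¹ with hs
  have hs0 : 0 ≤ s := by positivity
  have hpt : ∀ b ∈ ({0, 1} : Finset ℝ), ∀ σ ∈ ({-1, 1} : Finset ℝ),
      ∀ i ∈ Finset.Icc (-I : ℤ) I, ∀ j : ℤ,
      P {ω | lam < |gridIncr α r A (cdf μ) (fun i => ε i ω) n δ b σ i j|}
        ≤ ENNReal.ofReal (C / n / lam ^ 4) := by
    intro b hb σ hσ i hi j
    have hb01 : |b| ≤ 1 := by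
      simp only [Finset.mem_insert, Finset.mem_singleton] at hb
      rcases hb with rfl | rfl <;> simp
    have hσ1 : |σ| ≤ 1 := by
      simp only [Finset.mem_insert, Finset.mem_singleton] at hσ
      rcases hσ with rfl | rfl <;> simp
    have hiT : |δ * (i : ℝ)| ≤ T := by
      rw [Finset.mem_Icc] at hi
      have h1 : |(i : ℝ)| ≤ I := by
        rw [abs_le]
        exact ⟨by exact_mod_cast hi.1, by exact_mod_cast hi.2⟩
      rw [abs_mul, abs_of_pos hδ]
      exact (mul_le_mul_of_nonneg_left h1 hδ.le).trans hI
    have hH : ∀ k ω, 1 ≤ envelope r (fun i => ε i ω) k := fun k ω => one_le_envelope hr0.le k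
    have h0T : |(0 : ℝ)| ≤ T := by simpa using hT0
    have hW : ∀ τ, |τ| ≤ T → ∀ k ω, |b * score α (fun i => ε i ω) (α + s * τ) k
        + A * envelope r (fun i => ε i ω) k| ≤ B * envelope r (fun i => ε i ω) k := by
      intro τ hτ k ω
      have hk := hH k ω
      have h1 := (abs_residualDeriv_le (e := fun i => ε i ω) hρr hr1.le hρ hα1 (hθ τ hτ) k).2
      have h2 : |b * score α (fun i => ε i ω) (α + s * τ) k|
          ≤ A * envelope r (fun i => ε i ω) k := by
        rw [abs_mul]
        calc _ ≤ 1 * (c * envelope r (fun i => ε i ω) k) := by gcongr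
          _ ≤ _ := by rw [one_mul]; gcongr
      have h3 := abs_add_le (b * score α (fun i => ε i ω) (α + s * τ) k)
        (A * envelope r (fun i => ε i ω) k)
      rw [abs_of_nonneg (show 0 ≤ A * envelope r (fun i => ε i ω) k by positivity)] at h3
      have h4 : 0 ≤ A * T * envelope r (fun i => ε i ω) k := by positivity
      rw [hB]; linarith
    have hWm : ∀ τ k, Measurable[hε.past k] fun ω => b * score α (fun i => ε i ω) (α + s * τ) k
        + A * envelope r (fun i => ε i ω) k := fun τ k =>
      ((hε.measurable_score α _ k).const_mul b).add ((hε.measurable_envelope r k).const_mul A)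
    have hη : ∀ k, Measurable[hε.past k] fun ω => residShift α (fun i => ε i ω) (α + s * (δ * i)) k
        + σ * (s * δ * (1 + 2 * A * envelope r (fun i => ε i ω) k)) := fun k =>
      (hε.measurable_residShift α _ k).add (((((hε.measurable_envelope r k).const_mul
        (2 * A)).const_add 1).const_mul (s * δ)).const_mul σ)
    have hdiff : ∀ τ τ' : ℝ, |α + s * τ - (α + s * τ')| = s * |τ - τ'| := fun τ τ' => by
      rw [add_sub_add_left_eq_sub, ← mul_sub, abs_mul, abs_of_nonneg hs0]
    have := hC n (fun k ω => b * score α (fun i => ε i ω) (α + s * (δ * i)) k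
        + A * envelope r (fun i => ε i ω) k)
      (fun k ω => residShift α (fun i => ε i ω) (α + s * (δ * i)) k
        + σ * (s * δ * (1 + 2 * A * envelope r (fun i => ε i ω) k)))
      (fun k ω => b * score α (fun i => ε i ω) (α + s * 0) k
        + A * envelope r (fun i => ε i ω) k) (s * δ * j) hn
      (hWm _) hη (hWm _) (hW _ hiT) (hW 0 h0T) (fun k ω => ?_) (fun k ω => ?_)
    · exact measure_lt_abs_le_ofReal_div this.1 this.2 hlam
    · have hk := hH k ω
      have h1 := abs_score_sub_le (e := fun i => ε i ω) hρr hr1.le hρ hα1 (hθ _ hiT) (hθ 0 h0T) k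
      rw [hdiff, sub_zero] at h1
      rw [add_sub_add_right_eq_sub, ← mul_sub, abs_mul, ← hs]
      calc _ ≤ 1 * (2 * c ^ 2 * (s * T) * envelope r (fun i => ε i ω) k) := by
            refine mul_le_mul hb01 (h1.trans ?_) (abs_nonneg _) zero_le_one
            gcongr
        _ = (A * T) * s * envelope r (fun i => ε i ω) k := by rw [hA]; ring
        _ ≤ _ := by gcongr; rw [hB]; linarith
    · have hk := hH k ω
      have hqk : 0 ≤ (ρ / r) ^ k := by positivity
      have h1 := (abs_maResidual_sub_le (e := fun i => ε i ω) hρr hr1.le hρ hα1 (hθ _ hiT) hα k).2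
      have h2 := abs_residShift_self_le (e := fun i => ε i ω) hρr hρ hα1 hα k
      rw [add_sub_cancel_left, abs_mul, abs_of_nonneg hs0] at h1
      rw [← hs]
      set H := envelope r (fun i => ε i ω) k
      have h3 : |residShift α (fun i => ε i ω) (α + s * (δ * i)) k| ≤ (A * T * s + (ρ / r) ^ k) * H := by
        have h4 := abs_add_le (residShift α (fun i => ε i ω) (α + s * (δ * i)) k
          - residShift α (fun i => ε i ω) α k) (residShift α (fun i => ε i ω) α k)
        rw [sub_add_cancel] at h4
        have h5 : c * (s * |δ * (i : ℝ)|) * H ≤ A * (s * T) * H := by gcongr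
        linarith
      have h6 : |σ * (s * δ * (1 + 2 * A * H))| ≤ (1 + 2 * A) * s * H := by
        rw [abs_mul, abs_of_nonneg (show 0 ≤ s * δ * (1 + 2 * A * H) by positivity)]
        calc _ ≤ 1 * (s * 1 * (H + 2 * A * H)) := by gcongr
          _ = _ := by ring
      have h7 := (abs_add_le _ _).trans (add_le_add h3 h6)
      refine h7.trans ?_
      have h8 : 0 ≤ s * H := by positivity
      have h9 : 0 ≤ (ρ / r) ^ k * H := by positivity
      have h10 := mul_nonneg hA0 h9
      have h11 := mul_nonneg hAT h9
      rw [hB]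
      nlinarith
  have hsub : {ω | ¬ ∀ b ∈ ({0, 1} : Finset ℝ), ∀ σ ∈ ({-1, 1} : Finset ℝ),
      ∀ i ∈ Finset.Icc (-I : ℤ) I, ∀ j ∈ Finset.Icc (-(gridSize n) : ℤ) (gridSize n),
        |gridIncr α r A (cdf μ) (fun i => ε i ω) n δ b σ i j| ≤ lam}
      ⊆ ⋃ b ∈ ({0, 1} : Finset ℝ), ⋃ σ ∈ ({-1, 1} : Finset ℝ), ⋃ i ∈ Finset.Icc (-I : ℤ) I,
        ⋃ j ∈ Finset.Icc (-(gridSize n) : ℤ) (gridSize n),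
        {ω | lam < |gridIncr α r A (cdf μ) (fun i => ε i ω) n δ b σ i j|} := by
    intro ω hω
    simp only [Set.mem_ofPred_eq] at hω
    push Not at hω
    obtain ⟨b, hb, σ, hσ, i, hi, j, hj, hlt⟩ := hω
    simp only [Set.mem_iUnion]
    exact ⟨b, hb, σ, hσ, i, hi, j, hj, hlt⟩
  refine (measure_mono hsub).trans ?_
  set p := ENNReal.ofReal (C / n / lam ^ 4) with hp
  have hcard : ∀ m : ℕ, (Finset.Icc (-m : ℤ) m).card = 2 * m + 1 := fun m => by
    rw [Int.card_Icc]; omega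
  have c2 : ∀ a b : ℝ, (({a, b} : Finset ℝ).card : ℝ≥0∞) ≤ 2 := fun a b => by
    exact_mod_cast Finset.card_le_two
  calc _ ≤ ∑ b ∈ ({0, 1} : Finset ℝ), ∑ σ ∈ ({-1, 1} : Finset ℝ), ∑ i ∈ Finset.Icc (-I : ℤ) I,
        ∑ j ∈ Finset.Icc (-(gridSize n) : ℤ) (gridSize n), p := by
        refine (measure_biUnion_finset_le _ _).trans (Finset.sum_le_sum fun b hb => ?_)
        refine (measure_biUnion_finset_le _ _).trans (Finset.sum_le_sum fun σ hσ => ?_)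
        refine (measure_biUnion_finset_le _ _).trans (Finset.sum_le_sum fun i hi => ?_)
        refine (measure_biUnion_finset_le _ _).trans (Finset.sum_le_sum fun j hj => ?_)
        exact hpt b hb σ hσ i hi j
    _ ≤ 2 * (2 * (((2 * I + 1 : ℕ) : ℝ≥0∞) * (((2 * gridSize n + 1 : ℕ) : ℝ≥0∞) * p))) := by
        simp only [Finset.sum_const, nsmul_eq_mul, hcard]
        gcongr <;> exact c2 _ _
    _ = _ := by
        rw [ENNReal.ofReal_mul (by positivity), ← hp, ENNReal.ofReal_mul (by norm_num),
          ENNReal.ofReal_mul (by norm_num), ENNReal.ofReal_mul (by positivity)]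
        have e1 : ENNReal.ofReal (2 * (I : ℝ) + 1) = ((2 * I + 1 : ℕ) : ℝ≥0∞) := by
          rw [← ENNReal.ofReal_natCast]; push_cast; rfl
        have e2 : ENNReal.ofReal (2 * (gridSize n : ℝ) + 1) = ((2 * gridSize n + 1 : ℕ) : ℝ≥0∞) := by
          rw [← ENNReal.ofReal_natCast]; push_cast; rfl
        rw [e1, e2, show ENNReal.ofReal 2 = 2 by simp]
        ring

/-- The probability that the envelope leaves the range of the grid tends to zero. -/
theorem tendsto_measure_envelope (hε : IsInnovation P ε μ) (hr0 : 0 ≤ r) (hr1 : r < 1)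
    (hδ : 0 < δ) :
    Tendsto (fun n : ℕ => P {ω | ¬ ∀ k ≤ n, envelope r (fun i => ε i ω) k
      < (√(n : ℝ))⁻¹ * δ * ((gridSize n : ℝ) - 1)}) atTop (𝓝 0) := by
  obtain ⟨K, hK1, hK⟩ := hε.exists_envelope_moment hr0 hr1
  have hlim : Tendsto (fun n : ℕ => ENNReal.ofReal (2 * (K / δ ^ 8) / n)) atTop (𝓝 0) := by
    rw [← ENNReal.ofReal_zero]
    exact ENNReal.tendsto_ofReal (tendsto_const_div_atTop_nhds_zero_nat _)
  refine tendsto_of_tendsto_of_tendsto_of_le_of_le' tendsto_const_nhds hlim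
    (Eventually.of_forall fun _ => zero_le) ?_
  filter_upwards [eventually_ge_atTop 1] with n hn
  have hn1 : (1 : ℝ) ≤ n := by exact_mod_cast hn
  have hn0 : (0 : ℝ) < n := by linarith
  set t := δ * (n : ℝ) ^ (1 / 4 : ℝ) with ht
  have ht0 : 0 < t := by positivity
  -- Each of the n + 1 events has probability at most K/t⁸ = O(n⁻²), so their union is O(1/n).
  have ht8 : t ^ 8 = δ ^ 8 * (n : ℝ) ^ 2 := by
    rw [ht, mul_pow, ← Real.rpow_natCast ((n : ℝ) ^ (1 / 4 : ℝ)) 8, ← Real.rpow_mul hn0.le]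
    norm_num
  have hsub : {ω | ¬ ∀ k ≤ n, envelope r (fun i => ε i ω) k
      < (√(n : ℝ))⁻¹ * δ * ((gridSize n : ℝ) - 1)}
      ⊆ ⋃ k ∈ Finset.range (n + 1), {ω | t ^ 8 ≤ envelope r (fun i => ε i ω) k ^ 8} := by
    intro ω hω
    simp only [Set.mem_ofPred_eq] at hω
    push Not at hω
    obtain ⟨k, hk, hle⟩ := hω
    simp only [Set.mem_iUnion, Set.mem_ofPred_eq]
    exact ⟨k, Finset.mem_range.2 (by omega), pow_le_pow_left₀ ht0.le
      ((rpow_le_inv_sqrt_mul_gridSize hn hδ).trans hle) 8⟩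
  calc _ ≤ ∑ k ∈ Finset.range (n + 1), P {ω | t ^ 8 ≤ envelope r (fun i => ε i ω) k ^ 8} :=
        (measure_mono hsub).trans (measure_biUnion_finset_le _ _)
    _ ≤ ∑ k ∈ Finset.range (n + 1), ENNReal.ofReal (K / t ^ 8) :=
        Finset.sum_le_sum fun k _ => measure_ge_le_ofReal_div (fun ω => by positivity) (hK k).1
          (hK k).2 (by positivity)
    _ = ENNReal.ofReal ((n + 1) * (K / t ^ 8)) := by
        rw [Finset.sum_const, Finset.card_range, nsmul_eq_mul, ENNReal.ofReal_mul (by positivity),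
          ← ENNReal.ofReal_natCast]
        push_cast; rfl
    _ ≤ _ := by
        refine ENNReal.ofReal_le_ofReal ?_
        rw [ht8]
        calc (n + 1) * (K / (δ ^ 8 * (n : ℝ) ^ 2)) ≤ (2 * n) * (K / (δ ^ 8 * (n : ℝ) ^ 2)) := by
              gcongr; linarith
          _ = _ := by field_simp

end IsInnovation

namespace IsInnovation
variable {Ω : Type*} [MeasurableSpace Ω] {P : Measure Ω} {ε : ℤ → Ω → ℝ} {μ : Measure ℝ}
  [IsProbabilityMeasure P] {α ρ r lam : ℝ}

/-- K does not depend on δ or n, so δ can be chosen afterwards to make the probability small for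
every n ≥ 1. -/
theorem exists_measure_mean_sq_le (hε : IsInnovation P ε μ) (hr0 : 0 ≤ r) (hr1 : r < 1) :
    ∃ K : ℝ, 0 < K ∧ ∀ (n : ℕ) (δ lam : ℝ), 1 ≤ n → 0 < δ → 0 < lam →
      P {ω | lam ≤ δ * ((n : ℝ)⁻¹ * ∑ k ∈ Finset.range n, envelope r (fun i => ε i ω) k ^ 2)}
        ≤ ENNReal.ofReal (δ * K / lam) := by
  obtain ⟨K, hK1, hK⟩ := hε.exists_envelope_moment hr0 hr1
  refine ⟨K, by linarith, fun n δ lam hn hδ hlam => ?_⟩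
  have hn0 : (0 : ℝ) < n := by exact_mod_cast hn
  have h2 := hε.integrable_envelope_pow hr0 hK (show 2 ≤ 8 by norm_num)
  have hi := integrable_finsetSum (Finset.range n) fun k _ => (h2 k).1
  refine measure_ge_le_ofReal_div (fun ω => by positivity) ((hi.const_mul _).const_mul _) ?_ hlam
  rw [integral_const_mul, integral_const_mul, integral_finsetSum _ fun k _ => (h2 k).1]
  have : ∑ k ∈ Finset.range n, ∫ ω, envelope r (fun i => ε i ω) k ^ 2 ∂P ≤ n * K := by
    refine (Finset.sum_le_sum fun k _ => (h2 k).2).trans ?_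
    simp
  calc _ ≤ δ * ((n : ℝ)⁻¹ * (n * K)) := by gcongr
    _ = _ := by field_simp

theorem tendsto_inv_sqrt : Tendsto (fun n : ℕ => (√(n : ℝ))⁻¹) atTop (𝓝 0) :=
  tendsto_inv_atTop_zero.comp (Real.tendsto_sqrt_atTop.comp tendsto_natCast_atTop_atTop)

/-- The weights n⁻¹ + (ρ/r)^k have bounded sum, so the expectation is O(n^{-1/2}). -/
theorem tendsto_measure_fading (hε : IsInnovation P ε μ) (hρr : ρ < r) (hρ : 0 ≤ ρ) (hr1 : r < 1)
    (hlam : 0 < lam) :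
    Tendsto (fun n : ℕ => P {ω | lam ≤ (√(n : ℝ))⁻¹ * ∑ k ∈ Finset.range n,
      ((n : ℝ)⁻¹ + (ρ / r) ^ k) * (envelope r (fun i => ε i ω) k ^ 3
        + envelope r (fun i => ε i ω) (k + 1) ^ 3)}) atTop (𝓝 0) := by
  have hr0 : 0 < r := hρ.trans_lt hρr
  have hq0 : 0 ≤ ρ / r := by positivity
  have hq1 : ρ / r < 1 := (div_lt_one hr0).2 hρr
  obtain ⟨K, hK1, hK⟩ := hε.exists_envelope_moment hr0.le hr1
  have h3 := hε.integrable_envelope_pow hr0.le hK (show 3 ≤ 8 by norm_num)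
  have hlim : Tendsto (fun n : ℕ => ENNReal.ofReal
      ((√(n : ℝ))⁻¹ * ((1 + (1 - ρ / r)⁻¹) * (2 * K)) / lam)) atTop (𝓝 0) := by
    rw [← ENNReal.ofReal_zero]
    refine ENNReal.tendsto_ofReal ?_
    simpa using (tendsto_inv_sqrt.mul_const ((1 + (1 - ρ / r)⁻¹) * (2 * K))).div_const lam
  refine tendsto_of_tendsto_of_tendsto_of_le_of_le' tendsto_const_nhds hlim
    (Eventually.of_forall fun _ => zero_le) ?_
  filter_upwards [eventually_ge_atTop 1] with n hn
  have hn0 : (0 : ℝ) < n := by exact_mod_cast hn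
  have hi : ∀ k, Integrable (fun ω => ((n : ℝ)⁻¹ + (ρ / r) ^ k) *
      (envelope r (fun i => ε i ω) k ^ 3 + envelope r (fun i => ε i ω) (k + 1) ^ 3)) P :=
    fun k => ((h3 k).1.add (h3 (k + 1)).1).const_mul _
  have hH : ∀ k ω, 0 ≤ envelope r (fun i => ε i ω) k :=
    fun k ω => zero_le_one.trans (one_le_envelope hr0.le k)
  refine measure_ge_le_ofReal_div (fun ω => ?_)
    ((integrable_finsetSum _ fun k _ => hi k).const_mul _) ?_ hlam
  · refine mul_nonneg (by positivity) (Finset.sum_nonneg fun k _ => ?_)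
    have := hH k ω
    have := hH (k + 1) ω
    positivity
  · rw [integral_const_mul, integral_finsetSum _ fun k _ => hi k]
    refine mul_le_mul_of_nonneg_left ?_ (by positivity)
    have hgeo : ∑ k ∈ Finset.range n, ((n : ℝ)⁻¹ + (ρ / r) ^ k) ≤ 1 + (1 - ρ / r)⁻¹ := by
      rw [Finset.sum_add_distrib, Finset.sum_const, Finset.card_range, nsmul_eq_mul,
        mul_inv_cancel₀ hn0.ne', ← tsum_geometric_of_lt_one hq0 hq1]
      gcongr
      exact (summable_geometric_of_lt_one hq0 hq1).sum_le_tsum _ fun k _ => by positivity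
    calc _ ≤ ∑ k ∈ Finset.range n, ((n : ℝ)⁻¹ + (ρ / r) ^ k) * (2 * K) := by
          refine Finset.sum_le_sum fun k _ => ?_
          rw [integral_const_mul, integral_add (h3 k).1 (h3 (k + 1)).1]
          have h1 := (h3 k).2
          have h2 := (h3 (k + 1)).2
          gcongr
          linarith
      _ ≤ _ := by rw [← Finset.sum_mul]; gcongr

theorem tendsto_measure_boundary (hε : IsInnovation P ε μ) (hr0 : 0 ≤ r) (hr1 : r < 1)
    (hlam : 0 < lam) :
    Tendsto (fun n : ℕ => P {ω | lam ≤ (√(n : ℝ))⁻¹ *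
      (envelope r (fun i => ε i ω) 0 ^ 2 + envelope r (fun i => ε i ω) n ^ 2)}) atTop (𝓝 0) := by
  obtain ⟨K, hK1, hK⟩ := hε.exists_envelope_moment hr0 hr1
  have h2 := hε.integrable_envelope_pow hr0 hK (show 2 ≤ 8 by norm_num)
  have hlim : Tendsto (fun n : ℕ => ENNReal.ofReal ((√(n : ℝ))⁻¹ * (2 * K) / lam)) atTop
      (𝓝 0) := by
    rw [← ENNReal.ofReal_zero]
    refine ENNReal.tendsto_ofReal ?_
    simpa using (tendsto_inv_sqrt.mul_const (2 * K)).div_const lam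
  refine tendsto_of_tendsto_of_tendsto_of_le_of_le tendsto_const_nhds hlim (fun _ => zero_le)
    fun n => ?_
  refine measure_ge_le_ofReal_div (fun ω => by positivity)
    (((h2 0).1.add (h2 n).1).const_mul _) ?_ hlam
  rw [integral_const_mul, integral_add (h2 0).1 (h2 n).1]
  refine mul_le_mul_of_nonneg_left ?_ (by positivity)
  linarith [(h2 0).2, (h2 n).2]

theorem tendsto_measure_quadratic (hε : IsInnovation P ε μ) (hr0 : 0 ≤ r) (hr1 : r < 1) {B p : ℝ}
    (hB : 0 < B) {Y : ℕ → Ω → ℝ} (hYm : ∀ k, Measurable[hε.past k] (Y k))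
    (hY : ∀ k ω, |Y k ω| ≤ B * envelope r (fun i => ε i ω) k) (hlam : 0 < lam) :
    Tendsto (fun n : ℕ => P {ω | lam < |∑ k ∈ Finset.range n, (n : ℝ)⁻¹ *
      (p * (ε ((k + 1 : ℕ) : ℤ) ω ^ 2 - ∫ x, x ^ 2 ∂μ) + Y k ω * ε ((k + 1 : ℕ) : ℤ) ω)|})
      atTop (𝓝 0) := by
  obtain ⟨C, hC⟩ := hε.exists_integral_quadratic_pow_four_le (p := p) hr0 hr1 hB hYm hY
  have hlim : Tendsto (fun n : ℕ => ENNReal.ofReal (C / n / lam ^ 4)) atTop (𝓝 0) := by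
    rw [← ENNReal.ofReal_zero]
    refine ENNReal.tendsto_ofReal ?_
    simpa using (tendsto_const_div_atTop_nhds_zero_nat C).div_const (lam ^ 4)
  refine tendsto_of_tendsto_of_tendsto_of_le_of_le' tendsto_const_nhds hlim
    (Eventually.of_forall fun _ => zero_le) ?_
  filter_upwards [eventually_ge_atTop 1] with n hn
  exact measure_lt_abs_le_ofReal_div (hC n hn).1 (hC n hn).2 hlam

/-- Outside an event of small probability all remainders are small. -/
theorem eventually_measure_not_smallRemainders_le (hε : IsInnovation P ε μ) (hρr : ρ < r)
    (hr1 : r < 1) (hρ : 0 ≤ ρ) (hα : |α| ≤ ρ) (hlam : 0 < lam) {η : ℝ≥0∞} (hη : 0 < η) :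
    ∃ δ : ℝ, 0 < δ ∧ δ ≤ 1 ∧ ∀ᶠ n : ℕ in atTop,
      P {ω | ¬ SmallRemainders α ρ r (∫ x, x ^ 2 ∂μ) δ lam n fun i => ε i ω} ≤ η := by
  have hα1 : |α| ≤ 1 := hα.trans (hρr.le.trans hr1.le)
  have hr0 : 0 < r := hρ.trans_lt hρr
  have hc : 0 < (r - ρ)⁻¹ := inv_pos.2 (sub_pos.2 hρr)
  have hη2 : 0 < η / 2 := ENNReal.half_pos hη.ne'
  obtain ⟨K, hK0, hK⟩ := hε.exists_measure_mean_sq_le hr0.le hr1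
  obtain ⟨x, hx0, hx⟩ : ∃ x : ℝ, 0 < x ∧ ENNReal.ofReal x ≤ η / 2 := by
    obtain ⟨x, _, hx1, hx2⟩ := ENNReal.lt_iff_exists_real_btwn.1 hη2
    exact ⟨x, ENNReal.ofReal_pos.1 hx1, hx2.le⟩
  -- The mesh makes the mean-square event have probability at most η/2; the remaining events vanish
  -- as n grows.
  refine ⟨min 1 (x * lam / K), by positivity, min_le_left _ _, ?_⟩
  set δ := min 1 (x * lam / K) with hδ
  have hδ0 : 0 < δ := by positivity
  have hδK : δ * K / lam ≤ x := by
    rw [div_le_iff₀ hlam]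
    calc δ * K ≤ x * lam / K * K := by gcongr; exact min_le_right _ _
      _ = x * lam := by field_simp
  have hq := hε.tendsto_measure_quadratic (p := 1) (B := 2 * (r - ρ)⁻¹) (lam := lam) hr0.le hr1
    (by positivity) (Y := fun k ω => 2 * α * score α (fun i => ε i ω) α k)
    (fun k => (hε.measurable_score α α k).const_mul (2 * α)) (fun k ω => by
      rw [abs_mul, abs_mul, abs_two]
      calc 2 * |α| * |score α (fun i => ε i ω) α k|
          ≤ 2 * 1 * ((r - ρ)⁻¹ * envelope r (fun i => ε i ω) k) := by
            gcongr
            exact (abs_residualDeriv_le hρr hr1.le hρ hα1 hα k).2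
        _ = _ := by ring) hlam
  have hl := hε.tendsto_measure_quadratic (p := 0) (B := 1) (lam := lam) hr0.le hr1 one_pos
    (Y := fun _ _ => 1) (fun k => measurable_const)
    (fun k ω => by simpa using one_le_envelope hr0.le k) hlam
  have hsum := ((hε.tendsto_measure_fading hρr hρ hr1 hlam).add
    (hε.tendsto_measure_boundary hr0.le hr1 hlam)).add (hq.add hl)
  simp only [add_zero] at hsum
  filter_upwards [hsum.eventually_le_const hη2, eventually_ge_atTop 1] with n hn1 hn
  have h1 := (hK n δ lam hn hδ0 hlam).trans ((ENNReal.ofReal_le_ofReal hδK).trans hx)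
  refine le_trans ?_ ((add_le_add h1 hn1).trans (ENNReal.add_halves η).le)
  refine le_trans (measure_mono fun ω hω => ?_) ((measure_union_le _ _).trans (add_le_add le_rfl
    ((measure_union_le _ _).trans (add_le_add (measure_union_le _ _) (measure_union_le _ _)))))
  simp only [Set.mem_union, Set.mem_ofPred_eq] at hω ⊢
  by_contra hcon
  push Not at hcon
  obtain ⟨a1, ⟨a2, a3⟩, a4, a5⟩ := hcon
  exact hω ⟨a1.le, a2.le, a3.le, a4, a5⟩

/-! ### Conclusion -/

/-- The local increments converge in probability to their drift, uniformly. -/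
theorem tendsto_measure_localIncr (hε : IsInnovation P ε μ) (hα : |α| < 1) {g : ℝ → ℝ}
    (hμ : μ = volume.withDensity fun x => ENNReal.ofReal (g x)) (hg0 : ∀ x, 0 ≤ g x)
    (hg_lim : Tendsto g atTop (𝓝 0)) (hg : Differentiable ℝ g) {C : ℝ}
    (hC : ∀ x, |deriv g x| ≤ C) {Θ : ℝ} (hΘ : 0 ≤ Θ) {δ : ℝ≥0∞} (hδ : 0 < δ) :
    Tendsto (fun n : ℕ => P {ω | δ ≤ ⨆ (x : ℝ) (τ : ℝ) (_ : |τ| ≤ Θ),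
      ENNReal.ofReal |localIncr α (fun i => ε i ω) n x τ
        + τ * g x * ((∫ x, x ^ 2 ∂μ) / (1 - α ^ 2))|}) atTop (𝓝 0) := by
  have : IsProbabilityMeasure μ := hε.isProbabilityMeasure
  have hC0 : 0 ≤ C := (abs_nonneg _).trans (hC 0)
  -- The gap between |α| and ρ accommodates α + n^{-1/2} τ for large n; the gap between ρ and r pays
  -- for the envelope recursions.
  obtain ⟨ρ, hαρ, hρ1⟩ := exists_between hα
  obtain ⟨r, hρr, hr1⟩ := exists_between hρ1
  have hρ : 0 ≤ ρ := (abs_nonneg α).trans hαρ.le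
  have hr0 : 0 < r := hρ.trans_lt hρr
  have hLip := abs_cdf_sub_le hμ hg0 hg hC
  have hTay := abs_cdf_taylor_le hμ hg0 hg hC
  have hgM := density_le hμ hg0 hg hC
  set σ2 := ∫ x, x ^ 2 ∂μ
  -- The ceiling in I gives h I ≤ Θ + 2h, and h ≤ 1.
  set T := Θ + 2 with hT
  set A := 2 * (r - ρ)⁻¹ ^ 2 with hA
  set L := 2 * (r - ρ)⁻¹ ^ 2 * T ^ 2 with hL
  set M := 1 + C with hM
  obtain ⟨D, hD⟩ : ∃ D, D = 2 * (1 + (2 * A * M * (2 + 2 * (2 * A)) + 2 * A))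
        + (12 * (1 - ρ)⁻¹ ^ 4 * T + 2 * ((1 - ρ)⁻¹ ^ 2 + (r - ρ)⁻¹ * (1 - ρ)⁻¹)
        + T * M * ((1 - α ^ 2)⁻¹ * (3 + (r - ρ)⁻¹ ^ 2 + 2 * (r - ρ)⁻¹))
        + (2 * M * L ^ 2 + 2 * C * L ^ 3)) + T * |σ2 / (1 - α ^ 2)| := ⟨_, rfl⟩
  -- A finite level strictly below δ, so that a supremum bounded by it contradicts δ ≤ sup; δ may be
  -- infinite.
  obtain ⟨y, hy0, hy⟩ : ∃ y : ℝ, 0 < y ∧ ENNReal.ofReal y < δ := by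
    obtain ⟨y, _, hy1, hy2⟩ := ENNReal.lt_iff_exists_real_btwn.1 hδ
    exact ⟨y, ENNReal.ofReal_pos.1 hy1, hy2⟩
  obtain ⟨lam, hlam, hDlam⟩ : ∃ lam : ℝ, 0 < lam ∧ D * lam ≤ y := by
    refine ⟨y / (|D| + 1), by positivity, ?_⟩
    rw [← mul_div_assoc, div_le_iff₀ (by positivity)]
    nlinarith [le_abs_self D]
  have hθ : ∀ᶠ n : ℕ in atTop, ∀ τ, |τ| ≤ T → |α + (√(n : ℝ))⁻¹ * τ| ≤ ρ := by
    have h1 : Tendsto (fun n : ℕ => |α| + (√(n : ℝ))⁻¹ * T) atTop (𝓝 (|α| + 0 * T)) :=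
      (tendsto_inv_sqrt.mul_const T).const_add _
    rw [zero_mul, add_zero] at h1
    filter_upwards [h1.eventually_le_const hαρ] with n hn τ hτ
    refine (abs_add_le _ _).trans (le_trans ?_ hn)
    rw [abs_mul, abs_of_nonneg (show 0 ≤ (√(n : ℝ))⁻¹ by positivity)]
    gcongr
  rw [ENNReal.tendsto_nhds_zero]
  intro η hη
  have hη2 : 0 < η / 2 := ENNReal.half_pos hη.ne'
  obtain ⟨h, hh0, hh1, hsmall⟩ := hε.eventually_measure_not_smallRemainders_le (α := α) hρr hr1 hρ
    hαρ.le hlam hη2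
  set I := ⌈Θ / h + 1⌉₊ with hIdef
  have hI : Θ / h + 1 ≤ I := Nat.le_ceil _
  have hIT : h * I ≤ T := by
    have := (Nat.ceil_lt_add_one (show 0 ≤ Θ / h + 1 by positivity)).le
    calc h * I ≤ h * (Θ / h + 1 + 1) := by gcongr
      _ = Θ + 2 * h := by field_simp; ring
      _ ≤ T := by linarith
  have hgrid := hε.tendsto_measure_gridIncr hρr hr1 hρ hαρ.le hA (by positivity) hLip hh0 hh1 hlam
    (by positivity) hIT hθ
  have hsum := hgrid.add (hε.tendsto_measure_envelope hr0.le hr1 hh0)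
  rw [add_zero] at hsum
  have hgx : ∀ᶠ n : ℕ in atTop, ∀ x, (√(n : ℝ))⁻¹ * h * ((gridSize n : ℝ) - 1) ≤ |x| →
      g x ≤ lam := by
    obtain ⟨R1, hR1⟩ := eventually_atTop.1 (hg_lim.eventually_le_const hlam)
    obtain ⟨R2, hR2⟩ := eventually_atBot.1
      ((tendsto_density_atBot hμ hg0 hg hC).eventually_le_const hlam)
    have hinf : Tendsto (fun n : ℕ => h * (n : ℝ) ^ (1 / 4 : ℝ)) atTop atTop :=
      Tendsto.const_mul_atTop hh0
        ((tendsto_rpow_atTop (by norm_num)).comp tendsto_natCast_atTop_atTop)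
    filter_upwards [hinf.eventually_ge_atTop (max R1 (-R2)), eventually_ge_atTop 1] with n h1 hn x hx
    have h2 := (h1.trans (rpow_le_inv_sqrt_mul_gridSize hn hh0)).trans hx
    rcases le_abs.1 h2 with h3 | h3
    · exact hR1 x ((le_max_left _ _).trans h3)
    · exact hR2 x (by linarith [le_max_right R1 (-R2)])
  filter_upwards [hsmall, hsum.eventually_le_const hη2, hθ, hgx, eventually_ge_atTop 1]
    with n h1 h2 h3 h4 hn
  refine le_trans ?_ ((add_le_add h1 h2).trans (ENNReal.add_halves η).le)
  -- Only monotonicity and subadditivity of P are used, so the supremum need not be measurable.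
  refine le_trans (measure_mono fun ω hω => ?_) ((measure_union_le _ _).trans (add_le_add le_rfl
    (measure_union_le _ _)))
  simp only [Set.mem_union, Set.mem_ofPred_eq] at hω ⊢
  by_contra hcon
  rw [not_or, not_or, not_not, not_not, not_not] at hcon
  obtain ⟨a1, a2, a3⟩ := hcon
  refine absurd (hω.trans (iSup_le fun x => iSup_le fun τ => iSup_le fun hτ => ?_)) hy.not_ge
  refine ENNReal.ofReal_le_ofReal (le_trans ?_ hDlam)
  rw [hD]
  exact abs_localIncr_add_le a1 (cdf_nonneg μ) (cdf_le_one μ) hLip hg0 hgM hTay hC0 hρr hr1.le hρ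
    hαρ.le hn hh0 hΘ (by linarith) (by linarith) hI h3 hA hL a2 a3 h4 hτ x

end IsInnovation

theorem theorem1 {Ω : Type*} [MeasurableSpace Ω] (P : Measure Ω) [IsProbabilityMeasure P]
    (ε : ℤ → Ω → ℝ) (hε_meas : ∀ i, Measurable (ε i))
    (hε_indep : iIndepFun ε P) (hε_ident : ∀ i, IdentDistrib (ε i) (ε 1) P P)
    (hε_mean : ∫ ω, ε 1 ω ∂P = 0)
    (hε_moment : Integrable (fun ω => ε 1 ω ^ 8) P)
    (α : ℝ) (hα : |α| < 1)
    (g : ℝ → ℝ)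
    (hg_density : P.map (ε 1) = volume.withDensity (fun x => ENNReal.ofReal (g x)))
    (hg_pos : ∀ x, 0 < g x)
    (hg_lim : Tendsto g atTop (𝓝 0))
    (hg_diff : Differentiable ℝ g)
    (hg_deriv : ∃ C : ℝ, ∀ x, |deriv g x| ≤ C)
    (Θ : ℝ) (hΘ : 0 < Θ) :
    ∀ δ : ℝ≥0∞, 0 < δ →
      Tendsto
        (fun n : ℕ => P {ω | δ ≤ ⨆ (x : ℝ) (τ : ℝ) (_ : |τ| ≤ Θ),
          ENNReal.ofReal
            |√(n : ℝ) * (residualProcess (maObs α (fun i => ε i ω)) n x (α + τ / √(n : ℝ))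
                - innovationProcess α (fun i => ε i ω) n x)
              + τ * g x * ((∫ ω', ε 1 ω' ^ 2 ∂P) / (1 - α ^ 2))|})
        atTop (𝓝 0) := by
  intro δ hδ
  obtain ⟨C, hC⟩ := hg_deriv
  have h1 := (hε_meas 1).aemeasurable (μ := P)
  have hinn : IsInnovation P ε (P.map (ε 1)) := by
    refine ⟨hε_meas, hε_indep.precomp Nat.cast_injective, fun i => (hε_ident i).map_eq, ?_, ?_⟩
    · rw [integral_map h1 (by fun_prop)]; exact hε_mean
    · exact (integrable_map_measure (by fun_prop) h1).2 hε_moment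
  have hσ : ∫ x, x ^ 2 ∂(P.map (ε 1)) = ∫ ω, ε 1 ω ^ 2 ∂P := integral_map h1 (by fun_prop)
  have hmain := hinn.tendsto_measure_localIncr hα hg_density (fun x => (hg_pos x).le) hg_lim hg_diff
    hC hΘ.le hδ
  rw [hσ] at hmain
  refine hmain.congr' ?_
  filter_upwards [eventually_ge_atTop 1] with n hn
  simp only [sqrt_mul_process_sub _ _ hn]
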